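/- On the two-particle space $L^2(\mathbb R^3\times\mathbb R^3;\mathbb C)$, with variables $x_1,x_2\in\mathbb R^3$ and $p_j=-i\nabla_{x_j}$, let $S_j=(1+p_j^2)^{1/4}=(1-\Delta_{x_j})^{1/4}$ for $j=1,2$, with real powers $S_j^{s}=(1+p_j^2)^{s/4}$. Let $V_{1,2}$ and, for $\varepsilon>0$ and an integer $N\ge 1$, $V^{\varepsilon}_{1,2}$ be the operators of multiplication by $|x_1-x_2|^{-1}$ and by $(|x_1-x_2|+\varepsilon N^{-1})^{-1}$. Operator inequalities are in the sense of quadratic forms. Products of unbounded operators are taken on their natural domain; such a product is called bounded, with norm at most $C$, if this domain is dense and the bound holds on it. (i) For every real $a<3$ there is a constant $C(a)<\infty$, depending only on $a$, such that $$\frac{1}{|x_1-x_2|^{a}}\le C(a)\,S_1^{\alpha}S_2^{\beta}\qquad\text{for all }\alpha,\beta>0\text{ with }\alpha+\beta=2a .$$ If $a=1$, the constant can be taken to be $\pi/2$: $V_{1,2}\le \frac{\pi}{2}S_1^{\alpha}S_2^{\beta}$ for all $\alpha,\beta>0$ with $\alpha+\beta=2$; and this is sharp: for any such $\alpha,\beta$,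 if $V_{1,2}\le c\,S_1^{\alpha}S_2^{\beta}$ for a real number $c$, then $c\ge\pi/2$. (ii) The operator $S_1S_2^{-1}V_{1,2}S_1^{-1}S_2^{-1}$ is bounded, and there is a constant $C<\infty$ with $\|S_1S_2^{-1}V^{\varepsilon}_{1,2}S_1^{-1}S_2^{-1}\|\le C$ for all $\varepsilon>0$ and all integers $N\ge1$. (iii) For every $\delta>0$ there is a constant $C_\delta<\infty$ such that $$\|S_1^{-2}S_2^{-1}V^{\varepsilon}_{1,2}S_2\|\le C_\delta\,\varepsilon^{-\delta}N^{\delta}$$ for all $\varepsilon>0$ and all integers $N\ge1$, where in the case $\delta>1$ it is assumed in addition that $\varepsilon\le N$. -/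

import Mathlib

open MeasureTheory
open scoped ENNReal FourierTransform

noncomputable section

namespace TwoParticle

/-- The one-particle configuration space `ℝ³` (Euclidean norm). -/
abbrev Space : Type := EuclideanSpace ℝ (Fin 3)

/-- The two-particle configuration space `ℝ³ × ℝ³ = ℝ⁶` (Euclidean norm). A point is `x = (x₁, x₂)`
with `x₁ = x.fst` and `x₂ = x.snd`. -/
abbrev Config : Type := WithLp 2 (Space × Space)

/-- The two-particle Hilbert space `L²(ℝ⁶; ℂ)` with Lebesgue measure. -/
abbrev Hilb : Type := Lp (α := Config) ℂ 2 (volume : Measure Config)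

section Multiplication

variable {X : Type*} [MeasurableSpace X] {μ : Measure X}

theorem mul_coe_add (m : X → ℝ) (ψ φ : Lp ℂ 2 μ) :
    (fun x => (m x : ℂ) * (ψ + φ : Lp ℂ 2 μ) x) =ᵐ[μ]
      (fun x => (m x : ℂ) * ψ x) + fun x => (m x : ℂ) * φ x := by
  filter_upwards [Lp.coeFn_add ψ φ] with x hx
  rw [hx, Pi.add_apply, Pi.add_apply, mul_add]

theorem mul_coe_smul (m : X → ℝ) (c : ℂ) (ψ : Lp ℂ 2 μ) :
    (fun x => (m x : ℂ) * (c • ψ : Lp ℂ 2 μ) x) =ᵐ[μ] c • fun x => (m x : ℂ) * ψ x := by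
  filter_upwards [Lp.coeFn_smul c ψ] with x hx
  rw [hx, Pi.smul_apply, Pi.smul_apply, smul_eq_mul, smul_eq_mul, mul_left_comm]

theorem mul_coe_zero (m : X → ℝ) :
    (fun x => (m x : ℂ) * (0 : Lp ℂ 2 μ) x) =ᵐ[μ] (0 : X → ℂ) := by
  filter_upwards [Lp.coeFn_zero ℂ 2 μ] with x hx
  simp only [hx, Pi.zero_apply, mul_zero]

/-- The domain `{ψ ∈ L² | m ψ ∈ L²}` of multiplication by the real function `m`. -/
def mulDomain (μ : Measure X) (m : X → ℝ) : Submodule ℂ (Lp ℂ 2 μ) where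
  carrier := {ψ | MemLp (fun x => (m x : ℂ) * ψ x) 2 μ}
  zero_mem' := (memLp_congr_ae (mul_coe_zero m)).2 MemLp.zero
  add_mem' := fun {ψ φ} hψ hφ => (memLp_congr_ae (mul_coe_add m ψ φ)).2 (MemLp.add hψ hφ)
  smul_mem' := fun c ψ hψ => (memLp_congr_ae (mul_coe_smul m c ψ)).2 (MemLp.const_smul hψ c)

theorem mem_mulDomain {m : X → ℝ} {ψ : Lp ℂ 2 μ} :
    ψ ∈ mulDomain μ m ↔ MemLp (fun x => (m x : ℂ) * ψ x) 2 μ := Iff.rfl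

theorem toLp_mul_coe_add (m : X → ℝ) (ψ φ : Lp ℂ 2 μ)
    (h : MemLp (fun x => (m x : ℂ) * (ψ + φ : Lp ℂ 2 μ) x) 2 μ)
    (hψ : MemLp (fun x => (m x : ℂ) * ψ x) 2 μ) (hφ : MemLp (fun x => (m x : ℂ) * φ x) 2 μ) :
    h.toLp _ = hψ.toLp _ + hφ.toLp _ := by
  rw [← MemLp.toLp_add hψ hφ, MemLp.toLp_eq_toLp_iff]
  exact mul_coe_add m ψ φ

theorem toLp_mul_coe_smul (m : X → ℝ) (c : ℂ) (ψ : Lp ℂ 2 μ)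
    (h : MemLp (fun x => (m x : ℂ) * (c • ψ : Lp ℂ 2 μ) x) 2 μ)
    (hψ : MemLp (fun x => (m x : ℂ) * ψ x) 2 μ) :
    h.toLp _ = c • hψ.toLp _ := by
  rw [← MemLp.toLp_const_smul c hψ, MemLp.toLp_eq_toLp_iff]
  exact mul_coe_smul m c ψ

/-- The maximal operator of multiplication by the real function `m`: its domain consists of all
`ψ ∈ L²` with `m ψ ∈ L²`. -/
def mulOp (μ : Measure X) (m : X → ℝ) : Lp ℂ 2 μ →ₗ.[ℂ] Lp ℂ 2 μ where
  domain := mulDomain μ m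
  toFun :=
    { toFun := fun ψ => MemLp.toLp (fun x => (m x : ℂ) * (ψ : Lp ℂ 2 μ) x) (mem_mulDomain.1 ψ.2)
      map_add' := fun ψ φ => toLp_mul_coe_add m (ψ : Lp ℂ 2 μ) (φ : Lp ℂ 2 μ)
        (mem_mulDomain.1 (ψ + φ).2) (mem_mulDomain.1 ψ.2) (mem_mulDomain.1 φ.2)
      map_smul' := fun c ψ => toLp_mul_coe_smul m c (ψ : Lp ℂ 2 μ)
        (mem_mulDomain.1 (c • ψ).2) (mem_mulDomain.1 ψ.2) }

end Multiplication

/-- The composition `T ∘ R` of two unbounded operators on its natural domain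
`{ψ ∈ D(R) | R ψ ∈ D(T)}`. -/
def opComp (T R : Hilb →ₗ.[ℂ] Hilb) : Hilb →ₗ.[ℂ] Hilb :=
  T.comp (R.domRestrict ((T.domain.comap R.toFun).map R.domain.subtype)) (by
    rintro ⟨ψ, hψ⟩
    obtain ⟨⟨φ, hφT, rfl⟩, h2⟩ := hψ
    exact hφT)

/-- The function `m(p)` of the momentum operators `p = (p₁, p₂)`, `p_j = -i∇_j`. In the
normalization `f̂(ξ) = ∫ f(x) e^{-2πi⟨x,ξ⟩} dx` of the unitary Fourier transform, `p` acts as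
multiplication by `2πξ`. The domain is `{ψ | m(2πξ) ψ̂(ξ) ∈ L²}`. -/
def momentumOp (m : Config → ℝ) : Hilb →ₗ.[ℂ] Hilb where
  domain := (mulOp volume fun ξ : Config => m ((2 * Real.pi) • ξ)).domain.comap
    (Lp.fourierTransformₗᵢ Config ℂ).toLinearEquiv.toLinearMap
  toFun := (Lp.fourierTransformₗᵢ Config ℂ).symm.toLinearEquiv.toLinearMap ∘ₗ
    (mulOp volume fun ξ : Config => m ((2 * Real.pi) • ξ)).toFun ∘ₗ
      (Lp.fourierTransformₗᵢ Config ℂ).toLinearEquiv.toLinearMap.restrict (fun _ hψ => hψ)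

/-- `S₁ ^ s = (1 + p₁²)^{s/4} = (1 - Δ₁)^{s/4}`. -/
def S₁ (s : ℝ) : Hilb →ₗ.[ℂ] Hilb := momentumOp fun p => (1 + ‖p.fst‖ ^ 2) ^ (s / 4)

/-- `S₂ ^ s = (1 + p₂²)^{s/4} = (1 - Δ₂)^{s/4}`. -/
def S₂ (s : ℝ) : Hilb →ₗ.[ℂ] Hilb := momentumOp fun p => (1 + ‖p.snd‖ ^ 2) ^ (s / 4)

/-- The Coulomb potential `V(x) = |x|⁻¹`. -/
def V (x : Space) : ℝ := ‖x‖⁻¹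

/-- The regularized Coulomb potential `V^ε(x) = (|x| + ε N⁻¹)⁻¹`. -/
def Vreg (ε : ℝ) (N : ℕ) (x : Space) : ℝ := (‖x‖ + ε * (N : ℝ)⁻¹)⁻¹

/-- The operator `V₁₂` of multiplication by `V(x₁ - x₂)`. -/
def V₁₂ : Hilb →ₗ.[ℂ] Hilb := mulOp volume fun x => V (x.fst - x.snd)

/-- The operator `V^ε₁₂` of multiplication by `V^ε(x₁ - x₂)`. -/
def Vreg₁₂ (ε : ℝ) (N : ℕ) : Hilb →ₗ.[ℂ] Hilb :=
  mulOp volume fun x => Vreg ε N (x.fst - x.snd)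

/-- The quadratic form `(ψ, m(x) ψ)` of multiplication by `m ≥ 0`, with the value `∞` outside the
form domain. -/
def posForm (m : Config → ℝ) (ψ : Hilb) : ℝ≥0∞ :=
  ∫⁻ x, ENNReal.ofReal (m x) * ‖ψ x‖ₑ ^ 2 ∂(volume : Measure Config)

/-- The quadratic form `(ψ, m(p) ψ)` of the function `m(p)`, `m ≥ 0`, of the momentum operators,
with the value `∞` outside the form domain. -/
def momentumForm (m : Config → ℝ) (ψ : Hilb) : ℝ≥0∞ :=
  posForm (fun ξ => m ((2 * Real.pi) • ξ)) (Lp.fourierTransformₗᵢ Config ℂ ψ)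

/-- The operator inequality `m(x₁, x₂) ≤ c S₁^α S₂^β` in the sense of quadratic forms: every `ψ`
in the form domain of the right hand side is in that of the left hand side, and
`(ψ, m ψ) ≤ c (ψ, S₁^α S₂^β ψ)`. -/
def LeSS (m : Config → ℝ) (c α β : ℝ) : Prop :=
  ∀ ψ : Hilb, posForm m ψ ≤ ENNReal.ofReal c *
    momentumForm (fun p => (1 + ‖p.fst‖ ^ 2) ^ (α / 4) * (1 + ‖p.snd‖ ^ 2) ^ (β / 4)) ψ

/-- `T` is densely defined and bounded with `‖T‖ ≤ C`. -/
def NormLE (T : Hilb →ₗ.[ℂ] Hilb) (C : ℝ) : Prop :=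
  Dense (T.domain : Set Hilb) ∧ ∀ ψ : T.domain, ‖T ψ‖ ≤ C * ‖(ψ : Hilb)‖

/-- `S₁ S₂⁻¹ W S₁⁻¹ S₂⁻¹`. -/
def sandwichA (W : Hilb →ₗ.[ℂ] Hilb) : Hilb →ₗ.[ℂ] Hilb :=
  opComp (S₁ 1) (opComp (S₂ (-1)) (opComp W (opComp (S₁ (-1)) (S₂ (-1)))))

/-- `S₁⁻² S₂⁻¹ W S₂`. -/
def sandwichB (W : Hilb →ₗ.[ℂ] Hilb) : Hilb →ₗ.[ℂ] Hilb :=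
  opComp (S₁ (-2)) (opComp (S₂ (-1)) (opComp W (S₂ 1)))

end TwoParticle

end

/-! In momentum space a function of x₁ - x₂ acts by convolution along the shifts (k, -k), which
preserve the total momentum. All the potentials here are mixtures ∫ exp(-πu|y|²) dμ(u) with μ
positive. The convolution kernel `mixKer μ` is therefore positive, and |⟨ψ, Wφ⟩| is at most the
positive form `bil` of |ψ̂| and |φ̂|, with equality when φ = ψ and ψ̂ ≥ 0. Gaussians reduce all
Fourier analysis of singular potentials to Tonelli and Fubini. For |y|^(-a) the kernel is a multiple
of |k|^(a-3).

The form `bil` is bounded by a Schur test (`bil_schur`) with weights |ξ₁|^(-θZ)|ξ₂|^(-(1-θ)Z).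
Hölder in k separates the two particles and leaves convolutions of powers on ℝ³, which
`lintegral_rpow_mul_rpow` evaluates exactly. The result, `bil_rpow_le`, carries all upper bounds.
For (i) it remains to drop the 1 in 1 + p². When a = 1 the constants combine to π⁻¹ · π³ / (2π) =
π/2.

For sharpness the trial functions have transform |ξ₁|^(-2) on a large spherical shell, with |ξ₁ +
ξ₂| ≤ 1. There ξ₂ is close to -ξ₁, so the symbol of S₁^α S₂^β is close to 2π|ξ₁| whatever α and β
are. Both forms grow logarithmically in the ratio of the radii, and their quotient tends to π/2.

For (ii) and (iii), duality (`lintegral_mul_sq_le_of_inner`) turns an operator norm into a bound on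
`bil` with symbols as weights. Since `symb 1` is Hölder continuous of order 1/2, the positive power
of S_j can be moved through the shift, where it cancels an inverse power; the error costs a factor
|k|^(1/2) in the kernel (`bil_split`). In (ii) both resulting terms are within reach of the Schur
test. In (iii) the error term lies exactly at its endpoint, so the kernel of the regularized
potential is first bounded by a multiple of η^(-δ)|k|^(-2-δ), where η = ε/N. -/

noncomputable section

namespace TwoParticle

/-! ### One-dimensional integrals -/

theorem setLIntegral_Ioi_scale (f : ℝ → ℝ≥0∞) {c : ℝ} (hc : 0 < c) :
    ∫⁻ u in Set.Ioi 0, f u = ∫⁻ w in Set.Ioi 0, ENNReal.ofReal c * f (c * w) := by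
  have himg : (fun w => c * w) '' Set.Ioi (0 : ℝ) = Set.Ioi 0 := by
    ext u
    simp only [Set.mem_image, Set.mem_Ioi]
    refine ⟨?_, fun hu => ⟨u / c, div_pos hu hc, by field_simp⟩⟩
    rintro ⟨w, hw, rfl⟩
    positivity
  have h := lintegral_image_eq_lintegral_abs_deriv_mul (s := Set.Ioi (0 : ℝ))
    (f := fun w => c * w) (f' := fun _ => c) measurableSet_Ioi
    (fun x _ => by simpa using ((hasDerivAt_id x).const_mul c).hasDerivWithinAt)
    (fun x _ y _ hxy => mul_left_cancel₀ hc.ne' hxy) f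
  rw [himg] at h
  rw [h, abs_of_pos hc]

theorem setLIntegral_Ioi_inv (f : ℝ → ℝ≥0∞) :
    ∫⁻ u in Set.Ioi 0, f u = ∫⁻ w in Set.Ioi 0, ENNReal.ofReal (w ^ (-2 : ℝ)) * f w⁻¹ := by
  have himg : (fun w : ℝ => w⁻¹) '' Set.Ioi (0 : ℝ) = Set.Ioi 0 := by
    ext u
    simp only [Set.mem_image, Set.mem_Ioi]
    refine ⟨?_, fun hu => ⟨u⁻¹, inv_pos.2 hu, inv_inv u⟩⟩
    rintro ⟨w, hw, rfl⟩
    positivity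
  have h := lintegral_image_eq_lintegral_abs_deriv_mul (s := Set.Ioi (0 : ℝ))
    (f := fun w => w⁻¹) (f' := fun w => -(w ^ 2)⁻¹) measurableSet_Ioi
    (fun x hx => (hasDerivAt_inv (ne_of_gt hx)).hasDerivWithinAt)
    (fun x _ y _ hxy => inv_injective hxy) f
  rw [himg] at h
  rw [h]
  refine setLIntegral_congr_fun measurableSet_Ioi fun w hw => ?_
  have hw : 0 < w := hw
  rw [abs_neg, abs_of_pos (by positivity), Real.rpow_neg hw.le]
  norm_num

theorem lintegral_rpow_mul_exp {s r : ℝ} (hs : 0 < s) (hr : 0 < r) :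
    ∫⁻ u in Set.Ioi 0, ENNReal.ofReal (u ^ (s - 1) * Real.exp (-(r * u)))
      = ENNReal.ofReal (Real.Gamma s * r ^ (-s)) := by
  rw [← ofReal_integral_eq_lintegral_ofReal, Real.integral_rpow_mul_exp_neg_mul_Ioi hs hr]
  · rw [one_div, Real.inv_rpow hr.le, Real.rpow_neg hr.le, mul_comm]
  · have := integrableOn_rpow_mul_exp_neg_mul_rpow (p := 1) (s := s - 1) (b := r)
      (by linarith) one_pos hr
    simpa [IntegrableOn] using this
  · filter_upwards [ae_restrict_mem measurableSet_Ioi] with u hu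
    have hu : 0 < u := hu
    simp only [Pi.zero_apply]
    positivity

theorem lintegral_rpow_mul_exp_div {s r : ℝ} (hs : 0 < s) (hr : 0 < r) :
    ∫⁻ u in Set.Ioi 0, ENNReal.ofReal (u ^ (-s - 1) * Real.exp (-(r / u)))
      = ENNReal.ofReal (Real.Gamma s * r ^ (-s)) := by
  rw [setLIntegral_Ioi_inv, ← lintegral_rpow_mul_exp hs hr]
  refine setLIntegral_congr_fun measurableSet_Ioi fun w hw => ?_
  have hw : 0 < w := hw
  rw [← ENNReal.ofReal_mul (by positivity), div_inv_eq_mul, Real.inv_rpow hw.le,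
    ← Real.rpow_neg hw.le, ← mul_assoc, ← Real.rpow_add hw]
  ring_nf

/-- This is the beta integral B(a, c - a): the first power decides convergence at 0, and both
together decide it at infinity. -/
theorem lintegral_beta_lt_top {a c : ℝ} (ha : 0 < a) (hac : a < c) :
    ∫⁻ w in Set.Ioi (0 : ℝ), ENNReal.ofReal (w ^ (a - 1) * (1 + w) ^ (-c)) < ∞ := by
  rw [← Set.Ioc_union_Ioi_eq_Ioi zero_le_one]
  refine (lintegral_union_le _ _ _).trans_lt (ENNReal.add_lt_top.2 ⟨?_, ?_⟩)
  · have h : IntegrableOn (fun w : ℝ => w ^ (a - 1)) (Set.Ioc 0 1) := by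
      rw [← intervalIntegrable_iff_integrableOn_Ioc_of_le zero_le_one]
      exact intervalIntegral.intervalIntegrable_rpow' (by linarith)
    refine (setLIntegral_mono_ae' measurableSet_Ioc ?_).trans_lt h.2
    refine .of_forall fun w hw => ?_
    have hw0 : 0 < w := hw.1
    rw [Real.enorm_eq_ofReal (by positivity)]
    refine ENNReal.ofReal_le_ofReal (mul_le_of_le_one_right (by positivity) ?_)
    exact Real.rpow_le_one_of_one_le_of_nonpos (by linarith) (by linarith)
  · have h := integrableOn_Ioi_rpow_of_lt (a := a - 1 - c) (by linarith) one_pos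
    refine (setLIntegral_mono_ae' measurableSet_Ioi ?_).trans_lt h.2
    refine .of_forall fun w hw => ?_
    have hw : 1 < w := hw
    have hw0 : 0 < w := by linarith
    rw [Real.enorm_eq_ofReal (by positivity)]
    refine ENNReal.ofReal_le_ofReal ?_
    change w ^ (a - 1) * (1 + w) ^ (-c) ≤ w ^ (a - 1 - c)
    rw [sub_eq_add_neg (a - 1), Real.rpow_add hw0]
    gcongr ?_ * ?_
    exact Real.rpow_le_rpow_of_nonpos hw0 (by linarith) (by linarith)

/-- The substitution w = v² gives 2∫dv/(1 + v²). The value is one of the three factors π in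
`convConst_one_one`. -/
theorem lintegral_beta_half :
    ∫⁻ w in Set.Ioi (0 : ℝ), ENNReal.ofReal (w ^ ((1 / 2 : ℝ) - 1) * (1 + w) ^ (-1 : ℝ))
      = ENNReal.ofReal Real.pi := by
  have himg : (fun w : ℝ => w ^ 2) '' Set.Ioi (0 : ℝ) = Set.Ioi 0 := by
    ext u
    simp only [Set.mem_image, Set.mem_Ioi]
    refine ⟨?_, fun hu => ⟨√u, Real.sqrt_pos.2 hu, Real.sq_sqrt hu.le⟩⟩
    rintro ⟨w, hw, rfl⟩
    positivity
  have h := lintegral_image_eq_lintegral_abs_deriv_mul (s := Set.Ioi (0 : ℝ))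
    (f := fun w => w ^ 2) (f' := fun w => 2 * w) measurableSet_Ioi
    (fun x hx => by simpa using (hasDerivAt_pow 2 x).hasDerivWithinAt)
    (fun x hx y hy hxy => (pow_left_inj₀ (le_of_lt hx) (le_of_lt hy) two_ne_zero).1 hxy)
    (fun w => ENNReal.ofReal (w ^ ((1 / 2 : ℝ) - 1) * (1 + w) ^ (-1 : ℝ)))
  rw [himg] at h
  have h2 : ∫⁻ w in Set.Ioi (0 : ℝ), ENNReal.ofReal (2 * (1 + w ^ 2)⁻¹)
      = ENNReal.ofReal Real.pi := by
    rw [← ofReal_integral_eq_lintegral_ofReal, integral_const_mul, integral_Ioi_inv_one_add_sq]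
    · rw [Real.arctan_zero]; congr 1; ring
    · exact (integrable_inv_one_add_sq.const_mul 2).integrableOn
    · exact .of_forall fun w => by positivity
  rw [h, ← h2]
  refine setLIntegral_congr_fun measurableSet_Ioi fun w hw => ?_
  have hw : 0 < w := hw
  rw [abs_of_pos (by positivity), ← ENNReal.ofReal_mul (by positivity), ← Real.rpow_natCast,
    ← Real.rpow_mul hw.le, Real.rpow_neg_one]
  congr 1
  norm_num [Real.rpow_neg hw.le]
  field_simp

/-! ### Gaussian mixtures of powers and the convolution of powers on `ℝ³` -/

/-- The constant in `∫₀^∞ u^(s-1) exp(-π u r²) du = gammaPi s * r^(-2s)`. -/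
def gammaPi (s : ℝ) : ℝ := Real.Gamma s * Real.pi ^ (-s)

theorem gammaPi_pos {s : ℝ} (hs : 0 < s) : 0 < gammaPi s :=
  mul_pos (Real.Gamma_pos_of_pos hs) (Real.rpow_pos_of_pos Real.pi_pos _)

theorem gammaPi_one : gammaPi 1 = Real.pi⁻¹ := by
  rw [gammaPi, Real.Gamma_one, one_mul, Real.rpow_neg_one]

theorem gammaPi_half : gammaPi (1 / 2) = 1 := by
  rw [gammaPi, Real.Gamma_one_half_eq, Real.sqrt_eq_rpow, ← Real.rpow_add Real.pi_pos]
  norm_num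

theorem ofReal_norm_rpow {E : Type*} [NormedAddCommGroup E] {y : E} (hy : y ≠ 0) (a : ℝ) :
    ENNReal.ofReal (‖y‖ ^ a) = ‖y‖ₑ ^ a := by
  rw [← ENNReal.ofReal_rpow_of_pos (norm_pos_iff.2 hy), ofReal_norm]

theorem gammaPi_mul_pow {s r : ℝ} (hr : 0 < r) :
    Real.Gamma s * (Real.pi * r ^ 2) ^ (-s) = gammaPi s * r ^ (-(2 * s)) := by
  rw [Real.mul_rpow Real.pi_pos.le (by positivity), gammaPi, ← Real.rpow_natCast,
    ← Real.rpow_mul hr.le]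
  push_cast
  ring_nf

variable {E : Type*} [NormedAddCommGroup E]

theorem lintegral_gaussian_mixture {s : ℝ} (hs : 0 < s) {y : E} (hy : y ≠ 0) :
    ∫⁻ u in Set.Ioi 0, ENNReal.ofReal (u ^ (s - 1) * Real.exp (-(Real.pi * ‖y‖ ^ 2 * u)))
      = ENNReal.ofReal (gammaPi s) * ‖y‖ₑ ^ (-(2 * s)) := by
  have hy' : 0 < ‖y‖ := norm_pos_iff.2 hy
  rw [lintegral_rpow_mul_exp hs (by positivity), gammaPi_mul_pow hy',
    ENNReal.ofReal_mul (gammaPi_pos hs).le, ofReal_norm_rpow hy]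

theorem lintegral_gaussian_mixture_inv {s : ℝ} (hs : 0 < s) {y : E} (hy : y ≠ 0) :
    ∫⁻ u in Set.Ioi 0, ENNReal.ofReal (u ^ (-s - 1) * Real.exp (-(Real.pi * ‖y‖ ^ 2 / u)))
      = ENNReal.ofReal (gammaPi s) * ‖y‖ₑ ^ (-(2 * s)) := by
  have hy' : 0 < ‖y‖ := norm_pos_iff.2 hy
  rw [lintegral_rpow_mul_exp_div hs (by positivity), gammaPi_mul_pow hy',
    ENNReal.ofReal_mul (gammaPi_pos hs).le, ofReal_norm_rpow hy]

theorem lintegral_gaussian {s : ℝ} (hs : 0 < s) :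
    ∫⁻ k : Space, ENNReal.ofReal (Real.exp (-(Real.pi * s * ‖k‖ ^ 2)))
      = ENNReal.ofReal (s ^ (-(3 / 2) : ℝ)) := by
  have h := GaussianFourier.integral_rexp_neg_mul_sq_norm (V := Space) (b := Real.pi * s)
    (by positivity)
  have hne : Real.pi / (Real.pi * s) = s⁻¹ := by field_simp
  rw [finrank_euclideanSpace_fin, hne, Real.inv_rpow hs.le, ← Real.rpow_neg hs.le] at h
  simp only [neg_mul] at h
  rw [← ofReal_integral_eq_lintegral_ofReal, h]
  · norm_num
  · refine Integrable.of_integral_ne_zero ?_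
    rw [h]
    positivity
  · exact .of_forall fun w => by positivity

theorem lintegral_gaussian_mul_gaussian {s t : ℝ} (hs : 0 < s) (ht : 0 < t) (p : Space) :
    ∫⁻ k : Space, ENNReal.ofReal (Real.exp (-(Real.pi * ‖k‖ ^ 2 * s))) *
        ENNReal.ofReal (Real.exp (-(Real.pi * ‖p - k‖ ^ 2 * t)))
      = ENNReal.ofReal ((s + t) ^ (-(3 / 2) : ℝ) *
          Real.exp (-(Real.pi * ‖p‖ ^ 2 * (s * t / (s + t))))) := by
  have hst : 0 < s + t := by linarith
  -- Completing the square in k around t p / (s + t).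
  have key (k : Space) : s * ‖k‖ ^ 2 + t * ‖p - k‖ ^ 2
      = (s + t) * ‖k - (t / (s + t)) • p‖ ^ 2 + s * t / (s + t) * ‖p‖ ^ 2 := by
    rw [norm_sub_sq_real, norm_sub_sq_real, norm_smul, inner_smul_right, real_inner_comm k p,
      mul_pow, Real.norm_of_nonneg (by positivity)]
    field_simp
    ring
  have h (k : Space) : ENNReal.ofReal (Real.exp (-(Real.pi * ‖k‖ ^ 2 * s))) *
        ENNReal.ofReal (Real.exp (-(Real.pi * ‖p - k‖ ^ 2 * t)))
      = ENNReal.ofReal (Real.exp (-(Real.pi * (s + t) * ‖k - (t / (s + t)) • p‖ ^ 2))) *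
        ENNReal.ofReal (Real.exp (-(Real.pi * ‖p‖ ^ 2 * (s * t / (s + t))))) := by
    rw [← ENNReal.ofReal_mul (Real.exp_pos _).le, ← ENNReal.ofReal_mul (Real.exp_pos _).le,
      ← Real.exp_add, ← Real.exp_add]
    congr 2
    linear_combination (-Real.pi) * key k
  simp_rw [h]
  rw [lintegral_mul_const _ (by fun_prop),
    lintegral_sub_right_eq_self (μ := (volume : Measure Space))
      (fun k : Space => ENNReal.ofReal (Real.exp (-(Real.pi * (s + t) * ‖k‖ ^ 2)))),
    lintegral_gaussian hst, ← ENNReal.ofReal_mul (by positivity)]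

/-- The constant in the convolution of the powers `‖·‖^(-2x)` and `‖·‖^(-2z)` on `ℝ³`. -/
def convConst (x z : ℝ) : ℝ≥0∞ :=
  (ENNReal.ofReal (gammaPi x))⁻¹ * (ENNReal.ofReal (gammaPi z))⁻¹ *
    ENNReal.ofReal (gammaPi (x + z - 3 / 2)) *
    ∫⁻ w in Set.Ioi (0 : ℝ), ENNReal.ofReal (w ^ (3 / 2 - x - 1) * (1 + w) ^ (-(3 - x - z)))

theorem convConst_lt_top {x z : ℝ} (hx : 0 < x) (hz : 0 < z) (hx' : x < 3 / 2) (hz' : z < 3 / 2) :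
    convConst x z < ∞ := by
  refine ENNReal.mul_lt_top (ENNReal.mul_lt_top (ENNReal.mul_lt_top ?_ ?_) ENNReal.ofReal_lt_top)
    (lintegral_beta_lt_top (by linarith) (by linarith))
  · simpa using gammaPi_pos hx
  · simpa using gammaPi_pos hz

theorem convConst_one_one : convConst 1 1 = ENNReal.ofReal (Real.pi ^ 3) := by
  have h : ENNReal.ofReal (gammaPi (1 + 1 - 3 / 2)) = 1 := by
    rw [show (1 + 1 - 3 / 2 : ℝ) = 1 / 2 by norm_num, gammaPi_half, ENNReal.ofReal_one]
  rw [convConst, h, gammaPi_one, ENNReal.ofReal_inv_of_pos Real.pi_pos, inv_inv, mul_one,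
    show (3 / 2 - 1 - 1 : ℝ) = 1 / 2 - 1 by norm_num,
    show (-(3 - 1 - 1) : ℝ) = -1 by norm_num, lintegral_beta_half,
    ← ENNReal.ofReal_mul Real.pi_pos.le, ← ENNReal.ofReal_mul (by positivity)]
  ring_nf

/-- With t = s w the exponent is linear in s. The s-integral is then a Gamma integral, convergent at
0 because 3/2 < x + z, and a beta integral in w remains. -/
theorem lintegral_rpow_mul_rpow_aux {x z : ℝ} (hxz : 3 / 2 < x + z) {r : ℝ} (hr : 0 < r) :
    ∫⁻ s in Set.Ioi (0 : ℝ), ∫⁻ t in Set.Ioi (0 : ℝ),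
        ENNReal.ofReal (s ^ (x - 1)) * (ENNReal.ofReal (t ^ (z - 1)) *
          ENNReal.ofReal ((s + t) ^ (-(3 / 2) : ℝ) *
            Real.exp (-(Real.pi * r ^ 2 * (s * t / (s + t))))))
      = ENNReal.ofReal (gammaPi (x + z - 3 / 2) * r ^ (-(2 * (x + z - 3 / 2)))) *
        ∫⁻ w in Set.Ioi (0 : ℝ), ENNReal.ofReal (w ^ (3 / 2 - x - 1) * (1 + w) ^ (-(3 - x - z))) := by
  have h1 : ∀ s ∈ Set.Ioi (0 : ℝ), ∫⁻ t in Set.Ioi (0 : ℝ),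
        ENNReal.ofReal (s ^ (x - 1)) * (ENNReal.ofReal (t ^ (z - 1)) *
          ENNReal.ofReal ((s + t) ^ (-(3 / 2) : ℝ) *
            Real.exp (-(Real.pi * r ^ 2 * (s * t / (s + t))))))
      = ∫⁻ w in Set.Ioi (0 : ℝ), ENNReal.ofReal (w ^ (z - 1) * (1 + w) ^ (-(3 / 2) : ℝ)) *
          ENNReal.ofReal (s ^ (x + z - 3 / 2 - 1) *
            Real.exp (-(Real.pi * r ^ 2 * (w / (1 + w)) * s))) := by
    intro s hs
    have hs : 0 < s := hs
    rw [setLIntegral_Ioi_scale _ hs]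
    refine setLIntegral_congr_fun measurableSet_Ioi fun w hw => ?_
    have hw : 0 < w := hw
    rw [← ENNReal.ofReal_mul (by positivity), ← ENNReal.ofReal_mul (by positivity),
      ← ENNReal.ofReal_mul (by positivity), ← ENNReal.ofReal_mul (by positivity)]
    have e1 : s + s * w = s * (1 + w) := by ring
    have e2 : s * (s * w) / (s * (1 + w)) = w / (1 + w) * s := by field_simp
    rw [e1, e2, Real.mul_rpow hs.le hw.le, Real.mul_rpow hs.le (by positivity)]
    have e3 : s ^ (x + z - 3 / 2 - 1) = s * s ^ (x - 1) * s ^ (z - 1) * s ^ (-(3 / 2) : ℝ) := by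
      nth_rewrite 2 [← Real.rpow_one s]
      rw [← Real.rpow_add hs, ← Real.rpow_add hs, ← Real.rpow_add hs]
      ring_nf
    rw [e3]
    ring_nf
  rw [setLIntegral_congr_fun measurableSet_Ioi h1, lintegral_lintegral_swap (by fun_prop),
    ← lintegral_const_mul _ (by fun_prop)]
  refine setLIntegral_congr_fun measurableSet_Ioi fun w hw => ?_
  have hw : 0 < w := hw
  rw [lintegral_const_mul _ (by fun_prop), lintegral_rpow_mul_exp (by linarith) (by positivity),
    ← ENNReal.ofReal_mul (by positivity), Real.mul_rpow (by positivity) (by positivity),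
    ← mul_assoc (Real.Gamma _), gammaPi_mul_pow hr, Real.div_rpow hw.le (by positivity)]
  have hg := gammaPi_pos (s := x + z - 3 / 2) (by linarith)
  rw [← ENNReal.ofReal_mul (by positivity), div_eq_mul_inv (w ^ (-(x + z - 3 / 2))),
    ← Real.rpow_neg (by positivity : 0 ≤ 1 + w)]
  have e1 : w ^ (3 / 2 - x - 1) = w ^ (z - 1) * w ^ (-(x + z - 3 / 2)) := by
    rw [← Real.rpow_add hw]; ring_nf
  have e2 : (1 + w) ^ (-(3 - x - z)) = (1 + w) ^ (-(3 / 2) : ℝ) * (1 + w) ^ (- -(x + z - 3 / 2)) := by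
    rw [← Real.rpow_add (by positivity)]; ring_nf
  rw [e1, e2]
  ring_nf

/-- Both powers become Gaussian mixtures, and Tonelli reduces the k-integral to a convolution of two
Gaussians. The identity lives in [0, ∞]; finiteness is left to `convConst_lt_top`. -/
theorem lintegral_rpow_mul_rpow {x z : ℝ} (hx : 0 < x) (hz : 0 < z) (hxz : 3 / 2 < x + z)
    {p : Space} (hp : p ≠ 0) :
    ∫⁻ k : Space, ‖k‖ₑ ^ (-(2 * x)) * ‖p - k‖ₑ ^ (-(2 * z))
      = convConst x z * ‖p‖ₑ ^ (-(2 * (x + z - 3 / 2))) := by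
  have hgx := gammaPi_pos hx
  have hgz := gammaPi_pos hz
  have hge := gammaPi_pos (s := x + z - 3 / 2) (by linarith)
  have hp' : 0 < ‖p‖ := norm_pos_iff.2 hp
  have h1 : ∀ᵐ k : Space, ‖k‖ₑ ^ (-(2 * x)) * ‖p - k‖ₑ ^ (-(2 * z))
      = (ENNReal.ofReal (gammaPi x))⁻¹ * (ENNReal.ofReal (gammaPi z))⁻¹ *
        ∫⁻ s in Set.Ioi (0 : ℝ), ∫⁻ t in Set.Ioi (0 : ℝ),
          ENNReal.ofReal (s ^ (x - 1)) * (ENNReal.ofReal (t ^ (z - 1)) *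
          (ENNReal.ofReal (Real.exp (-(Real.pi * ‖k‖ ^ 2 * s))) *
            ENNReal.ofReal (Real.exp (-(Real.pi * ‖p - k‖ ^ 2 * t))))) := by
    have hn1 : ∀ᵐ k : Space, k ≠ 0 := by simp [ae_iff]
    have hn2 : ∀ᵐ k : Space, k ≠ p := by simp [ae_iff]
    filter_upwards [hn1, hn2] with k hk hkp
    have e (s t : ℝ) : ENNReal.ofReal (s ^ (x - 1)) * (ENNReal.ofReal (t ^ (z - 1)) *
          (ENNReal.ofReal (Real.exp (-(Real.pi * ‖k‖ ^ 2 * s))) *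
            ENNReal.ofReal (Real.exp (-(Real.pi * ‖p - k‖ ^ 2 * t)))))
        = (ENNReal.ofReal (s ^ (x - 1)) * ENNReal.ofReal (Real.exp (-(Real.pi * ‖k‖ ^ 2 * s)))) *
          (ENNReal.ofReal (t ^ (z - 1)) *
            ENNReal.ofReal (Real.exp (-(Real.pi * ‖p - k‖ ^ 2 * t)))) := by ring
    have hm {q : Space} (hq : q ≠ 0) {y : ℝ} (hy : 0 < y) :
        ∫⁻ u in Set.Ioi (0 : ℝ), ENNReal.ofReal (u ^ (y - 1)) *
          ENNReal.ofReal (Real.exp (-(Real.pi * ‖q‖ ^ 2 * u)))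
          = ENNReal.ofReal (gammaPi y) * ‖q‖ₑ ^ (-(2 * y)) := by
      rw [← lintegral_gaussian_mixture hy hq]
      refine setLIntegral_congr_fun measurableSet_Ioi fun u hu => ?_
      exact (ENNReal.ofReal_mul (Real.rpow_nonneg (le_of_lt hu) _)).symm
    simp_rw [e]
    rw [lintegral_congr fun s => lintegral_const_mul _ (by fun_prop),
      lintegral_mul_const _ (by fun_prop), hm hk hx, hm (sub_ne_zero.2 hkp.symm) hz]
    have c1 : (ENNReal.ofReal (gammaPi x))⁻¹ * ENNReal.ofReal (gammaPi x) = 1 :=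
      ENNReal.inv_mul_cancel (by simpa using hgx) ENNReal.ofReal_ne_top
    have c2 : (ENNReal.ofReal (gammaPi z))⁻¹ * ENNReal.ofReal (gammaPi z) = 1 :=
      ENNReal.inv_mul_cancel (by simpa using hgz) ENNReal.ofReal_ne_top
    calc _ = ((ENNReal.ofReal (gammaPi x))⁻¹ * ENNReal.ofReal (gammaPi x)) *
          ((ENNReal.ofReal (gammaPi z))⁻¹ * ENNReal.ofReal (gammaPi z)) *
          (‖k‖ₑ ^ (-(2 * x)) * ‖p - k‖ₑ ^ (-(2 * z))) := by rw [c1, c2, one_mul, one_mul]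
      _ = _ := by ring
  rw [lintegral_congr_ae h1, lintegral_const_mul _ (by fun_prop),
    lintegral_lintegral_swap (by fun_prop)]
  have h2 : ∀ s ∈ Set.Ioi (0 : ℝ), ∫⁻ k : Space, ∫⁻ t in Set.Ioi (0 : ℝ),
          ENNReal.ofReal (s ^ (x - 1)) * (ENNReal.ofReal (t ^ (z - 1)) *
          (ENNReal.ofReal (Real.exp (-(Real.pi * ‖k‖ ^ 2 * s))) *
            ENNReal.ofReal (Real.exp (-(Real.pi * ‖p - k‖ ^ 2 * t)))))
      = ∫⁻ t in Set.Ioi (0 : ℝ),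
        ENNReal.ofReal (s ^ (x - 1)) * (ENNReal.ofReal (t ^ (z - 1)) *
          ENNReal.ofReal ((s + t) ^ (-(3 / 2) : ℝ) *
            Real.exp (-(Real.pi * ‖p‖ ^ 2 * (s * t / (s + t)))))) := by
    intro s hs
    rw [lintegral_lintegral_swap (by fun_prop)]
    refine setLIntegral_congr_fun measurableSet_Ioi fun t ht => ?_
    rw [lintegral_const_mul _ (by fun_prop), lintegral_const_mul _ (by fun_prop),
      lintegral_gaussian_mul_gaussian hs ht]
  rw [setLIntegral_congr_fun measurableSet_Ioi h2, lintegral_rpow_mul_rpow_aux hxz hp', convConst,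
    ENNReal.ofReal_mul hge.le, ofReal_norm_rpow hp]
  ring

/-! ### The bilinear form of a convolution in the relative momentum and the Schur test -/

/-- The shift `(k, -k)` of the two momenta that preserves the total momentum. -/
def anti (k : Space) : Config := WithLp.toLp 2 (k, -k)

theorem anti_neg (k : Space) : anti (-k) = -anti k := rfl

@[simp] theorem sub_anti_fst (ξ : Config) (k : Space) : (ξ - anti k).fst = ξ.fst - k := rfl

@[simp] theorem sub_anti_snd (ξ : Config) (k : Space) : (ξ - anti k).snd = ξ.snd + k := by
  change ξ.snd - -k = _
  rw [sub_neg_eq_add]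

@[fun_prop]
theorem continuous_fst : Continuous (fun ξ : Config => ξ.fst) := by
  change Continuous fun ξ : Config => (WithLp.ofLp ξ).1
  fun_prop

@[fun_prop]
theorem continuous_snd : Continuous (fun ξ : Config => ξ.snd) := by
  change Continuous fun ξ : Config => (WithLp.ofLp ξ).2
  fun_prop

@[fun_prop]
theorem measurable_fst : Measurable (fun ξ : Config => ξ.fst) := continuous_fst.measurable

@[fun_prop]
theorem measurable_snd : Measurable (fun ξ : Config => ξ.snd) := continuous_snd.measurable

@[fun_prop]
theorem continuous_anti : Continuous anti := by
  unfold anti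
  fun_prop

@[fun_prop]
theorem measurable_anti : Measurable anti := continuous_anti.measurable

theorem ae_fst_snd {p : Space → Space → Prop} (hp : MeasurableSet {z : Space × Space | p z.1 z.2})
    (h : ∀ x, ∀ᵐ y : Space, p x y) : ∀ᵐ ξ : Config, p ξ.fst ξ.snd := by
  have h1 : ∀ᵐ z : Space × Space, p z.1 z.2 := by
    rw [Measure.volume_eq_prod, Measure.ae_prod_iff_ae_ae hp]
    exact .of_forall h
  exact (WithLp.volume_preserving_ofLp Space Space).quasiMeasurePreserving.ae h1

theorem ae_ne (x : Space) : ∀ᵐ y : Space, y ≠ x := by simp [ae_iff]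

theorem ae_snd_ne_zero : ∀ᵐ ξ : Config, ξ.snd ≠ 0 :=
  ae_fst_snd (p := fun _ y => y ≠ 0) (_root_.measurable_snd (measurableSet_singleton 0).compl)
    fun _ => ae_ne 0

theorem ae_sub_ne_zero : ∀ᵐ ξ : Config, ξ.fst - ξ.snd ≠ 0 :=
  ae_fst_snd (p := fun x y => x - y ≠ 0)
    ((_root_.measurable_fst.sub _root_.measurable_snd) (measurableSet_singleton 0).compl)
    fun x => by simpa only [ne_eq, sub_eq_zero, eq_comm] using ae_ne x

theorem ae_fst_ne_zero : ∀ᵐ ξ : Config, ξ.fst ≠ 0 := by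
  have h1 : ∀ᵐ z : Space × Space, z.1 ≠ 0 := by
    rw [Measure.volume_eq_prod]
    exact Measure.quasiMeasurePreserving_fst.ae (ae_ne 0)
  exact (WithLp.volume_preserving_ofLp Space Space).quasiMeasurePreserving.ae h1

/-- The form `∫∫ g(ξ) κ(k) f(ξ - (k, -k)) dk dξ`. -/
def bil (κ : Space → ℝ≥0∞) (g f : Config → ℝ≥0∞) : ℝ≥0∞ :=
  ∫⁻ k, κ k * ∫⁻ ξ, g ξ * f (ξ - anti k)

theorem bil_mono {κ κ' : Space → ℝ≥0∞} {g g' f f' : Config → ℝ≥0∞} (hκ : ∀ᵐ k, κ k ≤ κ' k)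
    (hg : ∀ᵐ ξ, g ξ ≤ g' ξ) (hf : ∀ᵐ ξ, f ξ ≤ f' ξ) : bil κ g f ≤ bil κ' g' f' := by
  refine lintegral_mono_ae ?_
  filter_upwards [hκ] with k hk
  refine mul_le_mul' hk (lintegral_mono_ae ?_)
  have hf' := (measurePreserving_sub_right volume (anti k)).quasiMeasurePreserving.ae hf
  filter_upwards [hg, hf'] with ξ h1 h2
  exact mul_le_mul' h1 h2

theorem bil_const_mul {κ : Space → ℝ≥0∞} (hκ : Measurable κ) {g f : Config → ℝ≥0∞}
    (hg : Measurable g) (hf : Measurable f) (c : ℝ≥0∞) :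
    bil (fun k => c * κ k) g f = c * bil κ g f := by
  unfold bil
  rw [← lintegral_const_mul _ (by fun_prop)]
  exact lintegral_congr fun k => mul_assoc _ _ _

/-- Cauchy–Schwarz with respect to κ(k) dk dξ, after writing g f as the product of g (B/A)^(1/2) and
f (A/B)^(1/2), with B and f taken at the shifted point. -/
theorem bil_schur {κ : Space → ℝ≥0∞} (hκ : Measurable κ) {g f A B : Config → ℝ≥0∞}
    (hg : Measurable g) (hf : Measurable f) (hA : Measurable A) (hB : Measurable B)
    (hA0 : ∀ᵐ ξ, A ξ ≠ 0 ∧ A ξ ≠ ∞) (hB0 : ∀ᵐ ξ, B ξ ≠ 0 ∧ B ξ ≠ ∞) :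
    bil κ g f ≤
      (∫⁻ ξ, g ξ ^ (2 : ℝ) * (A ξ)⁻¹ * ∫⁻ k, κ k * B (ξ - anti k)) ^ (1 / 2 : ℝ) *
      (∫⁻ ξ, f ξ ^ (2 : ℝ) * (B ξ)⁻¹ * ∫⁻ k, κ k * A (ξ + anti k))
        ^ (1 / 2 : ℝ) := by
  let F : Space × Config → ℝ≥0∞ := fun z =>
    (κ z.1 * (g z.2 ^ (2 : ℝ) * (A z.2)⁻¹ * B (z.2 - anti z.1))) ^ (1 / 2 : ℝ)
  let G : Space × Config → ℝ≥0∞ := fun z =>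
    (κ z.1 * (f (z.2 - anti z.1) ^ (2 : ℝ) * (B (z.2 - anti z.1))⁻¹ * A z.2)) ^ (1 / 2 : ℝ)
  have hFm : Measurable F := by fun_prop
  have hGm : Measurable G := by fun_prop
  have hsq : ∀ x : ℝ≥0∞, (x ^ (1 / 2 : ℝ)) ^ (2 : ℝ) = x := fun x => by
    rw [← ENNReal.rpow_mul]; norm_num
  have hsq' : ∀ x : ℝ≥0∞, (x ^ (2 : ℝ)) ^ (1 / 2 : ℝ) = x := fun x => by
    rw [← ENNReal.rpow_mul]; norm_num
  have h1 : bil κ g f = ∫⁻ z : Space × Config, (F * G) z := by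
    rw [Measure.volume_eq_prod, lintegral_prod _ (by fun_prop)]
    refine lintegral_congr fun k => ?_
    rw [← lintegral_const_mul _ (by fun_prop)]
    refine lintegral_congr_ae ?_
    have hB' := (measurePreserving_sub_right volume (anti k)).quasiMeasurePreserving.ae hB0
    filter_upwards [hA0, hB'] with ξ ha hb
    have cA : A ξ * (A ξ)⁻¹ = 1 := ENNReal.mul_inv_cancel ha.1 ha.2
    have cB : B (ξ - anti k) * (B (ξ - anti k))⁻¹ = 1 := ENNReal.mul_inv_cancel hb.1 hb.2
    simp only [F, G, Pi.mul_apply]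
    rw [← ENNReal.mul_rpow_of_nonneg _ _ (by norm_num)]
    have : κ k * (g ξ ^ (2 : ℝ) * (A ξ)⁻¹ * B (ξ - anti k)) *
        (κ k * (f (ξ - anti k) ^ (2 : ℝ) * (B (ξ - anti k))⁻¹ * A ξ))
        = (κ k * (g ξ * f (ξ - anti k))) ^ (2 : ℝ) := by
      calc _ = (κ k * (g ξ * f (ξ - anti k))) ^ (2 : ℝ) * (A ξ * (A ξ)⁻¹) *
            (B (ξ - anti k) * (B (ξ - anti k))⁻¹) := by
              simp only [ENNReal.rpow_two]; ring
        _ = _ := by rw [cA, cB, mul_one, mul_one]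
    rw [this, hsq']
  have h2 : ∫⁻ z : Space × Config, F z ^ (2 : ℝ)
      = ∫⁻ ξ, g ξ ^ (2 : ℝ) * (A ξ)⁻¹ * ∫⁻ k, κ k * B (ξ - anti k) := by
    simp only [F, hsq]
    rw [Measure.volume_eq_prod, lintegral_prod_symm _ (by fun_prop)]
    refine lintegral_congr fun ξ => ?_
    rw [← lintegral_const_mul _ (by fun_prop)]
    exact lintegral_congr fun k => by ring
  have h3 : ∫⁻ z : Space × Config, G z ^ (2 : ℝ)
      = ∫⁻ ξ, f ξ ^ (2 : ℝ) * (B ξ)⁻¹ *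
        ∫⁻ k, κ k * A (ξ + anti k) := by
    simp only [G, hsq]
    rw [Measure.volume_eq_prod, lintegral_prod _ (by fun_prop)]
    have e (k : Space) : ∫⁻ ξ, κ k * (f (ξ - anti k) ^ (2 : ℝ) * (B (ξ - anti k))⁻¹ * A ξ)
        = ∫⁻ ξ, κ k * (f ξ ^ (2 : ℝ) * (B ξ)⁻¹ * A (ξ + anti k)) := by
      rw [← lintegral_add_right_eq_self _ (anti k)]
      simp only [add_sub_cancel_right]
    simp_rw [e]
    rw [lintegral_lintegral_swap (by fun_prop)]
    refine lintegral_congr fun ξ => ?_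
    rw [← lintegral_const_mul _ (by fun_prop)]
    exact lintegral_congr fun k => by ring
  rw [h1, ← h2, ← h3]
  exact ENNReal.lintegral_mul_le_Lp_mul_Lq _ Real.HolderConjugate.two_two
    hFm.aemeasurable hGm.aemeasurable

/-- The weight `|ξ₁|^a |ξ₂|^c`. -/
def wt (a c : ℝ) (ξ : Config) : ℝ≥0∞ := ‖ξ.fst‖ₑ ^ a * ‖ξ.snd‖ₑ ^ c

@[fun_prop]
theorem measurable_wt (a c : ℝ) : Measurable (wt a c) := by
  unfold wt
  fun_prop

theorem wt_zero : wt 0 0 = 1 := by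
  ext ξ
  simp [wt]

theorem wt_mul {ξ : Config} (h1 : ξ.fst ≠ 0) (h2 : ξ.snd ≠ 0) (a c a' c' : ℝ) :
    wt a c ξ * wt a' c' ξ = wt (a + a') (c + c') ξ := by
  unfold wt
  rw [ENNReal.rpow_add _ _ (enorm_ne_zero.2 h1) enorm_ne_top,
    ENNReal.rpow_add _ _ (enorm_ne_zero.2 h2) enorm_ne_top]
  ring

theorem wt_inv {ξ : Config} (h1 : ξ.fst ≠ 0) (h2 : ξ.snd ≠ 0) (a c : ℝ) :
    (wt a c ξ)⁻¹ = wt (-a) (-c) ξ := by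
  refine (ENNReal.eq_inv_of_mul_eq_one_left ?_).symm
  rw [wt_mul h1 h2]
  simp [wt]

theorem wt_ne_zero_ne_top {ξ : Config} (h1 : ξ.fst ≠ 0) (h2 : ξ.snd ≠ 0) (a c : ℝ) :
    wt a c ξ ≠ 0 ∧ wt a c ξ ≠ ∞ := by
  have h1' : ‖ξ.fst‖ₑ ≠ 0 := enorm_ne_zero.2 h1
  have h2' : ‖ξ.snd‖ₑ ≠ 0 := enorm_ne_zero.2 h2
  constructor
  · exact mul_ne_zero (by simp [ENNReal.rpow_eq_zero_iff, h1'])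
      (by simp [ENNReal.rpow_eq_zero_iff, h2'])
  · exact ENNReal.mul_ne_top (by simp [ENNReal.rpow_eq_top_iff, h1'])
      (by simp [ENNReal.rpow_eq_top_iff, h2'])

theorem lintegral_rpow_mul_rpow' {b Z : ℝ} (hb : b < 3) (hZ : b < Z) (hZ0 : 0 < Z)
    {p : Space} (hp : p ≠ 0) :
    ∫⁻ k : Space, ‖k‖ₑ ^ (b - 3) * ‖p - k‖ₑ ^ (-Z)
      = convConst ((3 - b) / 2) (Z / 2) * ‖p‖ₑ ^ (-(Z - b)) := by
  have h := lintegral_rpow_mul_rpow (x := (3 - b) / 2) (z := Z / 2) (by linarith) (by linarith)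
    (by linarith) hp
  convert h using 4 <;> ring_nf

/-- Hölder with exponents 1/θ and 1/(1-θ) separates the factors in ξ₁ and ξ₂. Each is then an
explicit convolution that lowers Z to Z - b with the same constant, so the constants recombine to
one. -/
theorem lintegral_rpow_mul_wt_le {b Z θ : ℝ} (hb : b < 3) (hZ : b < Z) (hZ0 : 0 < Z)
    (hθ : 0 ≤ θ) (hθ' : θ ≤ 1) {ξ : Config} (h1 : ξ.fst ≠ 0) (h2 : ξ.snd ≠ 0) :
    ∫⁻ k : Space, ‖k‖ₑ ^ (b - 3) * wt (-(θ * Z)) (-((1 - θ) * Z)) (ξ - anti k)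
      ≤ convConst ((3 - b) / 2) (Z / 2) * wt (-(θ * (Z - b))) (-((1 - θ) * (Z - b))) ξ := by
  have hθ1 : 0 ≤ 1 - θ := by linarith
  have e : ∀ᵐ k : Space, ‖k‖ₑ ^ (b - 3) * wt (-(θ * Z)) (-((1 - θ) * Z)) (ξ - anti k)
      = (‖k‖ₑ ^ (b - 3) * ‖ξ.fst - k‖ₑ ^ (-Z)) ^ θ *
        (‖k‖ₑ ^ (b - 3) * ‖ξ.snd + k‖ₑ ^ (-Z)) ^ (1 - θ) := by
    filter_upwards [ae_ne 0] with k hk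
    have hk' : ‖k‖ₑ ≠ 0 := enorm_ne_zero.2 hk
    rw [ENNReal.mul_rpow_of_nonneg _ _ hθ, ENNReal.mul_rpow_of_nonneg _ _ hθ1, wt,
      ← ENNReal.rpow_mul, ← ENNReal.rpow_mul, ← ENNReal.rpow_mul, ← ENNReal.rpow_mul,
      mul_mul_mul_comm, ← ENNReal.rpow_add _ _ hk' enorm_ne_top, sub_anti_fst, sub_anti_snd]
    ring_nf
  -- The second momentum is shifted by +k; the reflection k ↦ -k brings it to the form of the first.
  have hneg : ∫⁻ k : Space, ‖k‖ₑ ^ (b - 3) * ‖ξ.snd + k‖ₑ ^ (-Z)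
      = convConst ((3 - b) / 2) (Z / 2) * ‖ξ.snd‖ₑ ^ (-(Z - b)) := by
    rw [← lintegral_rpow_mul_rpow' hb hZ hZ0 h2, ← lintegral_neg_eq_self]
    simp only [enorm_neg, sub_eq_add_neg]
  rw [lintegral_congr_ae e]
  refine (ENNReal.lintegral_mul_norm_pow_le (by fun_prop) (by fun_prop) hθ hθ1
    (by ring)).trans_eq ?_
  rw [lintegral_rpow_mul_rpow' hb hZ hZ0 h1, hneg, ENNReal.mul_rpow_of_nonneg _ _ hθ,
    ENNReal.mul_rpow_of_nonneg _ _ hθ1, mul_mul_mul_comm, ← ENNReal.rpow_add_of_nonneg _ _ hθ hθ1,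
    add_sub_cancel, ENNReal.rpow_one, wt, ← ENNReal.rpow_mul, ← ENNReal.rpow_mul]
  ring_nf

theorem lintegral_rpow_mul_wt_add_le {b Z θ : ℝ} (hb : b < 3) (hZ : b < Z) (hZ0 : 0 < Z)
    (hθ : 0 ≤ θ) (hθ' : θ ≤ 1) {ξ : Config} (h1 : ξ.fst ≠ 0) (h2 : ξ.snd ≠ 0) :
    ∫⁻ k : Space, ‖k‖ₑ ^ (b - 3) * wt (-(θ * Z)) (-((1 - θ) * Z)) (ξ + anti k)
      ≤ convConst ((3 - b) / 2) (Z / 2) * wt (-(θ * (Z - b))) (-((1 - θ) * (Z - b))) ξ := by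
  rw [← lintegral_neg_eq_self]
  simp only [enorm_neg, anti_neg, ← sub_eq_add_neg]
  exact lintegral_rpow_mul_wt_le hb hZ hZ0 hθ hθ' h1 h2

/-- Schur test for the kernel `|k|^(b-3)` between weighted `L²` spaces. -/
theorem bil_rpow_le {b Z W θ θ' : ℝ} (hb : b < 3) (hZ : b < Z) (hZ0 : 0 < Z) (hW : b < W)
    (hW0 : 0 < W) (hθ : 0 ≤ θ) (hθ1 : θ ≤ 1) (hθ' : 0 ≤ θ') (hθ1' : θ' ≤ 1)
    {g₁ g₂ f₁ f₂ : ℝ} (eg₁ : g₁ = θ' * W - θ * (Z - b))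
    (eg₂ : g₂ = (1 - θ') * W - (1 - θ) * (Z - b)) (ef₁ : f₁ = θ * Z - θ' * (W - b))
    (ef₂ : f₂ = (1 - θ) * Z - (1 - θ') * (W - b)) {g f : Config → ℝ≥0∞}
    (hg : Measurable g) (hf : Measurable f) :
    bil (fun k => ‖k‖ₑ ^ (b - 3)) g f ≤
      (convConst ((3 - b) / 2) (Z / 2) * ∫⁻ ξ, g ξ ^ (2 : ℝ) * wt g₁ g₂ ξ) ^ (1 / 2 : ℝ) *
      (convConst ((3 - b) / 2) (W / 2) * ∫⁻ ξ, f ξ ^ (2 : ℝ) * wt f₁ f₂ ξ) ^ (1 / 2 : ℝ) := by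
  have hne (a c : ℝ) : ∀ᵐ ξ, wt a c ξ ≠ 0 ∧ wt a c ξ ≠ ∞ := by
    filter_upwards [ae_fst_ne_zero, ae_snd_ne_zero] with ξ h1 h2
    exact wt_ne_zero_ne_top h1 h2 a c
  -- The Schur weights are A with parameters (θ', W) and B with parameters (θ, Z). Averaging B and
  -- dividing by A gives the exponents g₁, g₂; exchanging the roles gives f₁, f₂.
  refine (bil_schur (by fun_prop) hg hf (measurable_wt (-(θ' * W)) (-((1 - θ') * W)))
    (measurable_wt (-(θ * Z)) (-((1 - θ) * Z))) (hne _ _) (hne _ _)).trans ?_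
  gcongr
  · rw [← lintegral_const_mul _ (by fun_prop)]
    refine lintegral_mono_ae ?_
    filter_upwards [ae_fst_ne_zero, ae_snd_ne_zero] with ξ h1 h2
    refine (mul_le_mul_right (lintegral_rpow_mul_wt_le hb hZ hZ0 hθ hθ1 h1 h2) _).trans_eq ?_
    rw [wt_inv h1 h2, eg₁, eg₂, show θ' * W - θ * (Z - b) = - -(θ' * W) + -(θ * (Z - b)) by ring,
      show (1 - θ') * W - (1 - θ) * (Z - b) = - -((1 - θ') * W) + -((1 - θ) * (Z - b)) by ring,
      ← wt_mul h1 h2]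
    ring
  · rw [← lintegral_const_mul _ (by fun_prop)]
    refine lintegral_mono_ae ?_
    filter_upwards [ae_fst_ne_zero, ae_snd_ne_zero] with ξ h1 h2
    refine (mul_le_mul_right (lintegral_rpow_mul_wt_add_le hb hW hW0 hθ' hθ1' h1 h2) _).trans_eq ?_
    rw [wt_inv h1 h2, ef₁, ef₂, show θ * Z - θ' * (W - b) = - -(θ * Z) + -(θ' * (W - b)) by ring,
      show (1 - θ) * Z - (1 - θ') * (W - b) = - -((1 - θ) * Z) + -((1 - θ') * (W - b)) by ring,
      ← wt_mul h1 h2]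
    ring

/-- A shift preserves the L² norm, so Cauchy–Schwarz applies for each k. This serves integrable
kernels, namely the regularized one with large η. -/
theorem bil_lintegral_le {κ : Space → ℝ≥0∞} (hκ : Measurable κ) {g f : Config → ℝ≥0∞}
    (hg : Measurable g) (hf : Measurable f) :
    bil κ g f ≤ (∫⁻ k, κ k) * ((∫⁻ ξ, g ξ ^ (2 : ℝ)) ^ (1 / 2 : ℝ) *
      (∫⁻ ξ, f ξ ^ (2 : ℝ)) ^ (1 / 2 : ℝ)) := by
  rw [← lintegral_mul_const _ hκ]
  refine lintegral_mono fun k => ?_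
  gcongr
  refine (ENNReal.lintegral_mul_le_Lp_mul_Lq _ Real.HolderConjugate.two_two (g := fun ξ =>
    f (ξ - anti k)) hg.aemeasurable (by fun_prop)).trans_eq ?_
  rw [lintegral_sub_right_eq_self (μ := (volume : Measure Config)) (fun ξ => f ξ ^ (2 : ℝ))]

/-! ### Translation in momentum space is modulation in position space -/

/-- Translation of `L²` functions by `a`. -/
def translate (a : Config) : Hilb →ₗᵢ[ℂ] Hilb :=
  Lp.compMeasurePreservingₗᵢ ℂ (fun x => x - a) (measurePreserving_sub_right volume a)

theorem coeFn_translate (a : Config) (f : Hilb) :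
    translate a f =ᵐ[volume] fun x => f (x - a) :=
  Lp.coeFn_compMeasurePreserving f (measurePreserving_sub_right volume a)

theorem memLp_fourierChar (a : Config) :
    MemLp (fun x : Config => (𝐞 (inner ℝ a x) : ℂ)) ∞ (volume : Measure Config) := by
  refine memLp_top_of_bound (Continuous.aestronglyMeasurable (by fun_prop)) 1 ?_
  exact .of_forall fun x => (Circle.norm_coe _).le

/-- Multiplication by the character `x ↦ e^{2πi⟨a,x⟩}`. -/
def modulate (a : Config) : Hilb →L[ℂ] Hilb :=
  (ContinuousLinearMap.mul ℂ ℂ).holderL volume ∞ 2 2 (memLp_fourierChar a).toLp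

theorem coeFn_modulate (a : Config) (f : Hilb) :
    modulate a f =ᵐ[volume] fun x => (𝐞 (inner ℝ a x) : ℂ) * f x := by
  have h := (ContinuousLinearMap.mul ℂ ℂ).coeFn_holder (r := 2) (memLp_fourierChar a).toLp f
  filter_upwards [h, (memLp_fourierChar a).coeFn_toLp] with x h1 h2
  change ((ContinuousLinearMap.mul ℂ ℂ).holder 2 (memLp_fourierChar a).toLp f) x = _
  rw [h1, h2]
  rfl

/-- Both sides are continuous in f, so it suffices to treat Schwartz functions, where the inverse
transform is an integral and the claim is a change of variables. -/
theorem fourierInv_translate (a : Config) (f : Hilb) :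
    (Lp.fourierTransformₗᵢ Config ℂ).symm (translate a f)
      = modulate a ((Lp.fourierTransformₗᵢ Config ℂ).symm f) := by
  refine DenseRange.induction_on (p := fun f : Hilb => (Lp.fourierTransformₗᵢ Config ℂ).symm
    (translate a f) = modulate a ((Lp.fourierTransformₗᵢ Config ℂ).symm f))
    (SchwartzMap.denseRange_toLpCLM (p := 2) ENNReal.ofNat_ne_top) f ?_ ?_
  · exact isClosed_eq (by fun_prop) (by fun_prop)
  intro φ
  have h1 : translate a (φ.toLp 2) = (SchwartzMap.compSubConstCLM ℂ a φ).toLp 2 := by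
    refine Lp.ext ?_
    have hs := (measurePreserving_sub_right volume a).quasiMeasurePreserving.ae
      (φ.coeFn_toLp 2 (volume : Measure Config))
    filter_upwards [coeFn_translate a (φ.toLp 2), hs,
      (SchwartzMap.compSubConstCLM ℂ a φ).coeFn_toLp 2 (volume : Measure Config)] with x e1 e2 e3
    rw [e1, e2, e3]
    rfl
  change 𝓕⁻ (translate a (φ.toLp 2)) = modulate a (𝓕⁻ (φ.toLp 2))
  rw [h1, SchwartzMap.toLp_fourierInv_eq, SchwartzMap.toLp_fourierInv_eq]
  refine Lp.ext ?_
  filter_upwards [(𝓕⁻ (SchwartzMap.compSubConstCLM ℂ a φ)).coeFn_toLp 2 (volume : Measure Config),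
    coeFn_modulate a ((𝓕⁻ φ).toLp 2), (𝓕⁻ φ).coeFn_toLp 2 (volume : Measure Config)] with x e1 e2 e3
  rw [e1, e2, e3, SchwartzMap.fourierInv_coe, SchwartzMap.fourierInv_coe, Real.fourierInv_eq,
    Real.fourierInv_eq, ← integral_add_right_eq_self _ a, ← integral_const_mul]
  refine integral_congr_ae (.of_forall fun v => ?_)
  simp only [SchwartzMap.compSubConstCLM_apply, add_sub_cancel_right, Circle.smul_def, smul_eq_mul]
  rw [inner_add_left, AddChar.map_add_eq_mul, Circle.coe_mul]
  ring

theorem inner_modulate (a : Config) (ψ φ : Hilb) :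
    inner ℂ ψ (modulate a φ) = inner ℂ (Lp.fourierTransformₗᵢ Config ℂ ψ)
      (translate a (Lp.fourierTransformₗᵢ Config ℂ φ)) := by
  rw [← (Lp.fourierTransformₗᵢ Config ℂ).symm.inner_map_map
      (Lp.fourierTransformₗᵢ Config ℂ ψ), fourierInv_translate,
    LinearIsometryEquiv.symm_apply_apply, LinearIsometryEquiv.symm_apply_apply]

/-- The Gaussian becomes a positive superposition of characters, so multiplication by it becomes a
positive average of momentum shifts. -/
theorem gaussian_eq_integral {s : ℝ} (hs : 0 < s) (y : Space) :
    (Real.exp (-(Real.pi * s * ‖y‖ ^ 2)) : ℂ) = ∫ k : Space,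
      ((s ^ (-(3 / 2) : ℝ) * Real.exp (-(Real.pi * ‖k‖ ^ 2 / s)) : ℝ) : ℂ) *
        (𝐞 (inner ℝ k y) : ℂ) := by
  have h := GaussianFourier.integral_cexp_neg_mul_sq_norm_add (b := ((Real.pi / s : ℝ) : ℂ))
    (by rw [Complex.ofReal_re]; positivity) (2 * Real.pi * Complex.I) y
  have hb : (Real.pi : ℂ) / ((Real.pi / s : ℝ) : ℂ) = (s : ℂ) := by
    push_cast
    field_simp
  have he : (2 * Real.pi * Complex.I) ^ 2 * (‖y‖ : ℂ) ^ 2 / (4 * ((Real.pi / s : ℝ) : ℂ))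
      = ((-(Real.pi * s * ‖y‖ ^ 2) : ℝ) : ℂ) := by
    push_cast
    field_simp
    rw [Complex.I_sq]
    ring
  rw [hb, he, finrank_euclideanSpace_fin, ← Complex.ofReal_exp] at h
  have hc : (s : ℂ) ^ (((3 : ℕ) : ℂ) / 2) = ((s ^ (3 / 2 : ℝ) : ℝ) : ℂ) := by
    rw [Complex.ofReal_cpow hs.le]
    push_cast
    rfl
  rw [hc] at h
  have hs' : ((s ^ (-(3 / 2) : ℝ) : ℝ) : ℂ) * ((s ^ (3 / 2 : ℝ) : ℝ) : ℂ) = 1 := by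
    rw [← Complex.ofReal_mul, ← Real.rpow_add hs]
    norm_num
  calc _ = ((s ^ (-(3 / 2) : ℝ) : ℝ) : ℂ) * (((s ^ (3 / 2 : ℝ) : ℝ) : ℂ) *
        (Real.exp (-(Real.pi * s * ‖y‖ ^ 2)) : ℂ)) := by rw [← mul_assoc, hs', one_mul]
    _ = _ := by
      rw [← h, ← integral_const_mul]
      refine integral_congr_ae (.of_forall fun k => ?_)
      simp only
      rw [Complex.exp_add, Complex.ofReal_mul, ← mul_assoc, Real.fourierChar_apply,
        real_inner_comm y k, Complex.ofReal_exp]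
      congr 1
      · congr 2
        push_cast
        ring
      · congr 1
        push_cast
        ring

theorem inner_anti (k : Space) (x : Config) : inner ℝ (anti k) x = inner ℝ k (x.fst - x.snd) := by
  rw [inner_sub_right, sub_eq_add_neg, ← inner_neg_left]
  rfl

/-! ### Gaussian mixtures in position space and in momentum space -/

/-- The Fourier transform on the two-particle Hilbert space. -/
abbrev ft : Hilb ≃ₗᵢ[ℂ] Hilb := Lp.fourierTransformₗᵢ Config ℂ

theorem enorm_integral_eq {X : Type*} [MeasurableSpace X] {μ : Measure X} {f : X → ℂ}
    (hf : Integrable f μ) (h : ∀ᵐ x ∂μ, f x = (‖f x‖ : ℂ)) : ‖∫ x, f x ∂μ‖ₑ = ∫⁻ x, ‖f x‖ₑ ∂μ := by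
  rw [integral_congr_ae h, integral_complex_ofReal, ← ofReal_integral_norm_eq_lintegral_enorm hf,
    ← ofReal_norm, Complex.norm_real, Real.norm_of_nonneg (by positivity)]

theorem enorm_complex_ofReal {r : ℝ} (hr : 0 ≤ r) : ‖(r : ℂ)‖ₑ = ENNReal.ofReal r := by
  rw [← ofReal_norm, Complex.norm_real, Real.norm_of_nonneg hr]

theorem integrable_inner (ψ φ : Hilb) : Integrable fun x => inner ℂ (ψ x) (φ x) :=
  L2.integrable_inner ψ φ

theorem enorm_inner_complex (a b : ℂ) : ‖inner ℂ a b‖ₑ = ‖a‖ₑ * ‖b‖ₑ := by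
  rw [RCLike.inner_apply, enorm_mul, mul_comm, RCLike.enorm_conj]

theorem enorm_inner_le (ψ φ : Hilb) : ‖inner ℂ ψ φ‖ₑ ≤ ∫⁻ x, ‖ψ x‖ₑ * ‖φ x‖ₑ := by
  rw [L2.inner_def]
  refine (enorm_integral_le_lintegral_enorm _).trans (lintegral_mono fun x => ?_)
  exact (enorm_inner_complex _ _).le

/-- The Fourier transform of the Gaussian `exp (-π s |y|²)` on `ℝ³`. -/
def gaussKer (s : ℝ) (k : Space) : ℝ := s ^ (-(3 / 2) : ℝ) * Real.exp (-(Real.pi * ‖k‖ ^ 2 / s))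

theorem gaussKer_nonneg {s : ℝ} (hs : 0 < s) (k : Space) : 0 ≤ gaussKer s k := by
  unfold gaussKer
  positivity

@[fun_prop]
theorem measurable_gaussKer : Measurable fun z : ℝ × Space => gaussKer z.1 z.2 := by
  unfold gaussKer
  fun_prop

theorem lintegral_gaussKer {s : ℝ} (hs : 0 < s) : ∫⁻ k, ENNReal.ofReal (gaussKer s k) = 1 := by
  have h := lintegral_gaussian (inv_pos.2 hs)
  have e (k : Space) : ENNReal.ofReal (gaussKer s k) = ENNReal.ofReal (s ^ (-(3 / 2) : ℝ)) *
      ENNReal.ofReal (Real.exp (-(Real.pi * s⁻¹ * ‖k‖ ^ 2))) := by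
    rw [gaussKer, ENNReal.ofReal_mul (by positivity)]
    congr 4
    ring
  simp_rw [e]
  rw [lintegral_const_mul _ (by fun_prop), h, ← ENNReal.ofReal_mul (by positivity),
    Real.inv_rpow hs.le, mul_inv_cancel₀ (by positivity), ENNReal.ofReal_one]

theorem integrable_gaussKer {s : ℝ} (hs : 0 < s) : Integrable (gaussKer s) := by
  refine ⟨by unfold gaussKer; fun_prop, ?_⟩
  rw [hasFiniteIntegral_iff_ofReal (.of_forall (gaussKer_nonneg hs)), lintegral_gaussKer hs]
  exact ENNReal.one_lt_top

theorem integrable_fourierChar_mul {s : ℝ} (hs : 0 < s) (ψ φ : Hilb) :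
    Integrable (Function.uncurry fun (x : Config) (k : Space) => (𝐞 (inner ℝ (anti k) x) : ℂ) *
      (inner ℂ (ψ x) (φ x) * (gaussKer s k : ℂ))) (volume.prod volume) := by
  refine Integrable.bdd_mul (c := 1) ((integrable_inner ψ φ).mul_prod
    (integrable_gaussKer hs).ofReal) (Continuous.aestronglyMeasurable (by fun_prop)) ?_
  exact .of_forall fun z => (Circle.norm_coe _).le

theorem gaussKer_mul_inner (s : ℝ) (ψ φ : Hilb) (k : Space) :
    (gaussKer s k : ℂ) * inner ℂ (ft ψ) (translate (anti k) (ft φ))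
      = ∫ x : Config, (𝐞 (inner ℝ (anti k) x) : ℂ) *
        (inner ℂ (ψ x) (φ x) * (gaussKer s k : ℂ)) := by
  rw [← inner_modulate, L2.inner_def, ← integral_const_mul]
  refine integral_congr_ae ?_
  filter_upwards [coeFn_modulate (anti k) φ] with x hx
  rw [hx, ← smul_eq_mul (𝐞 (inner ℝ (anti k) x) : ℂ) (φ x), inner_smul_right]
  ring

theorem integral_gaussian_mul_inner {s : ℝ} (hs : 0 < s) (ψ φ : Hilb) :
    ∫ x : Config, (Real.exp (-(Real.pi * s * ‖x.fst - x.snd‖ ^ 2)) : ℂ) * inner ℂ (ψ x) (φ x)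
      = ∫ k, (gaussKer s k : ℂ) * inner ℂ (ft ψ) (translate (anti k) (ft φ)) := by
  have h1 (x : Config) : (Real.exp (-(Real.pi * s * ‖x.fst - x.snd‖ ^ 2)) : ℂ) *
      inner ℂ (ψ x) (φ x) = ∫ k : Space, (𝐞 (inner ℝ (anti k) x) : ℂ) *
        (inner ℂ (ψ x) (φ x) * (gaussKer s k : ℂ)) := by
    rw [gaussian_eq_integral hs, ← integral_mul_const]
    refine integral_congr_ae (.of_forall fun k => ?_)
    simp only [inner_anti, gaussKer]
    ring
  simp_rw [h1, gaussKer_mul_inner]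
  exact integral_integral_swap (integrable_fourierChar_mul hs ψ φ)

theorem enorm_integral_gaussian_le {s : ℝ} (hs : 0 < s) (ψ φ : Hilb) :
    ‖∫ x : Config, (Real.exp (-(Real.pi * s * ‖x.fst - x.snd‖ ^ 2)) : ℂ) * inner ℂ (ψ x) (φ x)‖ₑ
      ≤ bil (fun k => ENNReal.ofReal (gaussKer s k)) (fun ξ => ‖ft ψ ξ‖ₑ) (fun ξ => ‖ft φ ξ‖ₑ) := by
  rw [integral_gaussian_mul_inner hs]
  refine (enorm_integral_le_lintegral_enorm _).trans (lintegral_mono fun k => ?_)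
  rw [enorm_mul]
  gcongr
  · rw [enorm_complex_ofReal (gaussKer_nonneg hs k)]
  · refine (enorm_inner_le _ _).trans_eq (lintegral_congr_ae ?_)
    filter_upwards [coeFn_translate (anti k) (ft φ)] with ξ hξ
    rw [hξ]

theorem lintegral_gaussian_mul_sq {s : ℝ} (hs : 0 < s) (ψ : Hilb) :
    ∫⁻ x : Config, ENNReal.ofReal (Real.exp (-(Real.pi * s * ‖x.fst - x.snd‖ ^ 2))) * ‖ψ x‖ₑ ^ 2
      = ‖∫ x : Config, (Real.exp (-(Real.pi * s * ‖x.fst - x.snd‖ ^ 2)) : ℂ) *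
          inner ℂ (ψ x) (ψ x)‖ₑ := by
  rw [enorm_integral_eq]
  · refine lintegral_congr fun x => ?_
    rw [enorm_mul, enorm_inner_complex, enorm_complex_ofReal (Real.exp_pos _).le, sq ‖ψ x‖ₑ]
  · refine (integrable_inner ψ ψ).bdd_mul (c := 1)
      (Continuous.aestronglyMeasurable (by fun_prop)) (.of_forall fun x => ?_)
    rw [Complex.norm_real, Real.norm_of_nonneg (Real.exp_pos _).le]
    exact Real.exp_le_one_iff.2 (neg_nonpos.2 (by positivity))
  · refine .of_forall fun x => ?_
    rw [norm_mul, Complex.norm_real, Real.norm_of_nonneg (Real.exp_pos _).le,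
      inner_self_eq_norm_sq_to_K, norm_pow]
    simp

theorem inner_translate_eq {ψ : Hilb} (hψ : ∀ᵐ ξ, ψ ξ = (‖ψ ξ‖ : ℂ)) (a : Config) :
    ∀ᵐ ξ, inner ℂ (ψ ξ) (translate a ψ ξ) = ((‖ψ ξ‖ * ‖ψ (ξ - a)‖ : ℝ) : ℂ) := by
  have hψ' := (measurePreserving_sub_right volume a).quasiMeasurePreserving.ae hψ
  filter_upwards [hψ, hψ', coeFn_translate a ψ] with ξ h1 h2 h3
  rw [h3, RCLike.inner_apply, h1, h2, Complex.conj_ofReal]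
  simp only [Complex.norm_real, norm_norm]
  rw [← Complex.ofReal_mul, mul_comm]

theorem enorm_inner_translate {ψ : Hilb} (hψ : ∀ᵐ ξ, ψ ξ = (‖ψ ξ‖ : ℂ)) (a : Config) :
    ‖inner ℂ ψ (translate a ψ)‖ₑ = ∫⁻ ξ, ‖ψ ξ‖ₑ * ‖ψ (ξ - a)‖ₑ := by
  rw [L2.inner_def, enorm_integral_eq (integrable_inner _ _)]
  · refine lintegral_congr_ae ?_
    filter_upwards [coeFn_translate a ψ] with ξ h
    rw [enorm_inner_complex, h]
  · filter_upwards [inner_translate_eq hψ a] with ξ h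
    rw [h, Complex.norm_real, Real.norm_of_nonneg (by positivity)]

theorem inner_translate_eq_norm {ψ : Hilb} (hψ : ∀ᵐ ξ, ψ ξ = (‖ψ ξ‖ : ℂ)) (a : Config) :
    inner ℂ ψ (translate a ψ) = (‖inner ℂ ψ (translate a ψ)‖ : ℂ) := by
  rw [L2.inner_def, integral_congr_ae (inner_translate_eq hψ a), integral_complex_ofReal,
    Complex.norm_real, Real.norm_of_nonneg (by positivity)]

/-- No cancellation occurs when the transform of ψ is nonnegative. This equality supplies the lower
bound needed for sharpness. -/
theorem lintegral_gaussian_mul_sq_eq {s : ℝ} (hs : 0 < s) (ψ : Hilb)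
    (hψ : ∀ᵐ ξ, ft ψ ξ = (‖ft ψ ξ‖ : ℂ)) :
    ∫⁻ x : Config, ENNReal.ofReal (Real.exp (-(Real.pi * s * ‖x.fst - x.snd‖ ^ 2))) * ‖ψ x‖ₑ ^ 2
      = bil (fun k => ENNReal.ofReal (gaussKer s k)) (fun ξ => ‖ft ψ ξ‖ₑ)
          (fun ξ => ‖ft ψ ξ‖ₑ) := by
  rw [lintegral_gaussian_mul_sq hs, integral_gaussian_mul_inner hs, enorm_integral_eq]
  · refine lintegral_congr fun k => ?_
    rw [enorm_mul, enorm_complex_ofReal (gaussKer_nonneg hs k), enorm_inner_translate hψ]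
  · simp_rw [gaussKer_mul_inner]
    exact (integrable_fourierChar_mul hs ψ ψ).integral_prod_right
  · refine .of_forall fun k => ?_
    rw [inner_translate_eq_norm hψ, ← Complex.ofReal_mul, Complex.norm_real,
      Real.norm_of_nonneg (mul_nonneg (gaussKer_nonneg hs k) (norm_nonneg _))]

/-- The Gaussian mixture `∫ exp (-π u |y|²) dμ(u)`. -/
def mix (μ : Measure ℝ) (y : Space) : ℝ≥0∞ :=
  ∫⁻ u, ENNReal.ofReal (Real.exp (-(Real.pi * u * ‖y‖ ^ 2))) ∂μ

/-- The Fourier transform of the Gaussian mixture `mix μ`. -/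
def mixKer (μ : Measure ℝ) (k : Space) : ℝ≥0∞ := ∫⁻ u, ENNReal.ofReal (gaussKer u k) ∂μ

section Mixture

variable {μ : Measure ℝ} [SFinite μ]

theorem measurable_mix : Measurable (mix μ) := by
  unfold mix
  fun_prop

theorem measurable_mixKer : Measurable (mixKer μ) := by
  unfold mixKer
  fun_prop

theorem lintegral_bil_gaussKer {g f : Config → ℝ≥0∞} (hg : Measurable g) (hf : Measurable f) :
    ∫⁻ u, bil (fun k => ENNReal.ofReal (gaussKer u k)) g f ∂μ = bil (mixKer μ) g f := by
  unfold bil mixKer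
  rw [lintegral_lintegral_swap (by fun_prop)]
  exact lintegral_congr fun k => lintegral_mul_const _ (by fun_prop)

theorem lintegral_mix_mul_sq (ψ : Hilb) :
    ∫⁻ x : Config, mix μ (x.fst - x.snd) * ‖ψ x‖ₑ ^ 2
      = ∫⁻ u, (∫⁻ x : Config, ENNReal.ofReal (Real.exp (-(Real.pi * u * ‖x.fst - x.snd‖ ^ 2))) *
          ‖ψ x‖ₑ ^ 2) ∂μ := by
  unfold mix
  rw [lintegral_lintegral_swap (by fun_prop)]
  exact lintegral_congr fun x => (lintegral_mul_const _ (by fun_prop)).symm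

theorem lintegral_mix_mul_sq_le (hμ : ∀ᵐ u ∂μ, 0 < u) (ψ : Hilb) :
    ∫⁻ x : Config, mix μ (x.fst - x.snd) * ‖ψ x‖ₑ ^ 2
      ≤ bil (mixKer μ) (fun ξ => ‖ft ψ ξ‖ₑ) (fun ξ => ‖ft ψ ξ‖ₑ) := by
  rw [lintegral_mix_mul_sq, ← lintegral_bil_gaussKer (by fun_prop) (by fun_prop)]
  refine lintegral_mono_ae ?_
  filter_upwards [hμ] with u hu
  rw [lintegral_gaussian_mul_sq hu]
  exact enorm_integral_gaussian_le hu ψ ψ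

theorem lintegral_mix_mul_sq_eq (hμ : ∀ᵐ u ∂μ, 0 < u) (ψ : Hilb)
    (hψ : ∀ᵐ ξ, ft ψ ξ = (‖ft ψ ξ‖ : ℂ)) :
    ∫⁻ x : Config, mix μ (x.fst - x.snd) * ‖ψ x‖ₑ ^ 2
      = bil (mixKer μ) (fun ξ => ‖ft ψ ξ‖ₑ) (fun ξ => ‖ft ψ ξ‖ₑ) := by
  rw [lintegral_mix_mul_sq, ← lintegral_bil_gaussKer (by fun_prop) (by fun_prop)]
  refine lintegral_congr_ae ?_
  filter_upwards [hμ] with u hu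
  exact lintegral_gaussian_mul_sq_eq hu ψ hψ

/-- The off-diagonal version needs `hfin` for Fubini, since the integrand has no sign; the quadratic
form needs only Tonelli. -/
theorem enorm_integral_mix_le (hμ : ∀ᵐ u ∂μ, 0 < u) (ψ φ : Hilb)
    (hfin : ∫⁻ x : Config, mix μ (x.fst - x.snd) * (‖ψ x‖ₑ * ‖φ x‖ₑ) ≠ ∞) :
    ‖∫ x : Config, ((mix μ (x.fst - x.snd)).toReal : ℂ) * inner ℂ (ψ x) (φ x)‖ₑ
      ≤ bil (mixKer μ) (fun ξ => ‖ft ψ ξ‖ₑ) (fun ξ => ‖ft φ ξ‖ₑ) := by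
  have h1 (x : Config) : ((mix μ (x.fst - x.snd)).toReal : ℂ) * inner ℂ (ψ x) (φ x)
      = ∫ u, (Real.exp (-(Real.pi * u * ‖x.fst - x.snd‖ ^ 2)) : ℂ) * inner ℂ (ψ x) (φ x) ∂μ := by
    rw [integral_mul_const, integral_complex_ofReal, integral_eq_lintegral_of_nonneg_ae
      (.of_forall fun u => (Real.exp_pos _).le) (by fun_prop), mix]
  have hm : AEStronglyMeasurable (Function.uncurry fun (x : Config) (u : ℝ) =>
      (Real.exp (-(Real.pi * u * ‖x.fst - x.snd‖ ^ 2)) : ℂ) * inner ℂ (ψ x) (φ x))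
      ((volume : Measure Config).prod μ) := by
    refine AEStronglyMeasurable.mul (Continuous.aestronglyMeasurable (by fun_prop)) ?_
    exact (integrable_inner ψ φ).aestronglyMeasurable.comp_fst
  simp_rw [h1]
  rw [integral_integral_swap]
  · rw [← lintegral_bil_gaussKer (by fun_prop) (by fun_prop)]
    refine (enorm_integral_le_lintegral_enorm _).trans (lintegral_mono_ae ?_)
    filter_upwards [hμ] with u hu
    exact enorm_integral_gaussian_le hu ψ φ
  · refine ⟨hm, ?_⟩
    rw [HasFiniteIntegral, lintegral_prod _ hm.enorm]
    refine (lintegral_congr fun x => ?_).trans_lt (lt_top_iff_ne_top.2 hfin)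
    simp only [Function.uncurry, enorm_mul, enorm_inner_complex]
    rw [lintegral_mul_const _ (by fun_prop), mix]
    congr 1
    refine lintegral_congr fun u => ?_
    rw [enorm_complex_ofReal (Real.exp_pos _).le]

end Mixture

/-! ### The powers and the regularized Coulomb potential as Gaussian mixtures -/

/-- The measure on `(0, ∞)` with density `ρ`. -/
def mixMeasure (ρ : ℝ → ℝ≥0∞) : Measure ℝ := (volume.restrict (Set.Ioi 0)).withDensity ρ

instance (ρ : ℝ → ℝ≥0∞) : SFinite (mixMeasure ρ) := by
  unfold mixMeasure
  infer_instance

theorem ae_mixMeasure_pos (ρ : ℝ → ℝ≥0∞) : ∀ᵐ u ∂mixMeasure ρ, 0 < u :=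
  withDensity_absolutelyContinuous _ _ (ae_restrict_mem measurableSet_Ioi)

theorem lintegral_mixMeasure {ρ : ℝ → ℝ≥0∞} (hρ : Measurable ρ) {f : ℝ → ℝ≥0∞}
    (hf : Measurable f) : ∫⁻ u, f u ∂mixMeasure ρ = ∫⁻ u in Set.Ioi 0, ρ u * f u := by
  rw [mixMeasure, lintegral_withDensity_eq_lintegral_mul _ hρ hf]
  rfl

theorem mixKer_mono {ρ ρ' : ℝ → ℝ≥0∞} (hρ : Measurable ρ) (hρ' : Measurable ρ') {c : ℝ≥0∞}
    (h : ∀ u, 0 < u → ρ u ≤ c * ρ' u) (k : Space) :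
    mixKer (mixMeasure ρ) k ≤ c * mixKer (mixMeasure ρ') k := by
  unfold mixKer
  rw [lintegral_mixMeasure hρ (by fun_prop), lintegral_mixMeasure hρ' (by fun_prop),
    ← lintegral_const_mul _ (by fun_prop)]
  refine setLIntegral_mono' measurableSet_Ioi fun u hu => ?_
  rw [← mul_assoc]
  exact mul_le_mul_left (h u hu) _

/-- Each `gaussKer u` has mass one, which is the value at 0 of the Gaussian it transforms. -/
theorem lintegral_mixKer {μ : Measure ℝ} [SFinite μ] (hμ : ∀ᵐ u ∂μ, 0 < u) :
    ∫⁻ k, mixKer μ k = mix μ 0 := by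
  unfold mixKer mix
  rw [lintegral_lintegral_swap (by fun_prop)]
  refine lintegral_congr_ae ?_
  filter_upwards [hμ] with u hu
  rw [lintegral_gaussKer hu]
  simp

/-- The density whose Gaussian mixture is a multiple of `|y|^(-2s)`. -/
def powDensity (s : ℝ) (u : ℝ) : ℝ≥0∞ := ENNReal.ofReal (u ^ (s - 1))

@[fun_prop]
theorem measurable_powDensity (s : ℝ) : Measurable (powDensity s) := by
  unfold powDensity
  fun_prop

theorem mix_pow {s : ℝ} (hs : 0 < s) {y : Space} (hy : y ≠ 0) :
    mix (mixMeasure (powDensity s)) y = ENNReal.ofReal (gammaPi s) * ‖y‖ₑ ^ (-(2 * s)) := by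
  rw [mix, lintegral_mixMeasure (by fun_prop) (by fun_prop), ← lintegral_gaussian_mixture hs hy]
  refine setLIntegral_congr_fun measurableSet_Ioi fun u hu => ?_
  rw [powDensity, ← ENNReal.ofReal_mul (Real.rpow_nonneg (le_of_lt hu) _)]
  ring_nf

/-- No lower bound on s is needed: the kernel is finite even where `mix` diverges. The case s = 0 is
used when δ = 1 in `mixKer_reg_le`. -/
theorem mixKer_pow {s : ℝ} (hs : s < 3 / 2) {k : Space} (hk : k ≠ 0) :
    mixKer (mixMeasure (powDensity s)) k
      = ENNReal.ofReal (gammaPi (3 / 2 - s)) * ‖k‖ₑ ^ (2 * s - 3) := by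
  have h := lintegral_gaussian_mixture_inv (s := 3 / 2 - s) (by linarith) hk
  rw [show -(2 * (3 / 2 - s)) = 2 * s - 3 by ring] at h
  rw [mixKer, lintegral_mixMeasure (by fun_prop) (by fun_prop), ← h]
  refine setLIntegral_congr_fun measurableSet_Ioi fun u hu => ?_
  have hu : 0 < u := hu
  rw [powDensity, ← ENNReal.ofReal_mul (by positivity), gaussKer, ← mul_assoc, ← Real.rpow_add hu]
  ring_nf

/-! ### The regularized Coulomb potential as a Gaussian mixture. -/

theorem lintegral_Ioi_of_hasDerivAt {F F' : ℝ → ℝ} {L : ℝ}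
    (hcont : ContinuousWithinAt F (Set.Ici 0) 0) (hF : ∀ v, 0 < v → HasDerivAt F (F' v) v)
    (hpos : ∀ v, 0 < v → 0 ≤ F' v) (hL : Filter.Tendsto F Filter.atTop (nhds L)) :
    ∫⁻ v in Set.Ioi 0, ENNReal.ofReal (F' v) = ENNReal.ofReal (L - F 0) := by
  rw [← integral_Ioi_of_hasDerivAt_of_nonneg hcont hF hpos hL,
    ofReal_integral_eq_lintegral_ofReal (integrableOn_Ioi_deriv_of_nonneg hcont hF hpos hL)]
  filter_upwards [ae_restrict_mem measurableSet_Ioi] with v hv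
  exact hpos v hv

/-- At r = 0 the convention v / 0 = 0 makes both the function and its derivative vanish, so the
origin y = 0 is covered later. -/
theorem hasDerivAt_mul_arctan_div (r : ℝ) {v : ℝ} (hv : 0 < v) :
    HasDerivAt (fun v => r * Real.arctan (v / r)) (r ^ 2 / (v ^ 2 + r ^ 2)) v := by
  rcases eq_or_ne r 0 with rfl | hr
  · simpa using hasDerivAt_const v (0 : ℝ)
  · have h := (((hasDerivAt_id v).div_const r).arctan).const_mul r
    refine h.congr_deriv ?_
    simp only [id]
    have : v ^ 2 + r ^ 2 ≠ 0 := by positivity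
    have : 1 + (v / r) ^ 2 ≠ 0 := by positivity
    field_simp
    ring

theorem tendsto_mul_arctan_div {r : ℝ} (hr : 0 ≤ r) :
    Filter.Tendsto (fun v => r * Real.arctan (v / r)) Filter.atTop (nhds (r * (Real.pi / 2))) := by
  rcases hr.eq_or_lt with rfl | hr
  · simp
  · refine Filter.Tendsto.const_mul _ ?_
    exact (Real.tendsto_arctan_atTop.mono_right nhdsWithin_le_nhds).comp
      (Filter.tendsto_id.atTop_div_const hr)

/-- Partial fractions reduce the integrand to (r²/(v²+r²) - η²/(v²+η²))/(r²-η²), whose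
antiderivatives are arctangents. At r = η the partial fractions degenerate and another
antiderivative is used. -/
theorem lintegral_poisson {η r : ℝ} (hη : 0 < η) (hr : 0 ≤ r) :
    ∫⁻ v in Set.Ioi (0 : ℝ), ENNReal.ofReal (2 / Real.pi * (v ^ 2 / ((v ^ 2 + η ^ 2) *
      (v ^ 2 + r ^ 2)))) = ENNReal.ofReal (r + η)⁻¹ := by
  rcases eq_or_ne r η with rfl | hne
  · have h := lintegral_Ioi_of_hasDerivAt
      (F := fun v => 1 / Real.pi * ((r * Real.arctan (v / r)) / r ^ 2 - v / (v ^ 2 + r ^ 2)))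
      (F' := fun v => 2 / Real.pi * (v ^ 2 / ((v ^ 2 + r ^ 2) * (v ^ 2 + r ^ 2))))
      (L := 1 / Real.pi * ((r * (Real.pi / 2)) / r ^ 2 - 0)) ?_ ?_ ?_ ?_
    · rw [h]
      congr 1
      have := Real.pi_pos
      simp
      field_simp
      norm_num
    · refine Continuous.continuousWithinAt ?_
      have hp : ∀ v : ℝ, v ^ 2 + r ^ 2 ≠ 0 := fun v => by positivity
      fun_prop (disch := assumption)
    · intro v hv
      have hp : v ^ 2 + r ^ 2 ≠ 0 := by positivity
      have h1 := ((hasDerivAt_mul_arctan_div r hv).div_const (r ^ 2)).sub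
        ((hasDerivAt_id v).div ((hasDerivAt_pow 2 v).add_const (r ^ 2)) hp)
      refine (h1.const_mul (1 / Real.pi)).congr_deriv ?_
      simp only [id]
      have := Real.pi_pos
      field_simp
      push_cast
      ring
    · intro v hv
      positivity
    · refine Filter.Tendsto.const_mul _ (Filter.Tendsto.sub
        ((tendsto_mul_arctan_div hr).div_const _) ?_)
      refine squeeze_zero' (g := fun v : ℝ => v⁻¹) ?_ ?_ tendsto_inv_atTop_zero
      · filter_upwards [Filter.eventually_gt_atTop 0] with v hv
        positivity
      · filter_upwards [Filter.eventually_gt_atTop 0] with v hv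
        rw [div_le_iff₀ (by positivity)]
        field_simp
        nlinarith
  · have hd : r ^ 2 - η ^ 2 ≠ 0 := by
      rw [sq_sub_sq]
      exact mul_ne_zero (by positivity) (sub_ne_zero.2 hne)
    have h := lintegral_Ioi_of_hasDerivAt
      (F := fun v => 2 / Real.pi * ((r * Real.arctan (v / r) - η * Real.arctan (v / η)) /
        (r ^ 2 - η ^ 2)))
      (F' := fun v => 2 / Real.pi * (v ^ 2 / ((v ^ 2 + η ^ 2) * (v ^ 2 + r ^ 2))))
      (L := 2 / Real.pi * ((r * (Real.pi / 2) - η * (Real.pi / 2)) / (r ^ 2 - η ^ 2))) ?_ ?_ ?_ ?_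
    · rw [h]
      congr 1
      have := Real.pi_pos
      have h2 : r - η ≠ 0 := sub_ne_zero.2 hne
      have h3 : r + η ≠ 0 := by positivity
      rw [sq_sub_sq]
      simp
      field_simp
    · refine Continuous.continuousWithinAt ?_
      fun_prop
    · intro v hv
      have hp : v ^ 2 + r ^ 2 ≠ 0 := by positivity
      have hp' : v ^ 2 + η ^ 2 ≠ 0 := by positivity
      have h1 := ((hasDerivAt_mul_arctan_div r hv).sub (hasDerivAt_mul_arctan_div η hv)).div_const
        (r ^ 2 - η ^ 2)
      refine (h1.const_mul (2 / Real.pi)).congr_deriv ?_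
      congr 1
      rw [div_sub_div _ _ hp hp', div_div, div_eq_div_iff
        (mul_ne_zero (mul_ne_zero hp hp') hd) (by positivity)]
      ring
    · intro v hv
      positivity
    · exact (((tendsto_mul_arctan_div hr).sub (tendsto_mul_arctan_div hη.le)).div_const _).const_mul _

/-- The density whose Gaussian mixture is `(|y| + η)⁻¹`. -/
def regDensity (η : ℝ) (u : ℝ) : ℝ≥0∞ :=
  ∫⁻ v in Set.Ioi (0 : ℝ), ENNReal.ofReal (2 * (v ^ 2 / (v ^ 2 + η ^ 2)) *
    Real.exp (-(Real.pi * u * v ^ 2)))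

@[fun_prop]
theorem measurable_regDensity (η : ℝ) : Measurable (regDensity η) := by
  unfold regDensity
  fun_prop

/-- Insert 1/(v²+|y|²) = π∫exp(-πu(v²+|y|²)) du into `lintegral_poisson` and integrate in v first.
-/
theorem mix_reg {η : ℝ} (hη : 0 < η) (y : Space) :
    mix (mixMeasure (regDensity η)) y = ENNReal.ofReal (‖y‖ + η)⁻¹ := by
  rw [mix, lintegral_mixMeasure (by fun_prop) (by fun_prop),
    ← lintegral_poisson hη (norm_nonneg y)]
  unfold regDensity
  rw [lintegral_congr fun u => (lintegral_mul_const _ (by fun_prop)).symm,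
    lintegral_lintegral_swap (by fun_prop)]
  refine setLIntegral_congr_fun measurableSet_Ioi fun v hv => ?_
  have hv : 0 < v := hv
  have h1 : ∀ u : ℝ, ENNReal.ofReal (2 * (v ^ 2 / (v ^ 2 + η ^ 2)) *
      Real.exp (-(Real.pi * u * v ^ 2))) * ENNReal.ofReal (Real.exp (-(Real.pi * u * ‖y‖ ^ 2)))
      = ENNReal.ofReal (2 * (v ^ 2 / (v ^ 2 + η ^ 2))) * ENNReal.ofReal (u ^ ((1 : ℝ) - 1) *
        Real.exp (-(Real.pi * (v ^ 2 + ‖y‖ ^ 2) * u))) := by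
    intro u
    rw [← ENNReal.ofReal_mul (by positivity), ← ENNReal.ofReal_mul (by positivity), sub_self,
      Real.rpow_zero, one_mul, mul_assoc, ← Real.exp_add]
    ring_nf
  simp only [h1]
  rw [lintegral_const_mul _ (by fun_prop), lintegral_rpow_mul_exp one_pos (by positivity),
    ← ENNReal.ofReal_mul (by positivity), Real.Gamma_one, Real.rpow_neg_one]
  congr 1
  have := Real.pi_pos
  field_simp

/-- Weighted arithmetic-geometric means give v^(2-δ) η^δ ≤ v² + η². -/
theorem div_add_sq_le {η v δ : ℝ} (hη : 0 < η) (hv : 0 < v) (hδ : 0 ≤ δ) (hδ' : δ ≤ 2) :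
    v ^ 2 / (v ^ 2 + η ^ 2) ≤ η ^ (-δ) * v ^ δ := by
  have h := Real.geom_mean_le_arith_mean2_weighted (w₁ := 1 - δ / 2) (w₂ := δ / 2) (p₁ := v ^ 2)
    (p₂ := η ^ 2) (by linarith) (by linarith) (by positivity) (by positivity) (by ring)
  have h2 : (v ^ 2) ^ (1 - δ / 2) * (η ^ 2) ^ (δ / 2) ≤ v ^ 2 + η ^ 2 :=
    h.trans (by nlinarith [sq_nonneg v, sq_nonneg η])
  rw [← Real.rpow_natCast, ← Real.rpow_natCast, ← Real.rpow_mul hv.le, ← Real.rpow_mul hη.le] at h2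
  rw [div_le_iff₀ (by positivity)]
  calc v ^ 2 = η ^ (-δ) * v ^ δ *
        (v ^ (((2 : ℕ) : ℝ) * (1 - δ / 2)) * η ^ (((2 : ℕ) : ℝ) * (δ / 2))) := by
        have e1 : η ^ (-δ) * η ^ (((2 : ℕ) : ℝ) * (δ / 2)) = 1 := by
          rw [← Real.rpow_add hη]; push_cast; ring_nf; exact Real.rpow_zero _
        have e2 : v ^ δ * v ^ (((2 : ℕ) : ℝ) * (1 - δ / 2)) = v ^ 2 := by
          rw [← Real.rpow_add hv, ← Real.rpow_natCast]; push_cast; ring_nf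
        linear_combination (-v ^ 2) * e1 - (η ^ (-δ) * η ^ (((2 : ℕ) : ℝ) * (δ / 2))) * e2
    _ ≤ η ^ (-δ) * v ^ δ * (v ^ 2 + η ^ 2) := by
        rw [← Real.rpow_natCast v 2, ← Real.rpow_natCast η 2]
        gcongr

theorem regDensity_le {η δ u : ℝ} (hη : 0 < η) (hδ : 0 ≤ δ) (hδ' : δ ≤ 2) (hu : 0 < u) :
    regDensity η u ≤ ENNReal.ofReal (η ^ (-δ) * gammaPi ((1 + δ) / 2)) *
      powDensity ((1 - δ) / 2) u := by
  have hg := gammaPi_pos (s := (1 + δ) / 2) (by linarith)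
  have h1 := integral_rpow_mul_exp_neg_mul_rpow (p := 2) (q := δ) (b := Real.pi * u) two_pos
    (by linarith) (by positivity)
  have h2 := integrableOn_rpow_mul_exp_neg_mul_rpow (p := 2) (s := δ) (b := Real.pi * u)
    (by linarith) two_pos (by positivity)
  calc regDensity η u ≤ ∫⁻ v in Set.Ioi (0 : ℝ), ENNReal.ofReal (2 * η ^ (-δ)) *
        ENNReal.ofReal (v ^ δ * Real.exp (-(Real.pi * u) * v ^ (2 : ℝ))) := by
        refine setLIntegral_mono' measurableSet_Ioi fun v hv => ?_
        have hv : 0 < v := hv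
        rw [← ENNReal.ofReal_mul (by positivity)]
        refine ENNReal.ofReal_le_ofReal ?_
        rw [Real.rpow_two, neg_mul]
        have := div_add_sq_le hη hv hδ hδ'
        calc _ ≤ 2 * (η ^ (-δ) * v ^ δ) * Real.exp (-(Real.pi * u * v ^ 2)) := by gcongr
          _ = _ := by ring
    _ = ENNReal.ofReal (2 * η ^ (-δ)) * ENNReal.ofReal ((Real.pi * u) ^ (-(δ + 1) / 2) * (1 / 2) *
        Real.Gamma ((δ + 1) / 2)) := by
        rw [lintegral_const_mul _ (by fun_prop), ← h1, ofReal_integral_eq_lintegral_ofReal h2]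
        filter_upwards [ae_restrict_mem measurableSet_Ioi] with v hv
        have hv : 0 < v := hv
        simp only [Pi.zero_apply]
        positivity
    _ = _ := by
        rw [powDensity, ← ENNReal.ofReal_mul (by positivity), ← ENNReal.ofReal_mul (by positivity),
          gammaPi, Real.mul_rpow Real.pi_pos.le hu.le]
        ring_nf

/-- At δ = 0 this is the Coulomb kernel π⁻¹|k|⁻², uniformly in η. A positive δ trades η^(-δ) for
faster decay at large k. -/
theorem mixKer_reg_le {η δ : ℝ} (hη : 0 < η) (hδ : 0 ≤ δ) (hδ' : δ ≤ 2) {k : Space} (hk : k ≠ 0) :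
    mixKer (mixMeasure (regDensity η)) k ≤ ENNReal.ofReal (η ^ (-δ)) *
      (ENNReal.ofReal (gammaPi ((1 + δ) / 2) * gammaPi (1 + δ / 2)) * ‖k‖ₑ ^ (-2 - δ)) := by
  refine (mixKer_mono (by fun_prop) (by fun_prop)
    (fun u hu => regDensity_le hη hδ hδ' hu) k).trans_eq ?_
  have hg := gammaPi_pos (s := (1 + δ) / 2) (by linarith)
  rw [mixKer_pow (by linarith) hk, ENNReal.ofReal_mul (by positivity), ENNReal.ofReal_mul hg.le]
  ring_nf

/-! ### Form bounds for the powers `|x₁ - x₂|^(-a)` -/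

/-- The constant in the form bound of `|x₁ - x₂|^(-a)` by `|ξ₁|^(at) |ξ₂|^(a(1-t))`. -/
def hardyConst (a : ℝ) : ℝ≥0∞ :=
  (ENNReal.ofReal (gammaPi (a / 2)))⁻¹ * ENNReal.ofReal (gammaPi (3 / 2 - a / 2)) *
    convConst ((3 - a) / 2) ((3 + a) / 2 / 2)

theorem hardyConst_lt_top {a : ℝ} (ha : 0 < a) (ha' : a < 3) : hardyConst a < ∞ := by
  refine ENNReal.mul_lt_top (ENNReal.mul_lt_top ?_ ENNReal.ofReal_lt_top)
    (convConst_lt_top (by linarith) (by linarith) (by linarith) (by linarith))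
  simpa using gammaPi_pos (s := a / 2) (by linarith)

theorem hardyConst_one : hardyConst 1 = ENNReal.ofReal (Real.pi ^ 2) := by
  rw [hardyConst, gammaPi_half, show (3 / 2 - 1 / 2 : ℝ) = 1 by norm_num, gammaPi_one,
    show ((3 - 1) / 2 : ℝ) = 1 by norm_num, show ((3 + 1) / 2 / 2 : ℝ) = 1 by norm_num,
    convConst_one_one, ENNReal.ofReal_one, inv_one, one_mul, ← ENNReal.ofReal_mul (by positivity)]
  congr 1
  have := Real.pi_pos
  field_simp

theorem ennreal_half_mul_half (x : ℝ≥0∞) : x ^ (1 / 2 : ℝ) * x ^ (1 / 2 : ℝ) = x := by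
  rw [← ENNReal.rpow_add_of_nonneg _ _ (by norm_num) (by norm_num)]
  norm_num

/-- The exponent Z = W = (3 + a)/2 is the midpoint of the admissible interval (a, 3), and θ = θ' = t
puts the same weight on both functions. At a = 1 it gives Z = 2, the choice that yields the sharp
constant. -/
theorem bil_rpow_self_le {a t : ℝ} (ha : 0 < a) (ha' : a < 3) (ht : 0 ≤ t) (ht' : t ≤ 1)
    {g f : Config → ℝ≥0∞} (hg : Measurable g) (hf : Measurable f) :
    bil (fun k => ‖k‖ₑ ^ (a - 3)) g f ≤ convConst ((3 - a) / 2) ((3 + a) / 2 / 2) *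
      ((∫⁻ ξ, g ξ ^ (2 : ℝ) * wt (a * t) (a * (1 - t)) ξ) ^ (1 / 2 : ℝ) *
        (∫⁻ ξ, f ξ ^ (2 : ℝ) * wt (a * t) (a * (1 - t)) ξ) ^ (1 / 2 : ℝ)) := by
  refine (bil_rpow_le (Z := (3 + a) / 2) (W := (3 + a) / 2) (θ := t) (θ' := t) (g₁ := a * t)
    (g₂ := a * (1 - t)) (f₁ := a * t) (f₂ := a * (1 - t)) ha' (by linarith) (by linarith)
    (by linarith) (by linarith) ht ht' ht ht' (by ring) (by ring) (by ring) (by ring)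
    hg hf).trans_eq ?_
  rw [ENNReal.mul_rpow_of_nonneg _ _ (by norm_num), ENNReal.mul_rpow_of_nonneg _ _ (by norm_num),
    mul_mul_mul_comm, ennreal_half_mul_half]

theorem mixKer_pow_ae {a : ℝ} (ha : a < 3) : ∀ᵐ k : Space,
    mixKer (mixMeasure (powDensity (a / 2))) k
      = ENNReal.ofReal (gammaPi (3 / 2 - a / 2)) * ‖k‖ₑ ^ (a - 3) := by
  filter_upwards [ae_ne 0] with k hk
  rw [mixKer_pow (by linarith) hk]
  ring_nf

theorem bil_congr_ae {κ κ' : Space → ℝ≥0∞} (h : ∀ᵐ k, κ k = κ' k) (g f : Config → ℝ≥0∞) :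
    bil κ g f = bil κ' g f := by
  refine lintegral_congr_ae ?_
  filter_upwards [h] with k hk
  rw [hk]

theorem mix_pow_ae {a : ℝ} (ha : 0 < a) : ∀ᵐ x : Config, ‖x.fst - x.snd‖ₑ ^ (-a)
    = (ENNReal.ofReal (gammaPi (a / 2)))⁻¹ *
      mix (mixMeasure (powDensity (a / 2))) (x.fst - x.snd) := by
  filter_upwards [ae_sub_ne_zero] with x hx
  rw [mix_pow (by linarith) hx, ← mul_assoc, ENNReal.inv_mul_cancel, one_mul]
  · ring_nf
  · simpa using gammaPi_pos (s := a / 2) (by linarith)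
  · exact ENNReal.ofReal_ne_top

theorem lintegral_rpow_mul_sq_le {a t : ℝ} (ha : 0 < a) (ha' : a < 3) (ht : 0 ≤ t) (ht' : t ≤ 1)
    (ψ : Hilb) : ∫⁻ x : Config, ‖x.fst - x.snd‖ₑ ^ (-a) * ‖ψ x‖ₑ ^ 2
      ≤ hardyConst a * ∫⁻ ξ, wt (a * t) (a * (1 - t)) ξ * ‖ft ψ ξ‖ₑ ^ 2 := by
  have h1 : ∫⁻ x : Config, ‖x.fst - x.snd‖ₑ ^ (-a) * ‖ψ x‖ₑ ^ 2
      = (ENNReal.ofReal (gammaPi (a / 2)))⁻¹ * ∫⁻ x : Config,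
        mix (mixMeasure (powDensity (a / 2))) (x.fst - x.snd) * ‖ψ x‖ₑ ^ 2 := by
    have := measurable_mix (μ := mixMeasure (powDensity (a / 2)))
    rw [← lintegral_const_mul _ (by fun_prop)]
    refine lintegral_congr_ae ?_
    filter_upwards [mix_pow_ae ha] with x hx
    rw [hx, mul_assoc]
  rw [h1, hardyConst, mul_assoc, mul_assoc]
  gcongr
  refine (lintegral_mix_mul_sq_le (ae_mixMeasure_pos _) ψ).trans ?_
  rw [bil_congr_ae (mixKer_pow_ae ha'), bil_const_mul (by fun_prop) (by fun_prop) (by fun_prop)]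
  gcongr
  refine (bil_rpow_self_le ha ha' ht ht' (by fun_prop) (by fun_prop)).trans_eq ?_
  rw [ennreal_half_mul_half]
  congr 1
  refine lintegral_congr fun ξ => ?_
  rw [ENNReal.rpow_two, mul_comm]

theorem enorm_rpow_of_nonneg {E : Type*} [NormedAddCommGroup E] (v : E) {s : ℝ} (hs : 0 ≤ s) :
    ‖v‖ₑ ^ s = ENNReal.ofReal (‖v‖ ^ s) := by
  rw [← ofReal_norm, ENNReal.ofReal_rpow_of_nonneg (norm_nonneg v) hs]

theorem rpow_norm_le_symbol (v : Space) {s : ℝ} (hs : 0 ≤ s) :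
    (2 * Real.pi) ^ (s / 2) * ‖v‖ ^ (s / 2) ≤ (1 + ‖(2 * Real.pi) • v‖ ^ 2) ^ (s / 4) := by
  have hp := Real.pi_pos
  rw [← Real.mul_rpow (by positivity) (by positivity), norm_smul,
    Real.norm_of_nonneg (by positivity)]
  have : (2 * Real.pi * ‖v‖) ^ (s / 2) = ((2 * Real.pi * ‖v‖) ^ 2) ^ (s / 4) := by
    rw [← Real.rpow_natCast, ← Real.rpow_mul (by positivity)]
    push_cast
    ring_nf
  rw [this]
  gcongr
  linarith

/-- Dropping the 1 in 1 + p² bounds the symbol below by (2π)^a |ξ₁|^(α/2) |ξ₂|^(β/2). The choice t =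
α/(2a) produces exactly these exponents. -/
theorem posForm_le_of_hardy {a α β : ℝ} (ha : 0 < a) (ha' : a < 3) (hα : 0 < α) (hβ : 0 < β)
    (h : α + β = 2 * a) {m : Config → ℝ}
    (hm : ∀ᵐ x : Config, ENNReal.ofReal (m x) ≤ ‖x.fst - x.snd‖ₑ ^ (-a)) :
    LeSS m ((hardyConst a).toReal * (2 * Real.pi) ^ (-a)) α β := by
  intro ψ
  have hp := Real.pi_pos
  have hC := (hardyConst_lt_top ha ha').ne
  rw [ENNReal.ofReal_mul ENNReal.toReal_nonneg, ENNReal.ofReal_toReal hC, mul_assoc]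
  have h1 : posForm m ψ ≤ ∫⁻ x : Config, ‖x.fst - x.snd‖ₑ ^ (-a) * ‖ψ x‖ₑ ^ 2 := by
    refine lintegral_mono_ae ?_
    filter_upwards [hm] with x hx
    gcongr
  refine h1.trans ((lintegral_rpow_mul_sq_le (t := α / (2 * a)) ha ha' (by positivity)
    ((div_le_one (by positivity)).2 (by linarith)) ψ).trans ?_)
  gcongr
  rw [momentumForm, posForm, ← lintegral_const_mul' _ _ ENNReal.ofReal_ne_top]
  refine lintegral_mono fun ξ => ?_
  rw [← mul_assoc]
  gcongr
  have e1 : a * (α / (2 * a)) = α / 2 := by field_simp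
  have e2 : a * (1 - α / (2 * a)) = β / 2 := by
    field_simp
    linarith
  rw [wt, e1, e2, enorm_rpow_of_nonneg _ (by positivity), enorm_rpow_of_nonneg _ (by positivity),
    ← ENNReal.ofReal_mul (by positivity), ← ENNReal.ofReal_mul (by positivity)]
  refine ENNReal.ofReal_le_ofReal ?_
  have e3 : (2 * Real.pi) ^ (-a) * ((2 * Real.pi) ^ (α / 2) * (2 * Real.pi) ^ (β / 2)) = 1 := by
    rw [← Real.rpow_add (by positivity), ← Real.rpow_add (by positivity),
      show -a + (α / 2 + β / 2) = 0 by linarith, Real.rpow_zero]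
  calc ‖ξ.fst‖ ^ (α / 2) * ‖ξ.snd‖ ^ (β / 2)
      = (2 * Real.pi) ^ (-a) * (((2 * Real.pi) ^ (α / 2) * ‖ξ.fst‖ ^ (α / 2)) *
        ((2 * Real.pi) ^ (β / 2) * ‖ξ.snd‖ ^ (β / 2))) := by
        linear_combination (-(‖ξ.fst‖ ^ (α / 2) * ‖ξ.snd‖ ^ (β / 2))) * e3
    _ ≤ _ := by
        gcongr
        · exact rpow_norm_le_symbol ξ.fst hα.le
        · exact rpow_norm_le_symbol ξ.snd hβ.le

theorem exists_leSS_rpow (a : ℝ) (ha : a < 3) : ∃ C : ℝ, ∀ α β : ℝ, 0 < α → 0 < β →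
    α + β = 2 * a → LeSS (fun x => 1 / ‖x.fst - x.snd‖ ^ a) C α β := by
  refine ⟨(hardyConst a).toReal * (2 * Real.pi) ^ (-a), fun α β hα hβ h => ?_⟩
  -- Positivity of α and β forces a > 0, so nothing is claimed for a ≤ 0.
  refine posForm_le_of_hardy (by linarith) ha hα hβ h ?_
  filter_upwards [ae_sub_ne_zero] with x hx
  rw [one_div, ← Real.rpow_neg (norm_nonneg _), ofReal_norm_rpow hx]

theorem leSS_coulomb {α β : ℝ} (hα : 0 < α) (hβ : 0 < β) (h : α + β = 2) :
    LeSS (fun x => V (x.fst - x.snd)) (Real.pi / 2) α β := by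
  have hc : Real.pi / 2 = (hardyConst 1).toReal * (2 * Real.pi) ^ (-1 : ℝ) := by
    have := Real.pi_pos
    rw [hardyConst_one, ENNReal.toReal_ofReal (by positivity), Real.rpow_neg_one]
    field_simp
  rw [hc]
  refine posForm_le_of_hardy one_pos (by norm_num) hα hβ (by linarith) ?_
  filter_upwards [ae_sub_ne_zero] with x hx
  rw [V, ← Real.rpow_neg_one, ofReal_norm_rpow hx]

/-! ### Sharpness of the constant `π / 2` -/

/-- The coordinates are ξ₁ and the total momentum P = ξ₁ + ξ₂, which the interaction preserves. -/
theorem lintegral_config {G : Space × Space → ℝ≥0∞} (hG : Measurable G) :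
    ∫⁻ ξ : Config, G (ξ.fst, ξ.snd) = ∫⁻ x, ∫⁻ P, G (x, P - x) := by
  have h := (WithLp.volume_preserving_ofLp Space Space).lintegral_comp hG
  rw [show (fun ξ : Config => G (ξ.fst, ξ.snd)) = fun ξ : Config => G (WithLp.ofLp ξ) from rfl, h,
    Measure.volume_eq_prod, lintegral_prod _ (by fun_prop)]
  refine lintegral_congr fun x => ?_
  rw [lintegral_sub_right_eq_self (μ := (volume : Measure Space)) (fun y => G (x, y)) x]

theorem lintegral_smul_eq (f : Space → ℝ≥0∞) (hf : Measurable f) {r : ℝ} (hr : 0 < r) :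
    ∫⁻ x, f x = ENNReal.ofReal r ^ 3 * ∫⁻ x, f (r • x) := by
  have h := Measure.map_addHaar_smul (volume : Measure Space) hr.ne'
  have h2 : ∫⁻ x, f (r • x) = ENNReal.ofReal |(r ^ 3)⁻¹| * ∫⁻ x, f x := by
    rw [← lintegral_map hf (by fun_prop), h, lintegral_smul_measure, finrank_euclideanSpace_fin,
      smul_eq_mul]
  rw [h2, abs_of_pos (by positivity), ← mul_assoc, ← ENNReal.ofReal_pow hr.le,
    ← ENNReal.ofReal_mul (by positivity), mul_inv_cancel₀ (by positivity), ENNReal.ofReal_one,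
    one_mul]

/-- The spherical shell `r ≤ |x| < s`. -/
def shell (r s : ℝ) : Set Space := {x | r ≤ ‖x‖} ∩ {x | ‖x‖ < s}

theorem measurableSet_shell (r s : ℝ) : MeasurableSet (shell r s) :=
  (measurableSet_le measurable_const measurable_norm).inter
    (measurableSet_lt measurable_norm measurable_const)

theorem mem_shell {r s : ℝ} {x : Space} : x ∈ shell r s ↔ r ≤ ‖x‖ ∧ ‖x‖ < s := Iff.rfl

theorem ofReal_rpow_cancel {c : ℝ} (hc : 0 < c) {s t : ℝ} (h : s + t = 0) :
    ENNReal.ofReal c ^ s * ENNReal.ofReal c ^ t = 1 := by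
  rw [← ENNReal.rpow_add _ _ (by simpa using hc) ENNReal.ofReal_ne_top, h, ENNReal.rpow_zero]

theorem enorm_smul_pos {r : ℝ} (hr : 0 < r) (x : Space) : ‖r • x‖ₑ = ENNReal.ofReal r * ‖x‖ₑ := by
  rw [enorm_smul, Real.enorm_of_nonneg hr.le]

/-- The measure |x|⁻³ dx on ℝ³ is scale invariant. Hence a union of n geometric shells has n times
the mass of one, which is the logarithmic divergence. -/
theorem lintegral_shell_scale {r s c : ℝ} (hc : 0 < c) :
    ∫⁻ x in shell (c * r) (c * s), ‖x‖ₑ ^ (-3 : ℝ) = ∫⁻ x in shell r s, ‖x‖ₑ ^ (-3 : ℝ) := by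
  rw [← lintegral_indicator (measurableSet_shell _ _), ← lintegral_indicator (measurableSet_shell _ _),
    lintegral_smul_eq _ (Measurable.indicator (by fun_prop) (measurableSet_shell _ _)) hc,
    ← lintegral_const_mul' _ _ (ENNReal.pow_ne_top ENNReal.ofReal_ne_top)]
  refine lintegral_congr fun x => ?_
  have hmem : c • x ∈ shell (c * r) (c * s) ↔ x ∈ shell r s := by
    simp only [mem_shell, norm_smul, Real.norm_of_nonneg hc.le]
    rw [mul_le_mul_iff_right₀ hc, mul_lt_mul_iff_right₀ hc]
  by_cases hx : x ∈ shell r s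
  · rw [Set.indicator_of_mem hx, Set.indicator_of_mem (hmem.2 hx), enorm_smul_pos hc,
      ENNReal.mul_rpow_of_ne_top ENNReal.ofReal_ne_top enorm_ne_top, ← mul_assoc,
      ← ENNReal.rpow_natCast, ofReal_rpow_cancel hc (by norm_num), one_mul]
  · rw [Set.indicator_of_notMem hx, Set.indicator_of_notMem (mt hmem.1 hx), mul_zero]

theorem lintegral_shell_pow {c R : ℝ} (hc : 0 < c) (hR : 1 < R) (n : ℕ) :
    ∫⁻ x in shell c (c * R ^ n), ‖x‖ₑ ^ (-3 : ℝ) = n * ∫⁻ x in shell 1 R, ‖x‖ₑ ^ (-3 : ℝ) := by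
  induction n with
  | zero =>
    have : shell c (c * R ^ 0) = ∅ := by
      ext x
      simp only [mem_shell, Set.mem_empty_iff_false, pow_zero, mul_one, iff_false]
      exact fun h => h.1.not_gt h.2
    rw [this]
    simp
  | succ n ih =>
    have hR0 : 0 < R := by linarith
    have h1 : 1 ≤ R ^ n := one_le_pow₀ hR.le
    have hu : shell c (c * R ^ (n + 1)) = shell c (c * R ^ n) ∪ shell (c * R ^ n) (c * R ^ (n + 1)) := by
      have h2 : c ≤ c * R ^ n := le_mul_of_one_le_right hc.le h1
      have h3 : c * R ^ n ≤ c * R ^ (n + 1) := by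
        rw [pow_succ, ← mul_assoc]
        exact le_mul_of_one_le_right (by positivity) hR.le
      ext x
      simp only [mem_shell, Set.mem_union]
      constructor
      · rintro ⟨h4, h5⟩
        rcases lt_or_ge ‖x‖ (c * R ^ n) with h | h
        · exact Or.inl ⟨h4, h⟩
        · exact Or.inr ⟨h, h5⟩
      · rintro (⟨h4, h5⟩ | ⟨h4, h5⟩)
        · exact ⟨h4, h5.trans_le h3⟩
        · exact ⟨h2.trans h4, h5⟩
    have hd : Disjoint (shell c (c * R ^ n)) (shell (c * R ^ n) (c * R ^ (n + 1))) :=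
      Set.disjoint_left.2 fun x h4 h5 =>
      (mem_shell.1 h5).1.not_gt (mem_shell.1 h4).2
    have h4 := lintegral_shell_scale (r := 1) (s := R) (c := c * R ^ n) (by positivity)
    rw [mul_one, mul_assoc, ← pow_succ] at h4
    rw [hu, lintegral_union (measurableSet_shell _ _) hd, ih, h4]
    push_cast
    ring

theorem lintegral_shell_ne_top (R : ℝ) : ∫⁻ x in shell 1 R, ‖x‖ₑ ^ (-3 : ℝ) ≠ ∞ := by
  refine ne_top_of_le_ne_top (b := ∫⁻ x in shell 1 R, 1) ?_ ?_
  · rw [setLIntegral_one]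
    refine ne_top_of_le_ne_top (measure_ball_lt_top (x := (0 : Space)) (r := R)).ne
      (measure_mono fun x hx => ?_)
    simpa using hx.2
  · refine setLIntegral_mono' (measurableSet_shell _ _) fun x hx => ?_
    rw [ENNReal.rpow_neg, ENNReal.inv_le_one]
    refine ENNReal.one_le_rpow ?_ (by norm_num)
    rw [← ofReal_norm, ENNReal.one_le_ofReal]
    exact hx.1

/-- A unit vector of `ℝ³`. -/
def unitVec : Space := EuclideanSpace.single 0 1

theorem norm_unitVec : ‖unitVec‖ = 1 := by simp [unitVec]

theorem lintegral_shell_ne_zero {R : ℝ} (hR : 1 < R) :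
    ∫⁻ x in shell 1 R, ‖x‖ₑ ^ (-3 : ℝ) ≠ 0 := by
  rw [← lintegral_indicator (measurableSet_shell _ _), ne_eq, lintegral_eq_zero_iff
    (Measurable.indicator (by fun_prop) (measurableSet_shell _ _))]
  intro h
  have hopen : IsOpen ({x : Space | 1 < ‖x‖} ∩ {x | ‖x‖ < R}) :=
    (isOpen_lt continuous_const continuous_norm).inter (isOpen_lt continuous_norm continuous_const)
  have hne : ({x : Space | 1 < ‖x‖} ∩ {x | ‖x‖ < R}).Nonempty := by
    refine ⟨((1 + R) / 2) • unitVec, ?_⟩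
    simp only [Set.mem_inter_iff, Set.mem_ofPred_eq, norm_smul, norm_unitVec, mul_one]
    rw [Real.norm_of_nonneg (by linarith)]
    constructor <;> linarith
  refine (hopen.measure_pos volume hne).ne' (measure_mono_null (fun x hx => ?_) h)
  simp only [Set.mem_compl_iff, Set.mem_ofPred_eq]
  rw [Set.indicator_of_mem (mem_shell.2 ⟨le_of_lt hx.1, hx.2⟩)]
  simp [ENNReal.rpow_eq_zero_iff]

/-- The part of the convolution integral of `|q|⁻²` with itself at `x` over the shell
`|x| / R ≤ |q| < R |x|`. -/
def convShell (R : ℝ) (x : Space) : ℝ≥0∞ :=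
  ∫⁻ q in shell (‖x‖ / R) (R * ‖x‖), ‖q‖ₑ ^ (-2 : ℝ) * ‖x - q‖ₑ ^ (-2 : ℝ)

theorem convShell_smul (R : ℝ) {c : ℝ} (hc : 0 < c) (x : Space) :
    convShell R (c • x) = ENNReal.ofReal c ^ (-1 : ℝ) * convShell R x := by
  unfold convShell
  rw [← lintegral_indicator (measurableSet_shell _ _), ← lintegral_indicator (measurableSet_shell _ _),
    lintegral_smul_eq _ (Measurable.indicator (by fun_prop) (measurableSet_shell _ _)) hc,
    ← lintegral_const_mul' _ _ (ENNReal.pow_ne_top ENNReal.ofReal_ne_top),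
    ← lintegral_const_mul' _ _ (by simpa [ENNReal.rpow_eq_top_iff] using hc)]
  refine lintegral_congr fun q => ?_
  have hmem : c • q ∈ shell (‖c • x‖ / R) (R * ‖c • x‖) ↔ q ∈ shell (‖x‖ / R) (R * ‖x‖) := by
    simp only [mem_shell, norm_smul, Real.norm_of_nonneg hc.le, mul_left_comm R c, mul_div_assoc]
    rw [mul_le_mul_iff_right₀ hc, mul_lt_mul_iff_right₀ hc]
  by_cases hq : q ∈ shell (‖x‖ / R) (R * ‖x‖)
  · rw [Set.indicator_of_mem hq, Set.indicator_of_mem (hmem.2 hq), ← smul_sub, enorm_smul_pos hc,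
      enorm_smul_pos hc, ENNReal.mul_rpow_of_ne_top ENNReal.ofReal_ne_top enorm_ne_top,
      ENNReal.mul_rpow_of_ne_top ENNReal.ofReal_ne_top enorm_ne_top, mul_mul_mul_comm, ← mul_assoc,
      ← ENNReal.rpow_natCast]
    congr 1
    have hc0 : ENNReal.ofReal c ≠ 0 := by simpa using hc
    rw [← ENNReal.rpow_add _ _ hc0 ENNReal.ofReal_ne_top,
      ← ENNReal.rpow_add _ _ hc0 ENNReal.ofReal_ne_top]
    norm_num
  · rw [Set.indicator_of_notMem hq, Set.indicator_of_notMem (mt hmem.1 hq), mul_zero, mul_zero]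

theorem convShell_isometry (R : ℝ) (U : Space ≃ₗᵢ[ℝ] Space) (x : Space) :
    convShell R (U x) = convShell R x := by
  unfold convShell
  rw [← lintegral_indicator (measurableSet_shell _ _), ← lintegral_indicator (measurableSet_shell _ _),
    ← U.measurePreserving.lintegral_comp
      (Measurable.indicator (by fun_prop) (measurableSet_shell _ _))]
  refine lintegral_congr fun q => ?_
  simp only [Set.indicator, mem_shell, U.norm_map, ← map_sub, U.enorm_map]

/-- Homogeneity of degree -1 together with rotation invariance; the isometry used is the reflection
that exchanges x and ‖x‖ times the unit vector. -/
theorem convShell_eq (R : ℝ) {x : Space} (hx : x ≠ 0) :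
    convShell R x = ‖x‖ₑ ^ (-1 : ℝ) * convShell R unitVec := by
  have hx' : 0 < ‖x‖ := norm_pos_iff.2 hx
  have h1 : ‖‖x‖ • unitVec‖ = ‖x‖ := by
    rw [norm_smul, norm_unitVec, mul_one, norm_norm]
  rw [← ofReal_norm, ← convShell_smul R hx', ← convShell_isometry R _ (‖x‖ • unitVec),
    Submodule.reflection_sub h1]

/-- The shells exhaust the complement of the origin, and the full convolution integral at a unit
vector is π³. The offset 2 keeps the ratio above 1. -/
theorem iSup_convShell : ENNReal.ofReal (Real.pi ^ 3)
    ≤ ⨆ n : ℕ, convShell (n + 2 : ℝ) unitVec := by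
  have h0 : ∫⁻ q : Space, ‖q‖ₑ ^ (-2 : ℝ) * ‖unitVec - q‖ₑ ^ (-2 : ℝ)
      = ENNReal.ofReal (Real.pi ^ 3) := by
    have hne : unitVec ≠ 0 := norm_ne_zero_iff.1 (by rw [norm_unitVec]; exact one_ne_zero)
    have h := lintegral_rpow_mul_rpow one_pos one_pos (by norm_num) hne
    rw [convConst_one_one, ← ofReal_norm, norm_unitVec, ENNReal.ofReal_one, ENNReal.one_rpow,
      mul_one, mul_one] at h
    exact h
  set ν : Measure Space :=
    volume.withDensity fun q => ‖q‖ₑ ^ (-2 : ℝ) * ‖unitVec - q‖ₑ ^ (-2 : ℝ) with hν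
  let s : ℕ → Set Space := fun n => shell (1 / (n + 2 : ℝ)) (n + 2 : ℝ)
  have hs : Monotone s := by
    intro m n hmn x hx
    have hmn' : (m : ℝ) ≤ n := by exact_mod_cast hmn
    have hx := mem_shell.1 hx
    refine mem_shell.2 ⟨le_trans ?_ hx.1, hx.2.trans_le (by linarith)⟩
    gcongr
  have hU : {(0 : Space)}ᶜ ⊆ ⋃ n, s n := by
    intro x hx
    have hx' : 0 < ‖x‖ := norm_pos_iff.2 hx
    obtain ⟨m, hm⟩ := exists_nat_gt (max ‖x‖ ‖x‖⁻¹)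
    refine Set.mem_iUnion.2 ⟨m, mem_shell.2 ⟨?_, ?_⟩⟩
    · rw [one_div]
      refine inv_le_of_inv_le₀ hx' ?_
      have := (le_max_right ‖x‖ ‖x‖⁻¹).trans_lt hm
      linarith
    · have := (le_max_left ‖x‖ ‖x‖⁻¹).trans_lt hm
      linarith
  have h1 : ν Set.univ ≤ ν (⋃ n, s n) := by
    have : ν {(0 : Space)} = 0 := withDensity_absolutelyContinuous _ _ (by simp)
    calc ν Set.univ = ν ({0} ∪ {(0 : Space)}ᶜ) := by rw [Set.union_compl_self]
      _ ≤ ν {(0 : Space)} + ν {(0 : Space)}ᶜ := measure_union_le _ _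
      _ ≤ ν (⋃ n, s n) := by rw [this, zero_add]; exact measure_mono hU
  rw [← h0, ← setLIntegral_univ, ← withDensity_apply _ MeasurableSet.univ]
  refine h1.trans_eq ?_
  rw [hs.measure_iUnion]
  refine iSup_congr fun n => ?_
  rw [hν, withDensity_apply _ (measurableSet_shell _ _), convShell, norm_unitVec, mul_one]

/-- The trial functions in momentum space. -/
def trialSet (M S : ℝ) : Set Config := {ξ | ξ.fst ∈ shell M S} ∩ {ξ | ‖ξ.fst + ξ.snd‖ ≤ 1}

theorem measurableSet_trialSet (M S : ℝ) : MeasurableSet (trialSet M S) :=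
  (measurable_fst (measurableSet_shell M S)).inter
    (measurableSet_le (by fun_prop) measurable_const)

def trial (M S : ℝ) : Config → ℂ :=
  (trialSet M S).indicator fun ξ => ((‖ξ.fst‖ ^ (-2 : ℝ) : ℝ) : ℂ)

theorem volume_trialSet_ne_top (M S : ℝ) : volume (trialSet M S) ≠ ∞ := by
  refine ne_top_of_le_ne_top (measure_closedBall_lt_top (x := (0 : Config)) (r := 2 * |S| + 1)).ne
    (measure_mono fun ξ hξ => ?_)
  have h1 : ‖ξ.fst‖ ≤ |S| := ((mem_shell.1 hξ.1).2.le).trans (le_abs_self S)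
  have h2 : ‖ξ.snd‖ ≤ |S| + 1 := by
    have h3 : ξ.snd = (ξ.fst + ξ.snd) - ξ.fst := by abel
    have h4 : ‖ξ.fst + ξ.snd‖ ≤ 1 := hξ.2
    rw [h3]
    refine (norm_sub_le _ _).trans (by linarith)
  rw [mem_closedBall_zero_iff, WithLp.prod_norm_eq_of_L2]
  refine Real.sqrt_le_iff.2 ⟨by positivity, ?_⟩
  nlinarith [norm_nonneg ξ.fst, norm_nonneg ξ.snd]

theorem memLp_trial {M : ℝ} (hM : 1 ≤ M) (S : ℝ) :
    MemLp (trial M S) 2 (volume : Measure Config) := by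
  have hm := measurableSet_trialSet M S
  unfold trial
  rw [memLp_indicator_iff_restrict hm]
  have : IsFiniteMeasure ((volume : Measure Config).restrict (trialSet M S)) :=
    ⟨by simpa using (volume_trialSet_ne_top M S).lt_top⟩
  refine MemLp.of_bound (Complex.measurable_ofReal.comp
    (measurable_fst.norm.pow_const _)).aestronglyMeasurable 1 ?_
  filter_upwards [ae_restrict_mem hm] with ξ hξ
  have h1 : 1 ≤ ‖ξ.fst‖ := hM.trans (mem_shell.1 hξ.1).1
  rw [Complex.norm_real, Real.norm_of_nonneg (by positivity)]
  exact Real.rpow_le_one_of_one_le_of_nonpos h1 (by norm_num)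

/-- The radial part of the trial functions. -/
def radial (M S : ℝ) : Space → ℝ≥0∞ := (shell M S).indicator fun x => ‖x‖ₑ ^ (-2 : ℝ)

theorem measurable_radial (M S : ℝ) : Measurable (radial M S) :=
  Measurable.indicator (by fun_prop) (measurableSet_shell M S)

theorem enorm_trial {M : ℝ} (hM : 1 ≤ M) (S : ℝ) (ξ : Config) : ‖trial M S ξ‖ₑ
    = radial M S ξ.fst * (Metric.closedBall (0 : Space) 1).indicator 1 (ξ.fst + ξ.snd) := by
  unfold trial radial
  by_cases h1 : ξ.fst ∈ shell M S
  · have h3 : ξ.fst ≠ 0 := norm_ne_zero_iff.1 (by linarith [(mem_shell.1 h1).1])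
    by_cases h2 : ξ.fst + ξ.snd ∈ Metric.closedBall (0 : Space) 1
    · rw [Set.indicator_of_mem h1, Set.indicator_of_mem h2,
        Set.indicator_of_mem (show ξ ∈ trialSet M S from ⟨h1, mem_closedBall_zero_iff.1 h2⟩),
        enorm_complex_ofReal (by positivity), ofReal_norm_rpow h3]
      simp
    · rw [Set.indicator_of_notMem h2, Set.indicator_of_notMem
        (fun h : ξ ∈ trialSet M S => h2 (mem_closedBall_zero_iff.2 h.2))]
      simp
  · rw [Set.indicator_of_notMem h1, Set.indicator_of_notMem
        (fun h : ξ ∈ trialSet M S => h1 h.1)]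
    simp

/-- The `L²` function whose Fourier transform is the trial function. -/
def trialVec {M : ℝ} (hM : 1 ≤ M) (S : ℝ) : Hilb := ft.symm (memLp_trial hM S).toLp

theorem ft_trialVec {M : ℝ} (hM : 1 ≤ M) (S : ℝ) : ft (trialVec hM S) =ᵐ[volume] trial M S := by
  rw [trialVec, LinearIsometryEquiv.apply_symm_apply]
  exact (memLp_trial hM S).coeFn_toLp

theorem trial_eq_norm (M S : ℝ) (ξ : Config) : trial M S ξ = (‖trial M S ξ‖ : ℂ) := by
  unfold trial
  by_cases h : ξ ∈ trialSet M S
  · rw [Set.indicator_of_mem h, Complex.norm_real, Real.norm_of_nonneg (by positivity)]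
  · rw [Set.indicator_of_notMem h]
    simp

theorem indicator_sq (x : Space) : ((Metric.closedBall (0 : Space) 1).indicator 1 x : ℝ≥0∞) *
    (Metric.closedBall (0 : Space) 1).indicator 1 x
      = (Metric.closedBall (0 : Space) 1).indicator 1 x := by
  by_cases h : x ∈ Metric.closedBall (0 : Space) 1
  · rw [Set.indicator_of_mem h]; simp
  · rw [Set.indicator_of_notMem h]; simp

theorem lintegral_trial {G : Space → ℝ≥0∞} (hG : Measurable G) :
    ∫⁻ ξ : Config, G ξ.fst * (Metric.closedBall (0 : Space) 1).indicator 1 (ξ.fst + ξ.snd)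
      = volume (Metric.closedBall (0 : Space) 1) * ∫⁻ x, G x := by
  have hm : Measurable ((Metric.closedBall (0 : Space) 1).indicator (1 : Space → ℝ≥0∞)) :=
    Measurable.indicator measurable_one measurableSet_closedBall
  have h := lintegral_config (G := fun z => G z.1 *
    (Metric.closedBall (0 : Space) 1).indicator 1 (z.1 + z.2)) (by fun_prop)
  rw [h]
  simp only [add_sub_cancel]
  rw [lintegral_congr fun x => lintegral_const_mul _ hm, lintegral_mul_const _ hG,
    lintegral_indicator_one measurableSet_closedBall, mul_comm]

/-- The cutoff depends only on the conserved total momentum, so it factors out as the volume of the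
unit ball and leaves a one-particle form. -/
theorem bil_trial {M : ℝ} (hM : 1 ≤ M) (S : ℝ) :
    bil (fun k => ‖k‖ₑ ^ (-2 : ℝ)) (fun ξ => ‖trial M S ξ‖ₑ) (fun ξ => ‖trial M S ξ‖ₑ)
      = volume (Metric.closedBall (0 : Space) 1) *
        ∫⁻ x, radial M S x * ∫⁻ q, ‖x - q‖ₑ ^ (-2 : ℝ) * radial M S q := by
  have hr := measurable_radial M S
  have h1 (k : Space) : ∫⁻ ξ, ‖trial M S ξ‖ₑ * ‖trial M S (ξ - anti k)‖ₑ
      = volume (Metric.closedBall (0 : Space) 1) * ∫⁻ x, radial M S x * radial M S (x - k) := by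
    rw [← lintegral_trial (by fun_prop)]
    refine lintegral_congr fun ξ => ?_
    rw [enorm_trial hM, enorm_trial hM, sub_anti_fst, sub_anti_snd,
      show ξ.fst - k + (ξ.snd + k) = ξ.fst + ξ.snd by abel, mul_mul_mul_comm, indicator_sq]
  unfold bil
  simp_rw [h1, mul_left_comm (_ ^ (-2 : ℝ))]
  rw [lintegral_const_mul _ (by fun_prop)]
  congr 1
  rw [lintegral_congr fun k => (lintegral_const_mul (‖k‖ₑ ^ (-2 : ℝ))
    (show Measurable fun x => radial M S x * radial M S (x - k) by fun_prop)).symm,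
    lintegral_lintegral_swap (by fun_prop)]
  refine lintegral_congr fun x => ?_
  rw [← lintegral_const_mul _ (by fun_prop), ← lintegral_sub_left_eq_self _ x]
  refine lintegral_congr fun k => ?_
  rw [sub_sub_cancel]
  ring

/-- Of the n + 2 geometric shells, x is kept in the n inner ones, so that the whole range |x|/R ≤
|q| < R|x| stays inside the support. The integrand is then |x|⁻² · |x|⁻¹ times a constant. -/
theorem bil_trial_ge {M R : ℝ} (hM : 1 ≤ M) (hR : 1 < R) (n : ℕ) :
    volume (Metric.closedBall (0 : Space) 1) *
      (n * (∫⁻ x in shell 1 R, ‖x‖ₑ ^ (-3 : ℝ)) * convShell R unitVec)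
      ≤ bil (fun k => ‖k‖ₑ ^ (-2 : ℝ)) (fun ξ => ‖trial M (M * R ^ (n + 2)) ξ‖ₑ)
          (fun ξ => ‖trial M (M * R ^ (n + 2)) ξ‖ₑ) := by
  have hM0 : 0 < M := by linarith
  have hR0 : 0 < R := by linarith
  rw [bil_trial hM, ← lintegral_shell_pow (c := M * R) (by positivity) hR n,
    ← lintegral_mul_const _ (by fun_prop), ← lintegral_indicator (measurableSet_shell _ _)]
  refine mul_le_mul_right (lintegral_mono fun x => ?_) _
  by_cases hx : x ∈ shell (M * R) (M * R * R ^ n)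
  swap
  · rw [Set.indicator_of_notMem hx]
    exact bot_le
  rw [Set.indicator_of_mem hx]
  have hx := mem_shell.1 hx
  have hx0 : 0 < ‖x‖ := lt_of_lt_of_le (by positivity) hx.1
  have hxs : x ∈ shell M (M * R ^ (n + 2)) := by
    refine mem_shell.2 ⟨(le_mul_of_one_le_right hM0.le hR.le).trans hx.1, hx.2.trans_le ?_⟩
    rw [mul_assoc, ← pow_succ']
    gcongr
    · exact hR.le
    · omega
  have h2 : convShell R x ≤ ∫⁻ q, ‖x - q‖ₑ ^ (-2 : ℝ) * radial M (M * R ^ (n + 2)) q := by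
    rw [convShell, ← lintegral_indicator (measurableSet_shell _ _)]
    refine lintegral_mono fun q => ?_
    by_cases hq : q ∈ shell (‖x‖ / R) (R * ‖x‖)
    swap
    · rw [Set.indicator_of_notMem hq]
      exact bot_le
    rw [Set.indicator_of_mem hq]
    have hq := mem_shell.1 hq
    have hqs : q ∈ shell M (M * R ^ (n + 2)) := by
      refine mem_shell.2 ⟨?_, ?_⟩
      · refine le_trans ?_ hq.1
        rw [le_div_iff₀ hR0]
        exact hx.1
      · refine hq.2.trans ?_
        calc R * ‖x‖ < R * (M * R * R ^ n) := by gcongr; exact hx.2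
          _ = M * R ^ (n + 2) := by ring
    rw [radial, Set.indicator_of_mem hqs, mul_comm]
  have hxne : x ≠ 0 := norm_pos_iff.1 hx0
  rw [radial, Set.indicator_of_mem hxs]
  refine le_trans (le_of_eq ?_) (mul_le_mul_right h2 _)
  rw [convShell_eq R hxne, ← mul_assoc, ← ENNReal.rpow_add _ _ (enorm_ne_zero.2 hxne) enorm_ne_top]
  norm_num

theorem bil_congr_ae' {κ : Space → ℝ≥0∞} {g g' : Config → ℝ≥0∞} (h : ∀ᵐ ξ, g ξ = g' ξ) :
    bil κ g g = bil κ g' g' :=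
  le_antisymm
    (bil_mono (.of_forall fun _ => le_rfl) (h.mono fun _ => le_of_eq) (h.mono fun _ => le_of_eq))
    (bil_mono (.of_forall fun _ => le_rfl) (h.mono fun _ => ge_of_eq) (h.mono fun _ => ge_of_eq))

theorem posForm_trialVec {M : ℝ} (hM : 1 ≤ M) (S : ℝ) :
    posForm (fun x => V (x.fst - x.snd)) (trialVec hM S) = ENNReal.ofReal Real.pi⁻¹ *
      bil (fun k => ‖k‖ₑ ^ (-2 : ℝ)) (fun ξ => ‖trial M S ξ‖ₑ) (fun ξ => ‖trial M S ξ‖ₑ) := by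
  have h1 : posForm (fun x => V (x.fst - x.snd)) (trialVec hM S)
      = ∫⁻ x : Config, mix (mixMeasure (powDensity (1 / 2))) (x.fst - x.snd) *
        ‖trialVec hM S x‖ₑ ^ 2 := by
    refine lintegral_congr_ae ?_
    filter_upwards [ae_sub_ne_zero, mix_pow_ae one_pos] with x hx h
    rw [gammaPi_half, ENNReal.ofReal_one, inv_one, one_mul] at h
    rw [← h, V, ← Real.rpow_neg_one, ofReal_norm_rpow hx]
  have h2 : ∀ᵐ ξ, ft (trialVec hM S) ξ = (‖ft (trialVec hM S) ξ‖ : ℂ) := by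
    filter_upwards [ft_trialVec hM S] with ξ h
    rw [h]
    exact trial_eq_norm M S ξ
  have h3 : ∀ᵐ ξ, ‖ft (trialVec hM S) ξ‖ₑ = ‖trial M S ξ‖ₑ := by
    filter_upwards [ft_trialVec hM S] with ξ h
    rw [h]
  have hm : Measurable fun ξ => ‖trial M S ξ‖ₑ := by
    have := measurable_radial M S
    have : Measurable ((Metric.closedBall (0 : Space) 1).indicator (1 : Space → ℝ≥0∞)) :=
      Measurable.indicator measurable_one measurableSet_closedBall
    simp_rw [enorm_trial hM]
    fun_prop
  have h4 := mixKer_pow_ae (a := 1) (by norm_num)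
  rw [show (3 / 2 - 1 / 2 : ℝ) = 1 by norm_num, gammaPi_one,
    show (1 - 3 : ℝ) = -2 by norm_num] at h4
  rw [h1, lintegral_mix_mul_sq_eq (ae_mixMeasure_pos _) _ h2, bil_congr_ae' h3, bil_congr_ae h4,
    bil_const_mul (by fun_prop) hm hm]

/-- On the support |ξ₂| ≤ |ξ₁| + 1 and 1 ≤ |ξ₁|/M, so both factors 1 + p_j² are at most T². The
exponents α/4 and β/4 add up to 1/2, which makes the bound independent of how α + β = 2 is split. -/
theorem symbol_le_of_mem_trialSet {α β M S : ℝ} (hα : 0 < α) (hβ : 0 < β) (h : α + β = 2)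
    (hM : 1 ≤ M) {ξ : Config} (hξ : ξ ∈ trialSet M S) :
    (1 + ‖(2 * Real.pi) • ξ.fst‖ ^ 2) ^ (α / 4) * (1 + ‖(2 * Real.pi) • ξ.snd‖ ^ 2) ^ (β / 4)
      ≤ 2 * Real.pi * (1 + 2 / M) * ‖ξ.fst‖ := by
  have h1 : M ≤ ‖ξ.fst‖ := (mem_shell.1 hξ.1).1
  have hM0 : 0 < M := by linarith
  have h2 : ‖ξ.snd‖ ≤ ‖ξ.fst‖ + 1 := by
    have h3 : ξ.snd = (ξ.fst + ξ.snd) - ξ.fst := by abel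
    have h4 : ‖ξ.fst + ξ.snd‖ ≤ 1 := hξ.2
    rw [h3]
    refine (norm_sub_le _ _).trans (by linarith)
  have hpi : 1 ≤ 2 * Real.pi := by linarith [Real.pi_gt_three]
  set q := ‖ξ.fst‖ with hq
  have hq0 : 0 ≤ q := norm_nonneg _
  set T := 2 * Real.pi * (1 + 2 / M) * q with hT
  have hT0 : 0 ≤ T := by positivity
  have h5 : 1 ≤ q / M := (one_le_div hM0).2 h1
  have hTe : T = 2 * Real.pi * (q + 2 * (q / M)) := by rw [hT]; field_simp
  have hA : 1 + ‖(2 * Real.pi) • ξ.fst‖ ^ 2 ≤ T ^ 2 := by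
    rw [norm_smul, Real.norm_of_nonneg (by positivity), hTe, mul_pow (2 * Real.pi),
      mul_pow (2 * Real.pi), ← hq]
    have : (1 : ℝ) ≤ (2 * Real.pi) ^ 2 := one_le_pow₀ hpi
    have h8 : 1 + q ^ 2 ≤ (q + 2 * (q / M)) ^ 2 := by
      nlinarith [mul_nonneg hq0 (by linarith : (0 : ℝ) ≤ q / M)]
    calc 1 + (2 * Real.pi) ^ 2 * q ^ 2 ≤ (2 * Real.pi) ^ 2 * 1 + (2 * Real.pi) ^ 2 * q ^ 2 := by
          linarith
      _ = (2 * Real.pi) ^ 2 * (1 + q ^ 2) := by ring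
      _ ≤ _ := by gcongr
  have hB : 1 + ‖(2 * Real.pi) • ξ.snd‖ ^ 2 ≤ T ^ 2 := by
    rw [norm_smul, Real.norm_of_nonneg (by positivity), hTe, mul_pow (2 * Real.pi),
      mul_pow (2 * Real.pi)]
    have h6 : (1 : ℝ) ≤ (2 * Real.pi) ^ 2 := one_le_pow₀ hpi
    have h7 : ‖ξ.snd‖ ^ 2 ≤ (q + q / M) ^ 2 := by
      gcongr
      linarith
    have h8 : 1 + (q + q / M) ^ 2 ≤ (q + 2 * (q / M)) ^ 2 := by
      nlinarith [mul_nonneg hq0 (by linarith : (0 : ℝ) ≤ q / M)]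
    calc 1 + (2 * Real.pi) ^ 2 * ‖ξ.snd‖ ^ 2
        ≤ (2 * Real.pi) ^ 2 * 1 + (2 * Real.pi) ^ 2 * (q + q / M) ^ 2 := by
          gcongr
          linarith
      _ = (2 * Real.pi) ^ 2 * (1 + (q + q / M) ^ 2) := by ring
      _ ≤ _ := by gcongr
  have hT1 : 0 < T := by
    rw [hTe]
    positivity
  calc _ ≤ (T ^ 2) ^ (α / 4) * (T ^ 2) ^ (β / 4) := by gcongr
    _ = T := by
      rw [← Real.rpow_add (by positivity), ← Real.rpow_natCast, ← Real.rpow_mul hT0,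
        show ((2 : ℕ) : ℝ) * (α / 4 + β / 4) = 1 by push_cast; linarith, Real.rpow_one]

theorem momentumForm_trialVec_le {α β M S : ℝ} (hα : 0 < α) (hβ : 0 < β) (h : α + β = 2)
    (hM : 1 ≤ M) :
    momentumForm (fun p => (1 + ‖p.fst‖ ^ 2) ^ (α / 4) * (1 + ‖p.snd‖ ^ 2) ^ (β / 4))
      (trialVec hM S) ≤ ENNReal.ofReal (2 * Real.pi * (1 + 2 / M)) *
        (volume (Metric.closedBall (0 : Space) 1) * ∫⁻ x in shell M S, ‖x‖ₑ ^ (-3 : ℝ)) := by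
  have hm : Measurable ((shell M S).indicator fun x : Space => ‖x‖ₑ ^ (-3 : ℝ)) :=
    Measurable.indicator (by fun_prop) (measurableSet_shell M S)
  rw [← lintegral_indicator (measurableSet_shell M S), ← lintegral_trial hm,
    ← lintegral_const_mul' _ _ ENNReal.ofReal_ne_top]
  refine lintegral_mono_ae ?_
  filter_upwards [ft_trialVec hM S] with ξ hξ
  change ENNReal.ofReal ((1 + ‖(2 * Real.pi) • ξ.fst‖ ^ 2) ^ (α / 4) *
    (1 + ‖(2 * Real.pi) • ξ.snd‖ ^ 2) ^ (β / 4)) * ‖ft (trialVec hM S) ξ‖ₑ ^ 2 ≤ _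
  rw [hξ, enorm_trial hM, mul_pow, sq (Set.indicator _ _ _), indicator_sq, ← mul_assoc, ← mul_assoc]
  by_cases h1 : ξ.fst ∈ shell M S
  · by_cases h2 : ξ.fst + ξ.snd ∈ Metric.closedBall (0 : Space) 1
    · refine mul_le_mul_left ?_ _
      have h3 : ξ.fst ≠ 0 := norm_ne_zero_iff.1 (by linarith [(mem_shell.1 h1).1])
      have h4 := symbol_le_of_mem_trialSet (S := S) hα hβ h hM (ξ := ξ)
        ⟨h1, mem_closedBall_zero_iff.1 h2⟩
      rw [radial, Set.indicator_of_mem h1, Set.indicator_of_mem h1]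
      calc _ ≤ ENNReal.ofReal (2 * Real.pi * (1 + 2 / M) * ‖ξ.fst‖) *
            (‖ξ.fst‖ₑ ^ (-2 : ℝ)) ^ 2 := by gcongr
        _ = _ := by
          have hM0 : 0 < M := by linarith
          have := Real.pi_pos
          rw [ENNReal.ofReal_mul (by positivity), ofReal_norm, mul_assoc, ← ENNReal.rpow_natCast,
            ← ENNReal.rpow_mul]
          nth_rewrite 1 [← ENNReal.rpow_one ‖ξ.fst‖ₑ]
          rw [← ENNReal.rpow_add _ _ (enorm_ne_zero.2 h3) enorm_ne_top]
          norm_num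
    · rw [Set.indicator_of_notMem h2, mul_zero, mul_zero]
  · rw [radial, Set.indicator_of_notMem h1, Set.indicator_of_notMem h1]
    simp

/-- Take M = n and n + 2 shells. One factor 1 + 2/n is the error in the symbol, the other is the
ratio (n + 2)/n of shell counts; both tend to 1. -/
theorem convShell_le_of_leSS {α β c R : ℝ} (hα : 0 < α) (hβ : 0 < β) (h : α + β = 2)
    (hc : LeSS (fun x => V (x.fst - x.snd)) c α β) (hR : 1 < R) :
    convShell R unitVec ≤ ENNReal.ofReal (2 * Real.pi ^ 2) * ENNReal.ofReal c := by
  set B := volume (Metric.closedBall (0 : Space) 1) with hB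
  set ℓ := ∫⁻ x in shell 1 R, ‖x‖ₑ ^ (-3 : ℝ) with hℓ
  have hB0 : B ≠ 0 := (Metric.measure_closedBall_pos volume _ one_pos).ne'
  have hBt : B ≠ ∞ := measure_closedBall_lt_top.ne
  have hℓ0 : ℓ ≠ 0 := lintegral_shell_ne_zero hR
  have hℓt : ℓ ≠ ∞ := lintegral_shell_ne_top R
  have hpi := Real.pi_pos
  have key (n : ℕ) (hn : 1 ≤ n) : convShell R unitVec ≤
      ENNReal.ofReal (2 * Real.pi ^ 2) * ENNReal.ofReal c *
        ENNReal.ofReal ((1 + 2 * (n : ℝ)⁻¹) * (1 + 2 * (n : ℝ)⁻¹)) := by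
    have hM : (1 : ℝ) ≤ n := by exact_mod_cast hn
    have hn0 : (0 : ℝ) < n := by linarith
    have h1 := hc (trialVec hM (n * R ^ (n + 2)))
    rw [posForm_trialVec] at h1
    have h2 := (mul_le_mul_right (bil_trial_ge hM hR n) (ENNReal.ofReal Real.pi⁻¹)).trans (h1.trans
      (mul_le_mul_right (momentumForm_trialVec_le hα hβ h hM) (ENNReal.ofReal c)))
    rw [lintegral_shell_pow hn0 hR] at h2
    have h3 : (B * ℓ * ENNReal.ofReal (Real.pi⁻¹ * n)) * convShell R unitVec ≤
        (B * ℓ * ENNReal.ofReal (Real.pi⁻¹ * n)) *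
          (ENNReal.ofReal (2 * Real.pi ^ 2) * ENNReal.ofReal c *
        ENNReal.ofReal ((1 + 2 * (n : ℝ)⁻¹) * (1 + 2 * (n : ℝ)⁻¹))) := by
      have e1 : ENNReal.ofReal (Real.pi⁻¹ * n) = ENNReal.ofReal Real.pi⁻¹ * n := by
        rw [ENNReal.ofReal_mul (by positivity), ENNReal.ofReal_natCast]
      have e2 : ENNReal.ofReal (Real.pi⁻¹ * n) * ENNReal.ofReal (2 * Real.pi ^ 2) *
          ENNReal.ofReal ((1 + 2 * (n : ℝ)⁻¹) * (1 + 2 * (n : ℝ)⁻¹))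
          = ENNReal.ofReal (2 * Real.pi * (1 + 2 / n)) * ((n + 2 : ℕ) : ℝ≥0∞) := by
        rw [← ENNReal.ofReal_mul (by positivity), ← ENNReal.ofReal_mul (by positivity),
          ← ENNReal.ofReal_natCast, ← ENNReal.ofReal_mul (by positivity)]
        congr 1
        push_cast
        field_simp
      calc _ = ENNReal.ofReal Real.pi⁻¹ * (B * (n * ℓ * convShell R unitVec)) := by
            rw [e1]; ring
        _ ≤ _ := h2
        _ = (B * ℓ * ENNReal.ofReal c) *
            (ENNReal.ofReal (2 * Real.pi * (1 + 2 / n)) * ((n + 2 : ℕ) : ℝ≥0∞)) := by ring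
        _ = _ := by rw [← e2]; ring
    refine (ENNReal.mul_le_mul_iff_right ?_ ?_).1 h3
    · exact mul_ne_zero (mul_ne_zero hB0 hℓ0) (by simpa using by positivity)
    · exact ENNReal.mul_ne_top (ENNReal.mul_ne_top hBt hℓt) ENNReal.ofReal_ne_top
  have hlim : Filter.Tendsto (fun n : ℕ => ENNReal.ofReal (2 * Real.pi ^ 2) * ENNReal.ofReal c *
      ENNReal.ofReal ((1 + 2 * (n : ℝ)⁻¹) * (1 + 2 * (n : ℝ)⁻¹))) Filter.atTop
      (nhds (ENNReal.ofReal (2 * Real.pi ^ 2) * ENNReal.ofReal c *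
        ENNReal.ofReal ((1 + 2 * 0) * (1 + 2 * 0)))) := by
    have h1 : Filter.Tendsto (fun n : ℕ => 1 + 2 * (n : ℝ)⁻¹) Filter.atTop (nhds (1 + 2 * 0)) :=
      (tendsto_inv_atTop_nhds_zero_nat.const_mul 2).const_add 1
    exact ENNReal.Tendsto.const_mul (ENNReal.tendsto_ofReal (h1.mul h1))
      (Or.inr (ENNReal.mul_ne_top ENNReal.ofReal_ne_top ENNReal.ofReal_ne_top))
  simp only [mul_zero, add_zero, mul_one, ENNReal.ofReal_one] at hlim
  refine ge_of_tendsto hlim ?_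
  filter_upwards [Filter.eventually_ge_atTop 1] with n hn using key n hn

theorem pi_div_two_le_of_leSS {α β c : ℝ} (hα : 0 < α) (hβ : 0 < β) (h : α + β = 2)
    (hc : LeSS (fun x => V (x.fst - x.snd)) c α β) : Real.pi / 2 ≤ c := by
  have hpi := Real.pi_pos
  have h1 : ENNReal.ofReal (Real.pi ^ 3) ≤ ENNReal.ofReal (2 * Real.pi ^ 2 * c) := by
    rw [ENNReal.ofReal_mul (by positivity)]
    refine iSup_convShell.trans (iSup_le fun n => ?_)
    have hn : (0 : ℝ) ≤ n := n.cast_nonneg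
    exact convShell_le_of_leSS hα hβ h hc (by linarith)
  -- Since `ENNReal.ofReal` truncates, there is a second alternative, π³ ≤ 0, which is absurd.
  rw [ENNReal.ofReal_le_ofReal_iff'] at h1
  rcases h1 with h1 | h1
  · have h2 : Real.pi ^ 2 * (Real.pi / 2) ≤ Real.pi ^ 2 * c := by nlinarith
    exact le_of_mul_le_mul_left h2 (by positivity)
  · exact absurd h1 (by positivity : (0 : ℝ) < Real.pi ^ 3).not_ge

/-! ### Unbounded operators as relations -/

/-- `ψ` is in the domain of `T` and `T ψ = φ`. -/
def Rel (T : Hilb →ₗ.[ℂ] Hilb) (ψ φ : Hilb) : Prop := ∃ h : ψ ∈ T.domain, T ⟨ψ, h⟩ = φ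

theorem rel_opComp {T R : Hilb →ₗ.[ℂ] Hilb} {ψ χ : Hilb} :
    Rel (opComp T R) ψ χ ↔ ∃ φ, Rel R ψ φ ∧ Rel T φ χ := by
  constructor
  · rintro ⟨h, rfl⟩
    obtain ⟨⟨φ, hφ, rfl⟩, h2⟩ := h
    exact ⟨R φ, ⟨φ.2, rfl⟩, hφ, rfl⟩
  · rintro ⟨φ, ⟨h, rfl⟩, h', rfl⟩
    exact ⟨⟨⟨⟨ψ, h⟩, h', rfl⟩, h⟩, rfl⟩

theorem rel_mulOp {m : Config → ℝ} {ψ φ : Hilb} :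
    Rel (mulOp volume m) ψ φ ↔ ∀ᵐ x, φ x = (m x : ℂ) * ψ x := by
  constructor
  · rintro ⟨h, rfl⟩
    exact (mem_mulDomain.1 h).coeFn_toLp
  · intro h
    have hm : MemLp (fun x => (m x : ℂ) * ψ x) 2 volume := (memLp_congr_ae h).1 (Lp.memLp φ)
    refine ⟨hm, Lp.ext ?_⟩
    filter_upwards [hm.coeFn_toLp, h] with x h1 h2
    rw [h2]
    exact h1

theorem rel_momentumOp {m : Config → ℝ} {ψ φ : Hilb} :
    Rel (momentumOp m) ψ φ ↔ ∀ᵐ ξ, ft φ ξ = (m ((2 * Real.pi) • ξ) : ℂ) * ft ψ ξ := by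
  rw [← rel_mulOp (m := fun ξ : Config => m ((2 * Real.pi) • ξ))]
  constructor
  · rintro ⟨h, rfl⟩
    exact ⟨h, (LinearIsometryEquiv.apply_symm_apply _ _).symm⟩
  · rintro ⟨h, h2⟩
    refine ⟨h, ?_⟩
    rw [← LinearIsometryEquiv.symm_apply_apply ft φ, ← h2]
    rfl

theorem normLE_of_rel {T : Hilb →ₗ.[ℂ] Hilb} {C : ℝ} {D : Set Hilb} (hD : Dense D)
    (h1 : ∀ ψ ∈ D, ∃ φ, Rel T ψ φ) (h2 : ∀ ψ φ, Rel T ψ φ → ‖φ‖ ≤ C * ‖ψ‖) : NormLE T C :=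
  ⟨hD.mono fun ψ hψ => (h1 ψ hψ).elim fun _ h => h.1, fun ψ => h2 ψ (T ψ) ⟨ψ.2, rfl⟩⟩

theorem enorm_sq_eq_lintegral (g : Hilb) : ‖g‖ₑ ^ 2 = ∫⁻ x, ‖g x‖ₑ ^ 2 := by
  rw [Lp.enorm_def, eLpNorm_eq_lintegral_rpow_enorm_toReal (by norm_num) (by norm_num),
    ← ENNReal.rpow_natCast, ← ENNReal.rpow_mul]
  norm_num

theorem enorm_eq_lintegral (g : Hilb) : ‖g‖ₑ = (∫⁻ x, ‖g x‖ₑ ^ (2 : ℝ)) ^ (1 / 2 : ℝ) := by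
  simp_rw [ENNReal.rpow_two]
  rw [← enorm_sq_eq_lintegral, ← ENNReal.rpow_natCast, ← ENNReal.rpow_mul]
  norm_num

theorem memLp_iff_lintegral {f : Config → ℂ} (hf : AEStronglyMeasurable f volume) :
    MemLp f 2 volume ↔ ∫⁻ x, ‖f x‖ₑ ^ 2 < ∞ := by
  rw [MemLp, and_iff_right hf,
    eLpNorm_lt_top_iff_lintegral_rpow_enorm_lt_top (by norm_num) (by norm_num)]
  norm_num

theorem memLp_mul_of_bound {m : Config → ℝ} (hm : Measurable m) {C : ℝ} (hC : ∀ᵐ x, |m x| ≤ C)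
    (g : Hilb) : MemLp (fun x => (m x : ℂ) * g x) 2 (volume : Measure Config) := by
  refine MemLp.of_le_mul (c := C) (Lp.memLp g)
    ((Complex.measurable_ofReal.comp hm).aestronglyMeasurable.mul (Lp.aestronglyMeasurable g)) ?_
  filter_upwards [hC] with x hx
  rw [norm_mul, Complex.norm_real]
  gcongr
  exact hx

theorem exists_rel_momentumOp {m : Config → ℝ} (hm : Measurable m) {C : ℝ} (hC : ∀ x, |m x| ≤ C)
    (ψ : Hilb) : ∃ φ, Rel (momentumOp m) ψ φ := by
  have h := memLp_mul_of_bound (m := fun ξ : Config => m ((2 * Real.pi) • ξ)) (by fun_prop)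
    (.of_forall fun x => hC _) (ft ψ)
  refine ⟨ft.symm h.toLp, rel_momentumOp.2 ?_⟩
  rw [LinearIsometryEquiv.apply_symm_apply]
  exact h.coeFn_toLp

/-- A multiplier is bounded on `u` if its weak pairings with `u` are. -/
theorem lintegral_mul_sq_le_of_inner {m : Config → ℝ} (hm : Measurable m) (hm0 : ∀ ξ, 0 ≤ m ξ)
    {C : ℝ≥0∞} (u : Hilb) (h : ∀ g χ : Hilb, (∀ᵐ ξ, χ ξ = (m ξ : ℂ) * g ξ) →
      ‖inner ℂ χ u‖ₑ ≤ C * ‖g‖ₑ) : ∫⁻ ξ, ‖(m ξ : ℂ) * u ξ‖ₑ ^ 2 ≤ C ^ 2 := by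
  -- Truncate to m ≤ n, where m u and m² u are in L². Testing with g = m u and χ = m² u gives ⟨χ, u⟩
  -- = ‖g‖², hence ‖g‖ ≤ C, and n → ∞ by monotone convergence. Membership of u in the domain of m is
  -- a conclusion here.
  let T : ℕ → Set Config := fun n => {ξ | m ξ ≤ n}
  have hT (n : ℕ) : MeasurableSet (T n) := measurableSet_le hm measurable_const
  have step (n : ℕ) : ∫⁻ ξ in T n, ‖(m ξ : ℂ) * u ξ‖ₑ ^ 2 ≤ C ^ 2 := by
    let m₁ : Config → ℝ := (T n).indicator m
    have hm₁ : Measurable m₁ := hm.indicator (hT n)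
    have hb : ∀ ξ, |m₁ ξ| ≤ n := by
      intro ξ
      by_cases hξ : ξ ∈ T n
      · rw [show m₁ ξ = m ξ from Set.indicator_of_mem hξ m, abs_of_nonneg (hm0 ξ)]
        exact hξ
      · rw [show m₁ ξ = 0 from Set.indicator_of_notMem hξ m, abs_zero]
        exact n.cast_nonneg
    let g : Hilb := (memLp_mul_of_bound hm₁ (.of_forall hb) u).toLp
    have hg : ∀ᵐ ξ, g ξ = (m₁ ξ : ℂ) * u ξ := MemLp.coeFn_toLp _
    let χ : Hilb := (memLp_mul_of_bound hm₁ (.of_forall hb) g).toLp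
    have hχ : ∀ᵐ ξ, χ ξ = (m₁ ξ : ℂ) * g ξ := MemLp.coeFn_toLp _
    have hχ' : ∀ᵐ ξ, χ ξ = (m ξ : ℂ) * g ξ := by
      filter_upwards [hχ, hg] with ξ h1 h2
      by_cases hξ : ξ ∈ T n
      · rw [h1, show m₁ ξ = m ξ from Set.indicator_of_mem hξ m]
      · rw [h1, h2, show m₁ ξ = 0 from Set.indicator_of_notMem hξ m]
        simp
    have h1 := h g χ hχ'
    have h2 : inner ℂ χ u = inner ℂ g g := by
      rw [L2.inner_def, L2.inner_def]
      refine integral_congr_ae ?_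
      filter_upwards [hχ, hg] with ξ e1 e2
      simp only [RCLike.inner_apply]
      rw [e1, e2]
      simp only [map_mul, Complex.conj_ofReal]
      ring
    have h3 : ‖g‖ₑ ≤ C := by
      rw [h2, inner_self_eq_norm_sq_to_K] at h1
      have e : ‖((‖g‖ : ℝ) : ℂ) ^ 2‖ₑ = ‖g‖ₑ * ‖g‖ₑ := by
        rw [enorm_pow, enorm_complex_ofReal (norm_nonneg g), ofReal_norm, sq]
      have h1' : ‖g‖ₑ * ‖g‖ₑ ≤ C * ‖g‖ₑ := e ▸ h1
      rcases eq_or_ne ‖g‖ₑ 0 with h0 | h0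
      · rw [h0]
        exact bot_le
      · exact (ENNReal.mul_le_mul_iff_left h0 enorm_ne_top).1 h1'
    calc ∫⁻ ξ in T n, ‖(m ξ : ℂ) * u ξ‖ₑ ^ 2 ≤ ∫⁻ ξ, ‖g ξ‖ₑ ^ 2 := by
          rw [← lintegral_indicator (hT n)]
          refine lintegral_mono_ae ?_
          filter_upwards [hg] with ξ h4
          by_cases hξ : ξ ∈ T n
          · rw [Set.indicator_of_mem hξ, h4, show m₁ ξ = m ξ from Set.indicator_of_mem hξ m]
          · rw [Set.indicator_of_notMem hξ]
            exact bot_le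
      _ = ‖g‖ₑ ^ 2 := (enorm_sq_eq_lintegral g).symm
      _ ≤ C ^ 2 := by gcongr
  have hmono : Monotone T := fun a b hab ξ hξ =>
    le_trans (show m ξ ≤ a from hξ) (by exact_mod_cast hab)
  have hU : ⋃ n, T n = Set.univ := by
    refine Set.eq_univ_of_forall fun ξ => ?_
    obtain ⟨n, hn⟩ := exists_nat_ge (m ξ)
    exact Set.mem_iUnion.2 ⟨n, hn⟩
  rw [← setLIntegral_univ, ← withDensity_apply _ MeasurableSet.univ, ← hU, hmono.measure_iUnion]
  refine iSup_le fun n => ?_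
  rw [withDensity_apply _ (hT n)]
  exact step n

/-- The integrability required by `enorm_integral_mix_le` is automatic, because W φ = u is assumed
to lie in L². -/
theorem enorm_inner_mul_le {μ : Measure ℝ} [SFinite μ] (hμ : ∀ᵐ u ∂μ, 0 < u) {W : Config → ℝ}
    (hW : ∀ᵐ x : Config, 0 ≤ W x ∧ ENNReal.ofReal (W x) = mix μ (x.fst - x.snd)) {φ u : Hilb}
    (hu : ∀ᵐ x, u x = (W x : ℂ) * φ x) (χ : Hilb) :
    ‖inner ℂ (ft χ) (ft u)‖ₑ ≤ bil (mixKer μ) (fun ξ => ‖ft χ ξ‖ₑ) (fun ξ => ‖ft φ ξ‖ₑ) := by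
  have h1 : ∫⁻ x : Config, mix μ (x.fst - x.snd) * (‖χ x‖ₑ * ‖φ x‖ₑ)
      = ∫⁻ x : Config, ‖inner ℂ (χ x) (u x)‖ₑ := by
    refine lintegral_congr_ae ?_
    filter_upwards [hW, hu] with x h2 h3
    rw [enorm_inner_complex, h3, enorm_mul, enorm_complex_ofReal h2.1, h2.2]
    ring
  rw [LinearIsometryEquiv.inner_map_map, L2.inner_def]
  refine le_trans (le_of_eq ?_) (enorm_integral_mix_le hμ χ φ ?_)
  · congr 1
    refine integral_congr_ae ?_
    filter_upwards [hW, hu] with x h2 h3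
    rw [← h2.2, ENNReal.toReal_ofReal h2.1]
    rw [h3, ← smul_eq_mul (W x : ℂ), inner_smul_right]
  · rw [h1]
    exact (integrable_inner χ u).2.ne

/-! ### The symbols of the operators `S₁ ^ s` and `S₂ ^ s` -/

/-- The symbol `(1 + p²)^(s/4)` at `p = 2πv`. -/
def symb (s : ℝ) (v : Space) : ℝ := (1 + ‖(2 * Real.pi) • v‖ ^ 2) ^ (s / 4)

@[fun_prop]
theorem measurable_symb (s : ℝ) : Measurable (symb s) := by
  unfold symb
  fun_prop

theorem symb_pos (s : ℝ) (v : Space) : 0 < symb s v := by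
  unfold symb
  positivity

theorem symb_mul (s t : ℝ) (v : Space) : symb s v * symb t v = symb (s + t) v := by
  unfold symb
  rw [← Real.rpow_add (by positivity), add_div]

theorem symb_zero (v : Space) : symb 0 v = 1 := by
  unfold symb
  rw [zero_div, Real.rpow_zero]

/-- The symbol with values in `[0, ∞]`. -/
def esymb (s : ℝ) (v : Space) : ℝ≥0∞ := ENNReal.ofReal (symb s v)

@[fun_prop]
theorem measurable_esymb (s : ℝ) : Measurable (esymb s) := by
  unfold esymb
  fun_prop

theorem esymb_mul (s t : ℝ) (v : Space) : esymb s v * esymb t v = esymb (s + t) v := by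
  rw [esymb, esymb, ← ENNReal.ofReal_mul (symb_pos s v).le, symb_mul, esymb]

theorem esymb_zero (v : Space) : esymb 0 v = 1 := by
  rw [esymb, symb_zero, ENNReal.ofReal_one]

theorem enorm_symb (s : ℝ) (v : Space) : ‖(symb s v : ℂ)‖ₑ = esymb s v :=
  enorm_complex_ofReal (symb_pos s v).le

/-- Each inverse power S_j^(-s) can absorb any weight |ξ_j|^a with 0 ≤ a ≤ s in the Schur test. -/
theorem esymb_sq_mul_le {s a : ℝ} (ha : 0 ≤ a) (has : a ≤ s) (v : Space) :
    esymb (-s) v ^ 2 * ‖v‖ₑ ^ a ≤ 1 := by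
  have h1 : ‖v‖ ^ a ≤ symb (2 * s) v := by
    have h2 : ‖v‖ ^ a = (‖v‖ ^ 2) ^ (a / 2) := by
      rw [← Real.rpow_natCast, ← Real.rpow_mul (norm_nonneg v)]
      push_cast
      ring_nf
    have h3 : ‖v‖ ^ 2 ≤ 1 + ‖(2 * Real.pi) • v‖ ^ 2 := by
      have hpi : (1 : ℝ) ≤ 2 * Real.pi := by linarith [Real.pi_gt_three]
      rw [norm_smul, Real.norm_of_nonneg (by linarith), mul_pow]
      have : (1 : ℝ) ≤ (2 * Real.pi) ^ 2 := one_le_pow₀ hpi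
      nlinarith [sq_nonneg ‖v‖]
    rw [h2, symb]
    calc (‖v‖ ^ 2) ^ (a / 2) ≤ (1 + ‖(2 * Real.pi) • v‖ ^ 2) ^ (a / 2) := by gcongr
      _ ≤ _ := Real.rpow_le_rpow_of_exponent_le (le_add_of_nonneg_right (by positivity))
        (by linarith)
  calc esymb (-s) v ^ 2 * ‖v‖ₑ ^ a ≤ esymb (-s) v ^ 2 * esymb (2 * s) v := by
        rw [enorm_rpow_of_nonneg v ha]
        exact mul_le_mul_right (ENNReal.ofReal_le_ofReal h1) _
    _ = 1 := by
        rw [sq, esymb_mul, esymb_mul, show -s + -s + 2 * s = 0 by ring, esymb_zero]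

theorem symb_one_eq (v : Space) : symb 1 v = √√(1 + ‖(2 * Real.pi) • v‖ ^ 2) := by
  rw [symb, Real.sqrt_eq_rpow, Real.sqrt_eq_rpow, ← Real.rpow_mul (by positivity)]
  norm_num

/-- The function √(1 + |p|²) is 1-Lipschitz and the square root is subadditive. -/
theorem symb_one_le (v w : Space) : symb 1 v ≤ symb 1 w + √(2 * Real.pi) * √‖v - w‖ := by
  have hpi := Real.pi_pos
  rw [symb_one_eq, symb_one_eq, ← Real.sqrt_mul (by positivity)]
  set A := √(1 + ‖(2 * Real.pi) • w‖ ^ 2) with hA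
  have hA0 : 0 ≤ A := Real.sqrt_nonneg _
  have hA2 : A ^ 2 = 1 + ‖(2 * Real.pi) • w‖ ^ 2 := Real.sq_sqrt (by positivity)
  have hwA : ‖(2 * Real.pi) • w‖ ≤ A := Real.le_sqrt_of_sq_le (by linarith)
  set K := 2 * Real.pi * ‖v - w‖ with hK
  have hK0 : 0 ≤ K := by positivity
  have h1 : ‖(2 * Real.pi) • v‖ ≤ ‖(2 * Real.pi) • w‖ + K := by
    have e : (2 * Real.pi) • v = (2 * Real.pi) • w + (2 * Real.pi) • (v - w) := by
      rw [← smul_add, add_sub_cancel]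
    rw [e]
    refine (norm_add_le _ _).trans_eq ?_
    rw [norm_smul _ (v - w), Real.norm_of_nonneg (by positivity)]
  have h2 : √(1 + ‖(2 * Real.pi) • v‖ ^ 2) ≤ A + K := by
    refine Real.sqrt_le_iff.2 ⟨by positivity, ?_⟩
    nlinarith [norm_nonneg ((2 * Real.pi) • v), norm_nonneg ((2 * Real.pi) • w),
      mul_le_mul_of_nonneg_right hwA hK0]
  refine (Real.sqrt_le_sqrt h2).trans (Real.sqrt_le_iff.2 ⟨by positivity, ?_⟩)
  rw [add_sq, Real.sq_sqrt hA0, Real.sq_sqrt hK0]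
  nlinarith [mul_nonneg (Real.sqrt_nonneg A) (Real.sqrt_nonneg K)]

theorem esymb_one_le (v w : Space) :
    esymb 1 v ≤ esymb 1 w + ENNReal.ofReal √(2 * Real.pi) * ‖v - w‖ₑ ^ (1 / 2 : ℝ) := by
  rw [enorm_rpow_of_nonneg _ (by norm_num), ← Real.sqrt_eq_rpow,
    ← ENNReal.ofReal_mul (Real.sqrt_nonneg _), esymb, esymb,
    ← ENNReal.ofReal_add (symb_pos 1 w).le (by positivity)]
  exact ENNReal.ofReal_le_ofReal (symb_one_le v w)

theorem rel_S₁ {s : ℝ} {ψ φ : Hilb} :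
    Rel (S₁ s) ψ φ ↔ ∀ᵐ ξ, ft φ ξ = (symb s ξ.fst : ℂ) * ft ψ ξ := rel_momentumOp

theorem rel_S₂ {s : ℝ} {ψ φ : Hilb} :
    Rel (S₂ s) ψ φ ↔ ∀ᵐ ξ, ft φ ξ = (symb s ξ.snd : ℂ) * ft ψ ξ := rel_momentumOp

theorem abs_symbol_le_one {s : ℝ} (hs : s ≤ 0) (v : Space) : |(1 + ‖v‖ ^ 2) ^ (s / 4)| ≤ 1 := by
  rw [abs_of_nonneg (by positivity)]
  exact Real.rpow_le_one_of_one_le_of_nonpos (le_add_of_nonneg_right (by positivity)) (by linarith)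

theorem exists_rel_S₁ {s : ℝ} (hs : s ≤ 0) (ψ : Hilb) : ∃ φ, Rel (S₁ s) ψ φ :=
  exists_rel_momentumOp (by fun_prop) (fun p => abs_symbol_le_one hs p.fst) ψ

theorem exists_rel_S₂ {s : ℝ} (hs : s ≤ 0) (ψ : Hilb) : ∃ φ, Rel (S₂ s) ψ φ :=
  exists_rel_momentumOp (by fun_prop) (fun p => abs_symbol_le_one hs p.snd) ψ

/-- If ψ is orthogonal to the domain, then ⟨S₂⁻¹ψ, ψ⟩ = 0 because S₂⁻¹ψ belongs to the domain. The
symbol of S₂⁻¹ is strictly positive, so ψ = 0. -/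
theorem dense_S₂_domain : Dense ((S₂ 1).domain : Set Hilb) := by
  rw [Submodule.dense_iff_topologicalClosure_eq_top, Submodule.topologicalClosure_eq_top_iff,
    Submodule.eq_bot_iff]
  intro ψ hψ
  obtain ⟨φ, hφ⟩ := exists_rel_S₂ (s := -1) (by norm_num) ψ
  have h1 := rel_S₂.1 hφ
  have h2 : Rel (S₂ 1) φ ψ := by
    refine rel_S₂.2 ?_
    filter_upwards [h1] with ξ h
    rw [h, ← mul_assoc, ← Complex.ofReal_mul, symb_mul, add_neg_cancel, symb_zero]
    simp
  obtain ⟨hφD, -⟩ := h2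
  have h3 : inner ℂ (ft φ) (ft ψ) = 0 := by
    rw [LinearIsometryEquiv.inner_map_map]
    exact Submodule.inner_right_of_mem_orthogonal hφD hψ
  have h4 : ∀ᵐ ξ, inner ℂ (ft φ ξ) (ft ψ ξ) = ((symb (-1) ξ.snd * ‖ft ψ ξ‖ ^ 2 : ℝ) : ℂ) := by
    filter_upwards [h1] with ξ h
    rw [h, ← smul_eq_mul (symb (-1) ξ.snd : ℂ), inner_smul_left, inner_self_eq_norm_sq_to_K,
      Complex.conj_ofReal]
    push_cast
    rfl
  have h5 : ∫⁻ ξ, ‖inner ℂ (ft φ ξ) (ft ψ ξ)‖ₑ = 0 := by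
    rw [← enorm_integral_eq (integrable_inner _ _), ← L2.inner_def, h3, enorm_zero]
    filter_upwards [h4] with ξ h
    have := symb_pos (-1) ξ.snd
    rw [h, Complex.norm_real, Real.norm_of_nonneg (by positivity)]
  rw [lintegral_eq_zero_iff' (integrable_inner _ _).aestronglyMeasurable.enorm] at h5
  have h6 : ft ψ = 0 := by
    refine Lp.ext ?_
    filter_upwards [h4, h5, Lp.coeFn_zero ℂ 2 (volume : Measure Config)] with ξ e1 e2 e3
    have := symb_pos (-1) ξ.snd
    rw [e3]
    rw [e1] at e2
    simpa [this.ne'] using e2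
  simpa using h6

/-! ### Weighted estimates for the bilinear form -/

theorem sqrt_weight_le (K : ℝ≥0∞) {w : Config → ℝ≥0∞} {a c : ℝ}
    (h : ∀ ξ, w ξ ^ 2 * wt a c ξ ≤ 1) (g : Hilb) :
    (K * ∫⁻ ξ, (w ξ * ‖g ξ‖ₑ) ^ (2 : ℝ) * wt a c ξ) ^ (1 / 2 : ℝ) ≤ K ^ (1 / 2 : ℝ) * ‖g‖ₑ := by
  rw [ENNReal.mul_rpow_of_nonneg _ _ (by norm_num), enorm_eq_lintegral]
  gcongr with ξ
  rw [ENNReal.rpow_two, ENNReal.rpow_two, mul_pow]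
  calc w ξ ^ 2 * ‖g ξ‖ₑ ^ 2 * wt a c ξ = (w ξ ^ 2 * wt a c ξ) * ‖g ξ‖ₑ ^ 2 := by ring
    _ ≤ 1 * ‖g ξ‖ₑ ^ 2 := by gcongr; exact h ξ
    _ = _ := one_mul _

theorem bil_weighted_le {b Z W θ θ' : ℝ} (hb : b < 3) (hZ : b < Z) (hZ0 : 0 < Z) (hW : b < W)
    (hW0 : 0 < W) (hθ : 0 ≤ θ) (hθ1 : θ ≤ 1) (hθ' : 0 ≤ θ') (hθ1' : θ' ≤ 1)
    {g₁ g₂ f₁ f₂ : ℝ} (eg₁ : g₁ = θ' * W - θ * (Z - b))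
    (eg₂ : g₂ = (1 - θ') * W - (1 - θ) * (Z - b)) (ef₁ : f₁ = θ * Z - θ' * (W - b))
    (ef₂ : f₂ = (1 - θ) * Z - (1 - θ') * (W - b)) {v w : Config → ℝ≥0∞}
    (hv : Measurable v) (hw : Measurable w) (hv1 : ∀ ξ, v ξ ^ 2 * wt g₁ g₂ ξ ≤ 1)
    (hw1 : ∀ ξ, w ξ ^ 2 * wt f₁ f₂ ξ ≤ 1) (g f : Hilb) :
    bil (fun k => ‖k‖ₑ ^ (b - 3)) (fun ξ => v ξ * ‖g ξ‖ₑ) (fun ξ => w ξ * ‖f ξ‖ₑ) ≤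
      convConst ((3 - b) / 2) (Z / 2) ^ (1 / 2 : ℝ) * convConst ((3 - b) / 2) (W / 2) ^ (1 / 2 : ℝ) *
        (‖g‖ₑ * ‖f‖ₑ) := by
  refine (bil_rpow_le hb hZ hZ0 hW hW0 hθ hθ1 hθ' hθ1' eg₁ eg₂ ef₁ ef₂ (by fun_prop)
    (by fun_prop)).trans ((mul_le_mul' (sqrt_weight_le _ hv1 g) (sqrt_weight_le _ hw1 f)).trans_eq ?_)
  ring

/-- The weight P moves from the first function to the shifted one; the price is a second form whose
kernel carries the modulus of continuity D. -/
theorem bil_split {κ D : Space → ℝ≥0∞} (hκ : Measurable κ)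
    {P G F : Config → ℝ≥0∞} (hP : Measurable P) (hG : Measurable G) (hF : Measurable F)
    (h : ∀ ξ k, P ξ ≤ P (ξ - anti k) + D k) :
    bil κ (fun ξ => P ξ * G ξ) F ≤ bil κ G (fun ξ => P ξ * F ξ) + bil (fun k => D k * κ k) G F := by
  unfold bil
  rw [← lintegral_add_left (by fun_prop)]
  refine lintegral_mono fun k => ?_
  change κ k * ∫⁻ ξ, P ξ * G ξ * F (ξ - anti k) ≤
    κ k * (∫⁻ ξ, G ξ * (P (ξ - anti k) * F (ξ - anti k))) + D k * κ k * ∫⁻ ξ, G ξ * F (ξ - anti k)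
  rw [mul_comm (D k), mul_assoc, ← mul_add, ← lintegral_const_mul (D k) (by fun_prop),
    ← lintegral_add_left (by fun_prop)]
  gcongr with ξ
  calc P ξ * G ξ * F (ξ - anti k) ≤ (P (ξ - anti k) + D k) * G ξ * F (ξ - anti k) := by
        gcongr
        exact h ξ k
    _ = _ := by ring

theorem bil_split' {κ D : Space → ℝ≥0∞} (hκ : Measurable κ)
    {P G F : Config → ℝ≥0∞} (hP : Measurable P) (hG : Measurable G) (hF : Measurable F)
    (h : ∀ ξ k, P (ξ - anti k) ≤ P ξ + D k) :
    bil κ G (fun ξ => P ξ * F ξ) ≤ bil κ (fun ξ => P ξ * G ξ) F + bil (fun k => D k * κ k) G F := by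
  unfold bil
  rw [← lintegral_add_left (by fun_prop)]
  refine lintegral_mono fun k => ?_
  change κ k * ∫⁻ ξ, G ξ * (P (ξ - anti k) * F (ξ - anti k)) ≤
    κ k * (∫⁻ ξ, P ξ * G ξ * F (ξ - anti k)) + D k * κ k * ∫⁻ ξ, G ξ * F (ξ - anti k)
  rw [mul_comm (D k), mul_assoc, ← mul_add, ← lintegral_const_mul (D k) (by fun_prop),
    ← lintegral_add_left (by fun_prop)]
  gcongr with ξ
  calc G ξ * (P (ξ - anti k) * F (ξ - anti k)) ≤ G ξ * ((P ξ + D k) * F (ξ - anti k)) := by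
        gcongr
        exact h ξ k
    _ = _ := by ring

/-- The kernel error in commuting `S_j` past a shift by `±k`. -/
def shiftErr (k : Space) : ℝ≥0∞ := ENNReal.ofReal √(2 * Real.pi) * ‖k‖ₑ ^ (1 / 2 : ℝ)

theorem esymb_fst_le (ξ : Config) (k : Space) :
    esymb 1 ξ.fst ≤ esymb 1 (ξ - anti k).fst + shiftErr k := by
  have h := esymb_one_le ξ.fst (ξ - anti k).fst
  rwa [sub_anti_fst, sub_sub_cancel] at h

theorem esymb_snd_le (ξ : Config) (k : Space) :
    esymb 1 (ξ - anti k).snd ≤ esymb 1 ξ.snd + shiftErr k := by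
  have h := esymb_one_le (ξ - anti k).snd ξ.snd
  rw [sub_anti_snd] at h ⊢
  rwa [add_sub_cancel_left] at h

/-- The bound of the Coulomb kernel by `π⁻¹ |k|⁻²`. -/
def CoulombKernel (κ : Space → ℝ≥0∞) : Prop :=
  ∀ᵐ k, κ k ≤ ENNReal.ofReal Real.pi⁻¹ * ‖k‖ₑ ^ (-2 : ℝ)

/-- The constant in the estimate of `S₁ S₂⁻¹ V S₁⁻¹ S₂⁻¹`. -/
def constA : ℝ≥0∞ :=
  ENNReal.ofReal Real.pi⁻¹ * (convConst 1 1 ^ (1 / 2 : ℝ) * convConst 1 1 ^ (1 / 2 : ℝ)) +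
  ENNReal.ofReal √(2 * Real.pi) * ENNReal.ofReal Real.pi⁻¹ *
    (convConst (3 / 4) (5 / 4) ^ (1 / 2 : ℝ) * convConst (3 / 4) 1 ^ (1 / 2 : ℝ))

theorem sqrt_lt_top {x : ℝ≥0∞} (hx : x < ∞) : x ^ (1 / 2 : ℝ) < ∞ :=
  ENNReal.rpow_lt_top_of_nonneg (by norm_num) hx.ne

theorem constA_lt_top : constA < ∞ := by
  refine ENNReal.add_lt_top.2 ⟨?_, ?_⟩
  · refine ENNReal.mul_lt_top ENNReal.ofReal_lt_top (ENNReal.mul_lt_top ?_ ?_) <;>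
    exact sqrt_lt_top (convConst_lt_top (by norm_num) (by norm_num) (by norm_num) (by norm_num))
  · refine ENNReal.mul_lt_top (ENNReal.mul_lt_top ENNReal.ofReal_lt_top ENNReal.ofReal_lt_top)
      (ENNReal.mul_lt_top ?_ ?_) <;>
    exact sqrt_lt_top (convConst_lt_top (by norm_num) (by norm_num) (by norm_num) (by norm_num))

theorem enorm_rpow_add {k : Space} (hk : k ≠ 0) (a b : ℝ) : ‖k‖ₑ ^ a * ‖k‖ₑ ^ b = ‖k‖ₑ ^ (a + b) :=
  (ENNReal.rpow_add _ _ (enorm_ne_zero.2 hk) enorm_ne_top).symm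

theorem esymb_neg_one_mul_wt_le (ξ : Config) :
    (esymb (-1) ξ.fst * esymb (-1) ξ.snd) ^ 2 * wt 1 1 ξ ≤ 1 := by
  calc _ = (esymb (-1) ξ.fst ^ 2 * ‖ξ.fst‖ₑ ^ (1 : ℝ)) *
        (esymb (-1) ξ.snd ^ 2 * ‖ξ.snd‖ₑ ^ (1 : ℝ)) := by rw [wt]; ring
    _ ≤ 1 * 1 := mul_le_mul' (esymb_sq_mul_le (by norm_num) (by norm_num) ξ.fst)
        (esymb_sq_mul_le (by norm_num) (by norm_num) ξ.snd)
    _ = 1 := one_mul 1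

/-- In the main term S₁ cancels S₁⁻¹ and only S₂⁻¹ remains on either side. The error term has kernel
|k|^(-3/2) and keeps S₂⁻¹ on the left and S₁⁻¹S₂⁻¹ on the right. -/
theorem bil_sandwichA_le {κ : Space → ℝ≥0∞} (hκm : Measurable κ) (hκ : CoulombKernel κ)
    (g f : Hilb) :
    bil κ (fun ξ => esymb 1 ξ.fst * (esymb (-1) ξ.snd * ‖g ξ‖ₑ))
      (fun ξ => esymb (-1) ξ.fst * (esymb (-1) ξ.snd * ‖f ξ‖ₑ)) ≤ constA * (‖g‖ₑ * ‖f‖ₑ) := by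
  refine (bil_split hκm (by fun_prop) (by fun_prop) (by fun_prop)
    esymb_fst_le).trans ?_
  rw [constA, add_mul]
  refine add_le_add ?_ ?_
  · have h1 : bil κ (fun ξ => esymb (-1) ξ.snd * ‖g ξ‖ₑ)
        (fun ξ => esymb 1 ξ.fst * (esymb (-1) ξ.fst * (esymb (-1) ξ.snd * ‖f ξ‖ₑ)))
        ≤ bil (fun k => ENNReal.ofReal Real.pi⁻¹ * ‖k‖ₑ ^ (-2 : ℝ))
          (fun ξ => esymb (-1) ξ.snd * ‖g ξ‖ₑ) (fun ξ => esymb (-1) ξ.snd * ‖f ξ‖ₑ) := by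
      refine bil_mono hκ (.of_forall fun _ => le_rfl) (.of_forall fun ξ => ?_)
      rw [← mul_assoc, esymb_mul, add_neg_cancel, esymb_zero, one_mul]
    refine h1.trans ?_
    rw [bil_const_mul (by fun_prop) (by fun_prop) (by fun_prop), mul_assoc]
    gcongr
    have hw : ∀ ξ : Config, esymb (-1) ξ.snd ^ 2 * wt 0 1 ξ ≤ 1 := fun ξ => by
      rw [wt, ENNReal.rpow_zero, one_mul]
      exact esymb_sq_mul_le (by norm_num) (by norm_num) ξ.snd
    -- With θ = θ' = 0 only ξ₂ carries weight, one power on each side.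
    have h := bil_weighted_le (b := 1) (Z := 2) (W := 2) (θ := 0) (θ' := 0) (g₁ := 0) (g₂ := 1)
      (f₁ := 0) (f₂ := 1) (by norm_num) (by norm_num) (by norm_num) (by norm_num) (by norm_num)
      (by norm_num) (by norm_num) (by norm_num) (by norm_num) (by norm_num) (by norm_num)
      (by norm_num) (by norm_num) (by fun_prop) (by fun_prop) hw hw g f
    norm_num at h ⊢
    exact h
  · have h1 : bil (fun k => shiftErr k * κ k) (fun ξ => esymb (-1) ξ.snd * ‖g ξ‖ₑ)
        (fun ξ => esymb (-1) ξ.fst * (esymb (-1) ξ.snd * ‖f ξ‖ₑ))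
        ≤ bil (fun k => ENNReal.ofReal √(2 * Real.pi) * ENNReal.ofReal Real.pi⁻¹ *
            ‖k‖ₑ ^ (3 / 2 - 3 : ℝ))
          (fun ξ => esymb (-1) ξ.snd * ‖g ξ‖ₑ)
          (fun ξ => (esymb (-1) ξ.fst * esymb (-1) ξ.snd) * ‖f ξ‖ₑ) := by
      refine bil_mono ?_ (.of_forall fun _ => le_rfl) (.of_forall fun ξ => (mul_assoc _ _ _).ge)
      filter_upwards [hκ, ae_ne 0] with k hk hk0
      calc shiftErr k * κ k ≤ shiftErr k * (ENNReal.ofReal Real.pi⁻¹ * ‖k‖ₑ ^ (-2 : ℝ)) := by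
            gcongr
        _ = ENNReal.ofReal √(2 * Real.pi) * ENNReal.ofReal Real.pi⁻¹ *
            (‖k‖ₑ ^ (1 / 2 : ℝ) * ‖k‖ₑ ^ (-2 : ℝ)) := by rw [shiftErr]; ring
        _ = _ := by rw [enorm_rpow_add hk0]; norm_num
    refine h1.trans ?_
    rw [bil_const_mul (by fun_prop) (by fun_prop) (by fun_prop)]
    have hv : ∀ ξ : Config, esymb (-1) ξ.snd ^ 2 * wt 0 1 ξ ≤ 1 := fun ξ => by
      rw [wt, ENNReal.rpow_zero, one_mul]
      exact esymb_sq_mul_le (by norm_num) (by norm_num) ξ.snd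
    -- The exponents wanted are (0, 1) for g and (1, 1) for f. They force Z - W = 1/2; with W = 2
    -- the linear equations give θ = 4/9 and θ' = 2/9.
    have h := bil_weighted_le (b := 3 / 2) (Z := 5 / 2) (W := 2) (θ := 4 / 9) (θ' := 2 / 9)
      (g₁ := 0) (g₂ := 1) (f₁ := 1) (f₂ := 1) (by norm_num) (by norm_num) (by norm_num)
      (by norm_num) (by norm_num) (by norm_num) (by norm_num) (by norm_num) (by norm_num)
      (by norm_num) (by norm_num) (by norm_num) (by norm_num) (by fun_prop) (by fun_prop) hv
      esymb_neg_one_mul_wt_le g f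
    rw [show ((3 - 3 / 2) / 2 : ℝ) = 3 / 4 by norm_num, show (5 / 2 / 2 : ℝ) = 5 / 4 by norm_num,
      show (2 / 2 : ℝ) = 1 by norm_num] at h
    refine (mul_le_mul_right h _).trans_eq ?_
    ring

/-- The constant in the estimate of `S₁⁻² S₂⁻¹ V^ε S₂`. -/
def constB (δ : ℝ) : ℝ≥0∞ :=
  max (ENNReal.ofReal Real.pi⁻¹ * (convConst 1 (3 / 4) ^ (1 / 2 : ℝ) *
    convConst 1 (5 / 4) ^ (1 / 2 : ℝ))) 1 +
  ENNReal.ofReal √(2 * Real.pi) * ENNReal.ofReal (gammaPi ((1 + δ) / 2) * gammaPi (1 + δ / 2)) *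
    (convConst ((3 / 2 + δ) / 2) (3 / 4) ^ (1 / 2 : ℝ) *
      convConst ((3 / 2 + δ) / 2) ((3 - δ) / 2) ^ (1 / 2 : ℝ))

theorem constB_lt_top {δ : ℝ} (hδ : 0 < δ) (hδ' : δ ≤ 1) : constB δ < ∞ := by
  refine ENNReal.add_lt_top.2 ⟨?_, ?_⟩
  · refine max_lt (ENNReal.mul_lt_top ENNReal.ofReal_lt_top (ENNReal.mul_lt_top ?_ ?_))
      ENNReal.one_lt_top <;>
    exact sqrt_lt_top (convConst_lt_top (by norm_num) (by norm_num) (by norm_num) (by norm_num))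
  · refine ENNReal.mul_lt_top (ENNReal.mul_lt_top ENNReal.ofReal_lt_top ENNReal.ofReal_lt_top)
      (ENNReal.mul_lt_top ?_ ?_) <;>
    exact sqrt_lt_top (convConst_lt_top (by linarith) (by linarith) (by linarith) (by linarith))

theorem coulombKernel_reg {η : ℝ} (hη : 0 < η) : CoulombKernel (mixKer (mixMeasure (regDensity η))) := by
  filter_upwards [ae_ne 0] with k hk
  have h := mixKer_reg_le hη le_rfl zero_le_two hk
  rw [neg_zero, Real.rpow_zero, ENNReal.ofReal_one, one_mul, add_zero, gammaPi_half, one_mul,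
    zero_div, add_zero, gammaPi_one, sub_zero] at h
  exact h

theorem bil_reg_first_le {η δ : ℝ} (hη : 0 < η) (hδ : 0 < δ) (hδ' : δ ≤ 1) (g f : Hilb) :
    bil (mixKer (mixMeasure (regDensity η))) (fun ξ => esymb (-2) ξ.fst * ‖g ξ‖ₑ)
      (fun ξ => ‖f ξ‖ₑ) ≤ ENNReal.ofReal (η ^ (-δ)) *
        max (ENNReal.ofReal Real.pi⁻¹ * (convConst 1 (3 / 4) ^ (1 / 2 : ℝ) *
          convConst 1 (5 / 4) ^ (1 / 2 : ℝ))) 1 * (‖g‖ₑ * ‖f‖ₑ) := by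
  have hw : ∀ ξ : Config, esymb (-2) ξ.fst ^ 2 * wt 2 0 ξ ≤ 1 := fun ξ => by
    rw [wt, ENNReal.rpow_zero, mul_one]
    exact esymb_sq_mul_le (by norm_num) (by norm_num) ξ.fst
  -- For η ≤ 1 the uniform Coulomb bound suffices, as η^(-δ) ≥ 1. For η ≥ 1 the kernel has total
  -- mass η⁻¹, and η⁻¹ ≤ η^(-δ) uses δ ≤ 1.
  rcases le_total η 1 with h | h
  · have hone : (1 : ℝ≥0∞) ≤ ENNReal.ofReal (η ^ (-δ)) := by
      rw [ENNReal.one_le_ofReal]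
      exact Real.one_le_rpow_of_pos_of_le_one_of_nonpos hη h (by linarith)
    have h1 : bil (mixKer (mixMeasure (regDensity η))) (fun ξ => esymb (-2) ξ.fst * ‖g ξ‖ₑ)
        (fun ξ => ‖f ξ‖ₑ) ≤ bil (fun k => ENNReal.ofReal Real.pi⁻¹ * ‖k‖ₑ ^ (-2 : ℝ))
        (fun ξ => esymb (-2) ξ.fst * ‖g ξ‖ₑ) (fun ξ => 1 * ‖f ξ‖ₑ) :=
      bil_mono (coulombKernel_reg hη) (.of_forall fun _ => le_rfl)
        (.of_forall fun _ => (one_mul _).ge)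
    have h2 := bil_weighted_le (b := 1) (Z := 3 / 2) (W := 5 / 2) (θ := 1) (θ' := 1) (g₁ := 2)
      (g₂ := 0) (f₁ := 0) (f₂ := 0) (w := fun _ => 1) (by norm_num) (by norm_num) (by norm_num)
      (by norm_num) (by norm_num) (by norm_num) (by norm_num) (by norm_num) (by norm_num)
      (by norm_num) (by norm_num) (by norm_num) (by norm_num) (by fun_prop) (by fun_prop) hw
      (fun ξ => by rw [wt_zero]; simp) g f
    rw [bil_const_mul (by fun_prop) (by fun_prop) (by fun_prop)] at h1
    norm_num at h2
    refine h1.trans ?_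
    calc _ ≤ ENNReal.ofReal Real.pi⁻¹ * (convConst 1 (3 / 4) ^ (1 / 2 : ℝ) *
          convConst 1 (5 / 4) ^ (1 / 2 : ℝ) * (‖g‖ₑ * ‖f‖ₑ)) := by
          norm_num
          gcongr
      _ = 1 * (ENNReal.ofReal Real.pi⁻¹ * (convConst 1 (3 / 4) ^ (1 / 2 : ℝ) *
          convConst 1 (5 / 4) ^ (1 / 2 : ℝ))) * (‖g‖ₑ * ‖f‖ₑ) := by ring
      _ ≤ _ := by
          gcongr
          exact le_max_left _ _
  · have h1 := bil_lintegral_le (measurable_mixKer (μ := mixMeasure (regDensity η)))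
      (g := fun ξ => esymb (-2) ξ.fst * ‖g ξ‖ₑ) (f := fun ξ => ‖f ξ‖ₑ) (by fun_prop) (by fun_prop)
    rw [lintegral_mixKer (ae_mixMeasure_pos _), mix_reg hη, norm_zero, zero_add,
      ← enorm_eq_lintegral] at h1
    have h2 : (∫⁻ ξ : Config, (esymb (-2) ξ.fst * ‖g ξ‖ₑ) ^ (2 : ℝ)) ^ (1 / 2 : ℝ) ≤ ‖g‖ₑ := by
      have h3 := sqrt_weight_le 1 (w := fun ξ : Config => esymb (-2) ξ.fst) (a := 0) (c := 0)
        (fun ξ => ?_) g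
      · simpa [wt_zero] using h3
      · rw [wt_zero]
        simpa using esymb_sq_mul_le (s := 2) le_rfl zero_le_two ξ.fst
    have h3 : η⁻¹ ≤ η ^ (-δ) := by
      rw [← Real.rpow_neg_one]
      exact Real.rpow_le_rpow_of_exponent_le h (by linarith)
    refine h1.trans ?_
    rw [mul_assoc]
    refine mul_le_mul' (ENNReal.ofReal_le_ofReal h3) ?_
    calc _ ≤ 1 * (‖g‖ₑ * ‖f‖ₑ) := by
          rw [one_mul]
          gcongr
      _ ≤ _ := by
          gcongr
          exact le_max_right _ _

/-- The weights available, two powers of |ξ₁| and one of |ξ₂| on one side, total 3, while the kernel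
|k|^(b-3) needs 2b. The choice b = 3/2 - δ stays strictly below the endpoint. -/
theorem bil_reg_second_le {η δ : ℝ} (hη : 0 < η) (hδ : 0 < δ) (hδ' : δ ≤ 1) (g f : Hilb) :
    bil (fun k => shiftErr k * mixKer (mixMeasure (regDensity η)) k)
      (fun ξ => esymb (-2) ξ.fst * (esymb (-1) ξ.snd * ‖g ξ‖ₑ)) (fun ξ => ‖f ξ‖ₑ)
      ≤ ENNReal.ofReal (η ^ (-δ)) * (ENNReal.ofReal √(2 * Real.pi) *
        ENNReal.ofReal (gammaPi ((1 + δ) / 2) * gammaPi (1 + δ / 2)) *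
        (convConst ((3 / 2 + δ) / 2) (3 / 4) ^ (1 / 2 : ℝ) *
          convConst ((3 / 2 + δ) / 2) ((3 - δ) / 2) ^ (1 / 2 : ℝ))) * (‖g‖ₑ * ‖f‖ₑ) := by
  have h1 : bil (fun k => shiftErr k * mixKer (mixMeasure (regDensity η)) k)
      (fun ξ => esymb (-2) ξ.fst * (esymb (-1) ξ.snd * ‖g ξ‖ₑ)) (fun ξ => ‖f ξ‖ₑ)
      ≤ bil (fun k => ENNReal.ofReal (η ^ (-δ)) * (ENNReal.ofReal √(2 * Real.pi) *
          ENNReal.ofReal (gammaPi ((1 + δ) / 2) * gammaPi (1 + δ / 2))) *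
          ‖k‖ₑ ^ ((3 / 2 - δ) - 3 : ℝ))
        (fun ξ => (esymb (-2) ξ.fst * esymb (-1) ξ.snd) * ‖g ξ‖ₑ) (fun ξ => 1 * ‖f ξ‖ₑ) := by
    refine bil_mono ?_ (.of_forall fun _ => (mul_assoc _ _ _).ge)
      (.of_forall fun _ => (one_mul _).ge)
    filter_upwards [ae_ne 0] with k hk
    calc _ ≤ shiftErr k * (ENNReal.ofReal (η ^ (-δ)) *
          (ENNReal.ofReal (gammaPi ((1 + δ) / 2) * gammaPi (1 + δ / 2)) * ‖k‖ₑ ^ (-2 - δ))) := by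
          gcongr
          exact mixKer_reg_le hη hδ.le (by linarith) hk
      _ = ENNReal.ofReal (η ^ (-δ)) * (ENNReal.ofReal √(2 * Real.pi) *
          ENNReal.ofReal (gammaPi ((1 + δ) / 2) * gammaPi (1 + δ / 2))) *
          (‖k‖ₑ ^ (1 / 2 : ℝ) * ‖k‖ₑ ^ (-2 - δ)) := by rw [shiftErr]; ring
      _ = _ := by
          rw [enorm_rpow_add hk, show (1 / 2 : ℝ) + (-2 - δ) = 3 / 2 - δ - 3 by ring]
  have hv : ∀ ξ : Config, (esymb (-2) ξ.fst * esymb (-1) ξ.snd) ^ 2 *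
      wt (4 / 3 * (3 / 2 - δ)) (2 / 3 * (3 / 2 - δ)) ξ ≤ 1 := fun ξ => by
    calc _ = (esymb (-2) ξ.fst ^ 2 * ‖ξ.fst‖ₑ ^ (4 / 3 * (3 / 2 - δ))) *
          (esymb (-1) ξ.snd ^ 2 * ‖ξ.snd‖ₑ ^ (2 / 3 * (3 / 2 - δ))) := by rw [wt]; ring
      _ ≤ 1 * 1 := mul_le_mul' (esymb_sq_mul_le (by linarith) (by linarith) ξ.fst)
          (esymb_sq_mul_le (by linarith) (by linarith) ξ.snd)
      _ = 1 := one_mul 1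
  -- No weight on f forces W = Z + b, so finite constants require b < Z < 3 - b; Z = 3/2 is the
  -- midpoint. The value θ = θ' = 2/3 divides the weight 2b in the ratio 2 : 1 of S₁⁻² to S₂⁻¹.
  have h2 := bil_weighted_le (b := 3 / 2 - δ) (Z := 3 / 2) (W := 3 - δ) (θ := 2 / 3) (θ' := 2 / 3)
    (g₁ := 4 / 3 * (3 / 2 - δ)) (g₂ := 2 / 3 * (3 / 2 - δ)) (f₁ := 0) (f₂ := 0) (w := fun _ => 1)
    (by linarith) (by linarith) (by linarith) (by linarith) (by linarith) (by norm_num)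
    (by norm_num) (by norm_num) (by norm_num) (by ring) (by ring) (by ring) (by ring)
    (by fun_prop) (by fun_prop) hv (fun ξ => by rw [wt_zero]; simp) g f
  rw [bil_const_mul (by fun_prop) (by fun_prop) (by fun_prop)] at h1
  refine h1.trans ((mul_le_mul_right h2 _).trans_eq ?_)
  rw [show (3 - (3 / 2 - δ)) / 2 = (3 / 2 + δ) / 2 by ring, show (3 / 2 / 2 : ℝ) = 3 / 4 by norm_num]
  ring

theorem bil_sandwichB_le {η δ : ℝ} (hη : 0 < η) (hδ : 0 < δ) (hδ' : δ ≤ 1) (g f : Hilb) :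
    bil (mixKer (mixMeasure (regDensity η)))
      (fun ξ => esymb (-2) ξ.fst * (esymb (-1) ξ.snd * ‖g ξ‖ₑ))
      (fun ξ => esymb 1 ξ.snd * ‖f ξ‖ₑ) ≤ ENNReal.ofReal (η ^ (-δ)) * constB δ * (‖g‖ₑ * ‖f‖ₑ) := by
  refine (bil_split' measurable_mixKer (by fun_prop) (by fun_prop)
    (by fun_prop) esymb_snd_le).trans ?_
  rw [constB, mul_add, add_mul]
  refine add_le_add (le_trans (le_of_eq ?_) (bil_reg_first_le hη hδ hδ' g f))
    (bil_reg_second_le hη hδ hδ' g f)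
  congr 1
  ext ξ
  calc _ = (esymb 1 ξ.snd * esymb (-1) ξ.snd) * (esymb (-2) ξ.fst * ‖g ξ‖ₑ) := by ring
    _ = _ := by rw [esymb_mul, add_neg_cancel, esymb_zero, one_mul]

/-! ### The products `S₁ S₂⁻¹ W S₁⁻¹ S₂⁻¹` and `S₁⁻² S₂⁻¹ W S₂` -/

theorem norm_le_of_enorm_le {φ ψ : Hilb} {K : ℝ≥0∞} (hK : K ≠ ∞) (h : ‖φ‖ₑ ≤ K * ‖ψ‖ₑ) :
    ‖φ‖ ≤ K.toReal * ‖ψ‖ := by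
  have h1 := ENNReal.toReal_mono (ENNReal.mul_ne_top hK enorm_ne_top) h
  rwa [ENNReal.toReal_mul, toReal_enorm, toReal_enorm] at h1

/-- A potential dominated by the Coulomb potential maps the range of `S₁⁻¹ S₂⁻¹` to `L²`. -/
theorem memLp_mul_of_le_coulomb {W : Config → ℝ} (hWm : Measurable W)
    (hW : ∀ᵐ x : Config, ‖(W x : ℂ)‖ₑ ≤ ‖x.fst - x.snd‖ₑ ^ (-1 : ℝ)) {φ ψ : Hilb}
    (h : ∀ᵐ ξ, ft φ ξ = (symb (-1) ξ.fst * symb (-1) ξ.snd : ℂ) * ft ψ ξ) :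
    MemLp (fun x => (W x : ℂ) * φ x) 2 (volume : Measure Config) := by
  refine (memLp_iff_lintegral ((Complex.measurable_ofReal.comp hWm).aestronglyMeasurable.mul
    (Lp.aestronglyMeasurable φ))).2 ?_
  have h1 : ∫⁻ x, ‖(W x : ℂ) * φ x‖ₑ ^ 2 ≤
      ∫⁻ x : Config, ‖x.fst - x.snd‖ₑ ^ (-2 : ℝ) * ‖φ x‖ₑ ^ 2 := by
    refine lintegral_mono_ae ?_
    filter_upwards [hW] with x hx
    rw [enorm_mul, mul_pow]
    gcongr
    calc ‖(W x : ℂ)‖ₑ ^ 2 ≤ (‖x.fst - x.snd‖ₑ ^ (-1 : ℝ)) ^ 2 := by gcongr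
      _ = _ := by
        rw [← ENNReal.rpow_natCast, ← ENNReal.rpow_mul]
        norm_num
  -- The square of the Coulomb potential is controlled by |ξ₁||ξ₂|, which S₁⁻¹S₂⁻¹ absorbs.
  have h2 := lintegral_rpow_mul_sq_le (a := 2) (t := 1 / 2) (by norm_num) (by norm_num)
    (by norm_num) (by norm_num) φ
  have h3 : ∫⁻ ξ, wt (2 * (1 / 2)) (2 * (1 - 1 / 2)) ξ * ‖ft φ ξ‖ₑ ^ 2 ≤ ‖ft ψ‖ₑ ^ 2 := by
    rw [enorm_sq_eq_lintegral]
    refine lintegral_mono_ae ?_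
    filter_upwards [h] with ξ hξ
    rw [hξ, show (2 * (1 / 2) : ℝ) = 1 by norm_num, show (2 * (1 - 1 / 2) : ℝ) = 1 by norm_num,
      enorm_mul, enorm_mul, enorm_symb, enorm_symb]
    calc _ = ((esymb (-1) ξ.fst * esymb (-1) ξ.snd) ^ 2 * wt 1 1 ξ) * ‖ft ψ ξ‖ₑ ^ 2 := by ring
      _ ≤ 1 * ‖ft ψ ξ‖ₑ ^ 2 := by
        gcongr
        exact esymb_neg_one_mul_wt_le ξ
      _ = _ := one_mul _
  refine (h1.trans (h2.trans (mul_le_mul_right h3 _))).trans_lt ?_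
  exact ENNReal.mul_lt_top (hardyConst_lt_top (by norm_num) (by norm_num))
    (ENNReal.pow_lt_top enorm_lt_top)

theorem normLE_sandwichA {μ : Measure ℝ} [SFinite μ] (hμ : ∀ᵐ u ∂μ, 0 < u)
    (hκ : CoulombKernel (mixKer μ)) {W : Config → ℝ} (hWm : Measurable W)
    (hW : ∀ᵐ x : Config, 0 ≤ W x ∧ ENNReal.ofReal (W x) = mix μ (x.fst - x.snd))
    (hWC : ∀ᵐ x : Config, ‖(W x : ℂ)‖ₑ ≤ ‖x.fst - x.snd‖ₑ ^ (-1 : ℝ)) :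
    NormLE (sandwichA (mulOp volume W)) constA.toReal := by
  -- This one estimate gives both the norm bound and the fact that the vector reached lies in the
  -- domain of the outer S₁, so the product is defined everywhere.
  have key : ∀ ψ φ u : Hilb, (∀ᵐ ξ, ft φ ξ = (symb (-1) ξ.fst * symb (-1) ξ.snd : ℂ) * ft ψ ξ) →
      (∀ᵐ x, u x = (W x : ℂ) * φ x) →
      ∫⁻ ξ, ‖((symb 1 ξ.fst * symb (-1) ξ.snd : ℝ) : ℂ) * ft u ξ‖ₑ ^ 2 ≤ (constA * ‖ψ‖ₑ) ^ 2 := by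
    intro ψ φ u hφ hu
    refine lintegral_mul_sq_le_of_inner (m := fun ξ => symb 1 ξ.fst * symb (-1) ξ.snd)
      (by fun_prop) (fun ξ => (mul_pos (symb_pos _ _) (symb_pos _ _)).le) (ft u)
      fun g χ hχ => ?_
    have h1 := enorm_inner_mul_le hμ hW hu (ft.symm χ)
    rw [LinearIsometryEquiv.apply_symm_apply] at h1
    have h2 := bil_sandwichA_le (measurable_mixKer (μ := μ)) hκ g (ft ψ)
    rw [LinearIsometryEquiv.enorm_map] at h2
    refine (h1.trans (bil_mono (.of_forall fun _ => le_rfl) ?_ ?_)).trans (h2.trans_eq (by ring))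
    · filter_upwards [hχ] with ξ h
      rw [h, Complex.ofReal_mul, enorm_mul, enorm_mul, enorm_symb, enorm_symb, mul_assoc]
    · filter_upwards [hφ] with ξ h
      rw [h, enorm_mul, enorm_mul, enorm_symb, enorm_symb, mul_assoc]
  have comp : ∀ {ψ φ₂ φ : Hilb}, Rel (S₂ (-1)) ψ φ₂ → Rel (S₁ (-1)) φ₂ φ →
      ∀ᵐ ξ, ft φ ξ = (symb (-1) ξ.fst * symb (-1) ξ.snd : ℂ) * ft ψ ξ := by
    intro ψ φ₂ φ h2 h1
    filter_upwards [rel_S₁.1 h1, rel_S₂.1 h2] with ξ e1 e2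
    rw [e1, e2, mul_assoc]
  refine normLE_of_rel dense_univ (fun ψ _ => ?_) fun ψ w hw => ?_
  · obtain ⟨φ₂, h2⟩ := exists_rel_S₂ (s := -1) (by norm_num) ψ
    obtain ⟨φ, h1⟩ := exists_rel_S₁ (s := -1) (by norm_num) φ₂
    have hφ := comp h2 h1
    have hu := memLp_mul_of_le_coulomb hWm hWC hφ
    obtain ⟨u₂, h3⟩ := exists_rel_S₂ (s := -1) (by norm_num) hu.toLp
    have h4 : MemLp (fun ξ : Config => ((symb 1 ξ.fst * symb (-1) ξ.snd : ℝ) : ℂ) *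
        ft hu.toLp ξ) 2 volume := by
      refine (memLp_iff_lintegral (AEStronglyMeasurable.mul (Measurable.aestronglyMeasurable
        (by fun_prop)) (Lp.aestronglyMeasurable _))).2 ?_
      exact (key ψ φ hu.toLp hφ hu.coeFn_toLp).trans_lt
        (ENNReal.pow_lt_top (ENNReal.mul_lt_top constA_lt_top enorm_lt_top))
    refine ⟨ft.symm h4.toLp, rel_opComp.2 ⟨u₂, rel_opComp.2 ⟨hu.toLp, rel_opComp.2
      ⟨φ, rel_opComp.2 ⟨φ₂, h2, h1⟩, rel_mulOp.2 hu.coeFn_toLp⟩, h3⟩, rel_S₁.2 ?_⟩⟩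
    rw [LinearIsometryEquiv.apply_symm_apply]
    filter_upwards [h4.coeFn_toLp, rel_S₂.1 h3] with ξ e1 e2
    rw [e1, e2, Complex.ofReal_mul, mul_assoc]
  · obtain ⟨u₂, hw, h4⟩ := rel_opComp.1 hw
    obtain ⟨u, hw, h3⟩ := rel_opComp.1 hw
    obtain ⟨φ, hw, hu⟩ := rel_opComp.1 hw
    obtain ⟨φ₂, h2, h1⟩ := rel_opComp.1 hw
    refine norm_le_of_enorm_le constA_lt_top.ne ?_
    rw [← ENNReal.pow_le_pow_left_iff two_ne_zero, ← LinearIsometryEquiv.enorm_map ft w,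
      enorm_sq_eq_lintegral]
    refine (lintegral_mono_ae ?_).trans (key ψ φ u (comp h2 h1) (rel_mulOp.1 hu))
    filter_upwards [rel_S₁.1 h4, rel_S₂.1 h3] with ξ e1 e2
    rw [e1, e2, Complex.ofReal_mul, mul_assoc]

/-! ### Application to the Coulomb potential and its regularization. -/

theorem coulombKernel_pow : CoulombKernel (mixKer (mixMeasure (powDensity (1 / 2)))) := by
  filter_upwards [mixKer_pow_ae (a := 1) (by norm_num)] with k hk
  rw [hk, show (3 / 2 - 1 / 2 : ℝ) = 1 by norm_num, gammaPi_one,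
    show (1 - 3 : ℝ) = -2 by norm_num]

theorem enorm_inv_norm {y : Space} (hy : y ≠ 0) :
    ‖((‖y‖⁻¹ : ℝ) : ℂ)‖ₑ = ‖y‖ₑ ^ (-1 : ℝ) := by
  rw [enorm_complex_ofReal (by positivity), ← Real.rpow_neg_one, ofReal_norm_rpow hy]

theorem normLE_sandwichA_coulomb : NormLE (sandwichA V₁₂) constA.toReal := by
  refine normLE_sandwichA (ae_mixMeasure_pos _) coulombKernel_pow
    (W := fun x : Config => V (x.fst - x.snd)) ?_ ?_ ?_
  · unfold V
    fun_prop
  · filter_upwards [ae_sub_ne_zero] with x hx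
    refine ⟨inv_nonneg.2 (norm_nonneg _), ?_⟩
    rw [mix_pow (by norm_num) hx, gammaPi_half, ENNReal.ofReal_one, one_mul, V,
      ← Real.rpow_neg_one, ofReal_norm_rpow hx]
    norm_num
  · filter_upwards [ae_sub_ne_zero] with x hx
    exact (enorm_inv_norm hx).le

theorem reg_pos {ε : ℝ} {N : ℕ} (hε : 0 < ε) (hN : 1 ≤ N) : 0 < ε * (N : ℝ)⁻¹ := by
  have : (0 : ℝ) < N := by exact_mod_cast hN
  positivity

@[fun_prop]
theorem measurable_Vreg (ε : ℝ) (N : ℕ) : Measurable (Vreg ε N) := by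
  unfold Vreg
  fun_prop

theorem Vreg_eq_mix {ε : ℝ} {N : ℕ} (hε : 0 < ε) (hN : 1 ≤ N) (y : Space) :
    0 ≤ Vreg ε N y ∧
      ENNReal.ofReal (Vreg ε N y) = mix (mixMeasure (regDensity (ε * (N : ℝ)⁻¹))) y := by
  have h := reg_pos hε hN
  refine ⟨?_, (mix_reg h y).symm⟩
  unfold Vreg
  positivity

theorem normLE_sandwichA_reg {ε : ℝ} {N : ℕ} (hε : 0 < ε) (hN : 1 ≤ N) :
    NormLE (sandwichA (Vreg₁₂ ε N)) constA.toReal := by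
  have h := reg_pos hε hN
  refine normLE_sandwichA (ae_mixMeasure_pos _) (coulombKernel_reg h)
    (W := fun x : Config => Vreg ε N (x.fst - x.snd)) (by fun_prop)
    (.of_forall fun x => Vreg_eq_mix hε hN _) ?_
  filter_upwards [ae_sub_ne_zero] with x hx
  have hx' := norm_pos_iff.2 hx
  rw [← enorm_inv_norm hx, enorm_complex_ofReal (Vreg_eq_mix hε hN _).1,
    enorm_complex_ofReal (by positivity)]
  refine ENNReal.ofReal_le_ofReal (inv_anti₀ hx' ?_)
  linarith

/-- The potential is bounded by η⁻¹ and the outer factors are bounded, so the product is defined on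
the whole domain of S₂; only the size of the norm needs the form estimate. -/
theorem normLE_sandwichB_reg {ε δ : ℝ} {N : ℕ} (hε : 0 < ε) (hN : 1 ≤ N) (hδ : 0 < δ)
    (hδ' : δ ≤ 1) : NormLE (sandwichB (Vreg₁₂ ε N))
      ((constB δ).toReal * (ε * (N : ℝ)⁻¹) ^ (-δ)) := by
  have hη := reg_pos hε hN
  set η := ε * (N : ℝ)⁻¹ with hηdef
  have hb : ∀ x : Config, |Vreg ε N (x.fst - x.snd)| ≤ η⁻¹ := fun x => by
    rw [abs_of_nonneg (Vreg_eq_mix hε hN _).1]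
    exact inv_anti₀ hη (le_add_of_nonneg_left (norm_nonneg _))
  refine normLE_of_rel dense_S₂_domain (fun ψ hψ => ?_) fun ψ w hw => ?_
  · have hu := memLp_mul_of_bound (m := fun x : Config => Vreg ε N (x.fst - x.snd)) (by fun_prop)
      (.of_forall hb) (S₂ 1 ⟨ψ, hψ⟩)
    obtain ⟨u₂, h3⟩ := exists_rel_S₂ (s := -1) (by norm_num) hu.toLp
    obtain ⟨w, h4⟩ := exists_rel_S₁ (s := -2) (by norm_num) u₂
    exact ⟨w, rel_opComp.2 ⟨u₂, rel_opComp.2 ⟨hu.toLp, rel_opComp.2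
      ⟨_, ⟨hψ, rfl⟩, rel_mulOp.2 hu.coeFn_toLp⟩, h3⟩, h4⟩⟩
  · obtain ⟨u₂, hw, h4⟩ := rel_opComp.1 hw
    obtain ⟨u, hw, h3⟩ := rel_opComp.1 hw
    obtain ⟨φ, h2, hu⟩ := rel_opComp.1 hw
    have hK : ENNReal.ofReal (η ^ (-δ)) * constB δ ≠ ∞ :=
      ENNReal.mul_ne_top ENNReal.ofReal_ne_top (constB_lt_top hδ hδ').ne
    have e : (constB δ).toReal * η ^ (-δ) = (ENNReal.ofReal (η ^ (-δ)) * constB δ).toReal := by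
      rw [ENNReal.toReal_mul, ENNReal.toReal_ofReal (by positivity), mul_comm]
    rw [e]
    refine norm_le_of_enorm_le hK ?_
    have key : ∫⁻ ξ, ‖((symb (-2) ξ.fst * symb (-1) ξ.snd : ℝ) : ℂ) * ft u ξ‖ₑ ^ 2
        ≤ (ENNReal.ofReal (η ^ (-δ)) * constB δ * ‖ψ‖ₑ) ^ 2 := by
      refine lintegral_mul_sq_le_of_inner (m := fun ξ => symb (-2) ξ.fst * symb (-1) ξ.snd)
        (by fun_prop) (fun ξ => (mul_pos (symb_pos _ _) (symb_pos _ _)).le) (ft u)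
        fun g χ hχ => ?_
      have h1 := enorm_inner_mul_le (ae_mixMeasure_pos _)
        (.of_forall fun x => Vreg_eq_mix hε hN _) (rel_mulOp.1 hu) (ft.symm χ)
      rw [LinearIsometryEquiv.apply_symm_apply] at h1
      have h5 := bil_sandwichB_le hη hδ hδ' g (ft ψ)
      rw [LinearIsometryEquiv.enorm_map] at h5
      refine (h1.trans (bil_mono (.of_forall fun _ => le_rfl) ?_ ?_)).trans (h5.trans_eq (by ring))
      · filter_upwards [hχ] with ξ h
        rw [h, Complex.ofReal_mul, enorm_mul, enorm_mul, enorm_symb, enorm_symb, mul_assoc]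
      · filter_upwards [rel_S₂.1 h2] with ξ h
        rw [h, enorm_mul, enorm_symb]
    rw [← ENNReal.pow_le_pow_left_iff two_ne_zero, ← LinearIsometryEquiv.enorm_map ft w,
      enorm_sq_eq_lintegral]
    refine (lintegral_mono_ae ?_).trans key
    filter_upwards [rel_S₁.1 h4, rel_S₂.1 h3] with ξ e1 e2
    rw [e1, e2, Complex.ofReal_mul, mul_assoc]

theorem NormLE.mono {T : Hilb →ₗ.[ℂ] Hilb} {C C' : ℝ} (h : NormLE T C) (hC : C ≤ C') :
    NormLE T C' :=
  ⟨h.1, fun ψ => (h.2 ψ).trans (mul_le_mul_of_nonneg_right hC (norm_nonneg _))⟩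

theorem exists_normLE_sandwichB {δ : ℝ} (hδ : 0 < δ) : ∃ C : ℝ, ∀ (ε : ℝ) (N : ℕ), 0 < ε →
    1 ≤ N → (δ ≤ 1 ∨ ε ≤ N) →
      NormLE (sandwichB (Vreg₁₂ ε N)) (C * ε ^ (-δ) * (N : ℝ) ^ δ) := by
  -- The estimate is proved for exponents at most 1. For δ > 1 the exponent 1 is used, and ε ≤ N
  -- means η ≤ 1, so η⁻¹ ≤ η^(-δ).
  refine ⟨(constB (min δ 1)).toReal, fun ε N hε hN h => ?_⟩
  have hN' : (0 : ℝ) < N := by exact_mod_cast hN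
  refine (normLE_sandwichB_reg hε hN (lt_min hδ one_pos) (min_le_right δ 1)).mono ?_
  have e : ε ^ (-δ) * (N : ℝ) ^ δ = (ε * (N : ℝ)⁻¹) ^ (-δ) := by
    rw [Real.mul_rpow hε.le (by positivity), Real.inv_rpow hN'.le, Real.rpow_neg hN'.le, inv_inv]
  rw [mul_assoc, e]
  refine mul_le_mul_of_nonneg_left ?_ ENNReal.toReal_nonneg
  rcases le_total δ 1 with h1 | h1
  · rw [min_eq_left h1]
  · rcases h with h | h
    · rw [min_eq_left h]
    · refine Real.rpow_le_rpow_of_exponent_ge (reg_pos hε hN) ?_ (neg_le_neg (min_le_left δ 1))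
      rw [← div_eq_mul_inv]
      exact (div_le_one hN').2 h

end TwoParticle

end

theorem lemma9p1 :
    -- (i): the bound for all `a < 3`, with a constant depending only on `a`
    (∀ a : ℝ, a < 3 → ∃ C : ℝ, ∀ α β : ℝ, 0 < α → 0 < β → α + β = 2 * a →
      TwoParticle.LeSS (fun x => 1 / ‖x.fst - x.snd‖ ^ a) C α β) ∧
    -- (i): for `a = 1` the constant `π / 2` is admissible, and no smaller constant is
    (∀ α β : ℝ, 0 < α → 0 < β → α + β = 2 →
      TwoParticle.LeSS (fun x => TwoParticle.V (x.fst - x.snd)) (Real.pi / 2) α β ∧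
      ∀ c : ℝ, TwoParticle.LeSS (fun x => TwoParticle.V (x.fst - x.snd)) c α β →
        Real.pi / 2 ≤ c) ∧
    -- (ii)
    (∃ C : ℝ, TwoParticle.NormLE (TwoParticle.sandwichA TwoParticle.V₁₂) C) ∧
    (∃ C : ℝ, ∀ (ε : ℝ) (N : ℕ), 0 < ε → 1 ≤ N →
      TwoParticle.NormLE (TwoParticle.sandwichA (TwoParticle.Vreg₁₂ ε N)) C) ∧
    -- (iii)
    (∀ δ : ℝ, 0 < δ → ∃ C : ℝ, ∀ (ε : ℝ) (N : ℕ), 0 < ε → 1 ≤ N → (δ ≤ 1 ∨ ε ≤ N) →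
      TwoParticle.NormLE (TwoParticle.sandwichB (TwoParticle.Vreg₁₂ ε N))
        (C * ε ^ (-δ) * (N : ℝ) ^ δ)) :=
  ⟨TwoParticle.exists_leSS_rpow,
    fun _ _ hα hβ h => ⟨TwoParticle.leSS_coulomb hα hβ h,
      fun _ hc => TwoParticle.pi_div_two_le_of_leSS hα hβ h hc⟩,
    ⟨_, TwoParticle.normLE_sandwichA_coulomb⟩,
    ⟨_, fun _ _ hε hN => TwoParticle.normLE_sandwichA_reg hε hN⟩,
    fun _ hδ => TwoParticle.exists_normLE_sandwichB hδ⟩
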